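/- **Proposition 3.2 (action spectrum of the rotating Kepler problem).** Let $$H_R(q,p)=\tfrac12|p|^2-\tfrac1{|q|}+L(q,p),\qquad L(q,p)=p_1q_2-p_2q_1,\qquad (q,p)\in(\mathbb R^2\setminus\{0\})\times\mathbb R^2 .$$ Let $\Phi:T^*\mathbb R^2\to T^*(S^2\setminus\{N\})$ be the cotangent lift of inverse stereographic projection from the north pole $N$, and let $\Psi$ be the exchange of position and momentum $(q,p)\mapsto(x,y)=(-p,q)$. For $c>\frac32$ let $\Sigma_R^c$ be the bounded connected component of the closure in $T^*S^2$ of $\Phi\circ\Psi(H_R^{-1}(-c))$ (the energy hypersurface of the regularized rotating Kepler problem at energy $-c$), and let $\lambda_{can}$ be the Liouville 1-form of $T^*S^2$. Let $\mathrm{Spec}(\Sigma_R^c,\lambda_{can})$ be the set of all positive (not necessarily minimal) periods of closed orbits of the Reeb flow of $(\Sigma_R^c,\lambda_{can}|_{\Sigma_R^c})$. Write $\mathbb N=\{1,2,3,\dots\}$. A circular orbit on $\Sigma_R^c$ is a solution of Hamilton's equations of $H_R$ of energy $-c$ whose image under $\Phi\circ\Psi$ lies in $\Sigma_R^c$ and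 along which $|q|$ is constant; it is called retrograde if $L>0$ along it and direct if $L<0$ along it. The action of such an orbit is the integral of $\lambda_{can}$ along its image in $\Sigma_R^c$ over one minimal period. Then for every $c>\frac32$ the equation $c=\frac1{2x^2}-x$ has exactly one solution $x=L_R(c)$ with $x>0$ and exactly one solution $x=L_D(c)$ with $-1<x<0$, and $$\mathrm{Spec}(\Sigma_R^c,\lambda_{can})=2\pi L_R(c)\,\mathbb N\ \cup\ (-2\pi L_D(c))\,\mathbb N\ \cup\ \Big\{2\pi\big(-lc+\tfrac32k^{2/3}l^{1/3}\big)\ :\ k,l\in\mathbb N,\ k>l,\ \tfrac lk\in\big(L_R(c)^3,-L_D(c)^3\big)\Big\}.$$ Moreover, retrograde and direct orbits on $\Sigma_R^c$ exist and have minimal periods; every retrograde orbit has action $2\pi L_R(c)$ and every direct orbit has action $-2\pi L_D(c)$. The first set is exactly the set of periods of the closed Reeb orbits that trace a retrograde orbit (its covers), the second is exactly the set of periods of the closed Reeb orbits that trace a direct orbit (its covers), and the third is exactly the set of periods of the remaining closed Reeb orbits, those that trace no circular orbit (the torus-type orbits, including closed collision orbits). -/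

import Mathlib

open scoped RealInnerProductSpace

noncomputable section

namespace RotatingKepler

/-- The Euclidean plane. -/
abbrev Plane : Type := EuclideanSpace ℝ (Fin 2)

/-- Euclidean three-space, containing the unit sphere `S²`. -/
abbrev Space : Type := EuclideanSpace ℝ (Fin 3)

/-! ### The cotangent bundle of the sphere -/

/-- `T*S²` as a submanifold of `ℝ³ × ℝ³`: a point `ξ` of the unit sphere together with a covector,
represented (through the Euclidean inner product) by a vector `η` tangent to the sphere at `ξ`. -/
def cotangentSphere : Set (Space × Space) :=
  {z | ‖z.1‖ = 1 ∧ ⟪z.1, z.2⟫ = 0}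

/-- The Liouville form `λ_can` at `z = (ξ, η)`, evaluated on a vector `v` of the ambient space:
the covector `η` applied to the base component of `v`. Only its restriction to `T*S²` matters. -/
def liouville (z v : Space × Space) : ℝ := ⟪z.2, v.1⟫

/-- The exterior derivative `dλ_can(v, w)` (it does not depend on the base point). -/
def dLiouville (v w : Space × Space) : ℝ := ⟪v.2, w.1⟫ - ⟪w.2, v.1⟫

/-- `dLiouville` is the exterior derivative of `liouville`. -/
theorem dLiouville_eq (z v w : Space × Space) :
    dLiouville v w =
      fderiv ℝ (fun u => liouville u w) z v - fderiv ℝ (fun u => liouville u v) z w := by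
  have h : ∀ a b : Space × Space, fderiv ℝ (fun u => liouville u a) z b = ⟪b.2, a.1⟫ := by
    intro a b
    have h1 : HasFDerivAt (fun u : Space × Space => liouville u a)
        ((innerSL ℝ a.1).comp (ContinuousLinearMap.snd ℝ Space Space)) z := by
      have := ((innerSL ℝ a.1).comp (ContinuousLinearMap.snd ℝ Space Space)).hasFDerivAt (x := z)
      refine this.congr_of_eventuallyEq (Filter.Eventually.of_forall fun u => ?_)
      simp [liouville, real_inner_comm]
    rw [h1.fderiv]
    simp [real_inner_comm]
  rw [h, h, dLiouville]

/-! ### Reeb orbits and the action spectrum -/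

/-- The tangent vectors at `z` of a submanifold `S` of a normed space: the velocities at `z` of
curves that run in `S`. -/
def tangentVectors {V : Type*} [NormedAddCommGroup V] [NormedSpace ℝ V] (S : Set V) (z : V) :
    Set V :=
  {v | ∃ σ : ℝ → V, σ 0 = z ∧ (∀ᶠ s in nhds 0, σ s ∈ S) ∧ HasDerivAt σ v 0}

/-- `R` is the value at `z` of the Reeb vector field of `(S, λ_can|_S)`:
`λ_can(R) = 1` and `ι_R dλ_can = 0` on the tangent space of `S`. -/
structure IsReebVector (S : Set (Space × Space)) (z R : Space × Space) : Prop where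
  tangent : R ∈ tangentVectors S z
  normalized : liouville z R = 1
  kernel : ∀ v ∈ tangentVectors S z, dLiouville R v = 0

/-- `γ` is an orbit of the Reeb flow on `(S, λ_can|_S)`, defined for all times. -/
structure IsReebOrbit (S : Set (Space × Space)) (γ : ℝ → Space × Space) : Prop where
  mem : ∀ t, γ t ∈ S
  reeb : ∀ t, ∃ R, HasDerivAt γ R t ∧ IsReebVector S (γ t) R

/-- `γ` is a closed Reeb orbit with (positive, not necessarily minimal) period `T`. -/
def IsClosedReebOrbit (S : Set (Space × Space)) (γ : ℝ → Space × Space) (T : ℝ) : Prop :=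
  IsReebOrbit S γ ∧ 0 < T ∧ Function.Periodic γ T

/-- The action spectrum `Spec(S, λ_can)`: the set of all positive periods of closed Reeb orbits. -/
def actionSpectrum (S : Set (Space × Space)) : Set ℝ :=
  {T | ∃ γ, IsClosedReebOrbit S γ T}

/-! ### The regularized energy hypersurface -/

/-- The integral `L = p₁ q₂ - p₂ q₁`. -/
def angular (q p : Plane) : ℝ := p 0 * q 1 - p 1 * q 0

/-- The Hamiltonian `H_R` of the rotating Kepler problem (meaningful for `q ≠ 0`). -/
def hamiltonian (q p : Plane) : ℝ := (1 / 2) * ‖p‖ ^ 2 - 1 / ‖q‖ + angular q p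

/-- The energy hypersurface `H_R⁻¹(-c)` in `T*(ℝ² - {0})`. -/
def energyLevel (c : ℝ) : Set (Plane × Plane) :=
  {z | z.1 ≠ 0 ∧ hamiltonian z.1 z.2 = -c}

/-- Inverse stereographic projection `φ : ℝ² → S² - {N}` from the north pole `N = (0, 0, 1)`. -/
def stereo (x : Plane) : Space :=
  !₂[2 * x 0 / (‖x‖ ^ 2 + 1), 2 * x 1 / (‖x‖ ^ 2 + 1), (‖x‖ ^ 2 - 1) / (‖x‖ ^ 2 + 1)]

/-- The covector at `stereo x` that corresponds to the covector `y` at `x`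
under the cotangent lift of `stereo`. -/
def stereoCovector (x y : Plane) : Space :=
  !₂[(‖x‖ ^ 2 + 1) / 2 * y 0 - ⟪x, y⟫ * x 0, (‖x‖ ^ 2 + 1) / 2 * y 1 - ⟪x, y⟫ * x 1, ⟪x, y⟫]

/-- The canonical chart `Φ : T*ℝ² → T*(S² - {N})`, the cotangent lift of `stereo`. -/
def cotangentLift (x y : Plane) : Space × Space := (stereo x, stereoCovector x y)

/-- `cotangentLift` takes values in `T*S²`. -/
theorem cotangentLift_mem (x y : Plane) : cotangentLift x y ∈ cotangentSphere := by
  have hx : ‖x‖ ^ 2 = x 0 ^ 2 + x 1 ^ 2 := by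
    rw [EuclideanSpace.norm_sq_eq, Fin.sum_univ_two]; simp
  have hpos : x 0 ^ 2 + x 1 ^ 2 + 1 ≠ 0 := by positivity
  constructor
  · have : ‖stereo x‖ ^ 2 = 1 := by
      rw [EuclideanSpace.norm_sq_eq, Fin.sum_univ_three]
      simp only [stereo, Real.norm_eq_abs, sq_abs]
      simp [hx]
      field_simp
      ring
    have h0 := norm_nonneg (stereo x)
    change ‖stereo x‖ = 1
    nlinarith
  · simp [cotangentLift, stereo, stereoCovector, PiLp.inner_apply, Fin.sum_univ_three, hx]
    field_simp
    ring

/-- `cotangentLift` is the cotangent lift of `stereo`: the covector at `stereo x`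
pulls back to the covector `y`. -/
theorem stereoCovector_spec (x y v : Plane) :
    ⟪stereoCovector x y, fderiv ℝ stereo x v⟫ = ⟪y, v⟫ := by
  have hx : ∀ x : Plane, ‖x‖ ^ 2 = x 0 ^ 2 + x 1 ^ 2 := by
    intro x; rw [EuclideanSpace.norm_sq_eq, Fin.sum_univ_two]; simp
  have hpos : x 0 ^ 2 + x 1 ^ 2 + 1 ≠ 0 := by positivity
  have hn : HasFDerivAt (fun x : Plane => ‖x‖ ^ 2) (2 • (innerSL ℝ x)) x :=
    (hasStrictFDerivAt_norm_sq x).hasFDerivAt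
  have hne : ‖x‖ ^ 2 + 1 ≠ 0 := by positivity
  have hi : HasFDerivAt (fun x : Plane => (‖x‖ ^ 2 + 1)⁻¹)
      (-((‖x‖ ^ 2 + 1) ^ 2)⁻¹ • (2 • (innerSL ℝ x))) x :=
    (hasDerivAt_inv hne).comp_hasFDerivAt x (hn.add_const 1)
  have hc : ∀ i : Fin 2, HasFDerivAt (fun x : Plane => x i)
      (EuclideanSpace.proj i : Plane →L[ℝ] ℝ) x := fun i =>
    (EuclideanSpace.proj i : Plane →L[ℝ] ℝ).hasFDerivAt
  have hd : DifferentiableAt ℝ stereo x := by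
    rw [differentiableAt_euclidean]
    intro i
    fin_cases i
    · simpa [stereo, div_eq_mul_inv] using
        ((((hc 0).const_mul 2).fun_mul hi).differentiableAt)
    · simpa [stereo, div_eq_mul_inv] using
        ((((hc 1).const_mul 2).fun_mul hi).differentiableAt)
    · simpa [stereo, div_eq_mul_inv] using
        (((hn.sub_const 1).fun_mul hi).differentiableAt)
  have hcomp : ∀ i : Fin 3, (fderiv ℝ stereo x v) i = fderiv ℝ (fun x => stereo x i) x v := by
    intro i
    have := ((EuclideanSpace.proj i : Space →L[ℝ] ℝ).hasFDerivAt.comp x hd.hasFDerivAt).fderiv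
    have h2 : fderiv ℝ (fun x => stereo x i) x
        = (EuclideanSpace.proj i : Space →L[ℝ] ℝ).comp (fderiv ℝ stereo x) := this
    rw [h2]; rfl
  have h0 : fderiv ℝ (fun x => stereo x 0) x v
      = 2 * x 0 * (-((‖x‖ ^ 2 + 1) ^ 2)⁻¹ * (2 * ⟪x, v⟫)) + (‖x‖ ^ 2 + 1)⁻¹ * (2 * v 0) := by
    have e : (fun x : Plane => stereo x 0) = fun x => 2 * x 0 * (‖x‖ ^ 2 + 1)⁻¹ := by
      funext x; simp [stereo, div_eq_mul_inv]
    have d := ((hc 0).const_mul 2).fun_mul hi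
    rw [e, d.fderiv]; simp
  have h1 : fderiv ℝ (fun x => stereo x 1) x v
      = 2 * x 1 * (-((‖x‖ ^ 2 + 1) ^ 2)⁻¹ * (2 * ⟪x, v⟫)) + (‖x‖ ^ 2 + 1)⁻¹ * (2 * v 1) := by
    have e : (fun x : Plane => stereo x 1) = fun x => 2 * x 1 * (‖x‖ ^ 2 + 1)⁻¹ := by
      funext x; simp [stereo, div_eq_mul_inv]
    have d := ((hc 1).const_mul 2).fun_mul hi
    rw [e, d.fderiv]; simp
  have h2 : fderiv ℝ (fun x => stereo x 2) x v
      = (‖x‖ ^ 2 - 1) * (-((‖x‖ ^ 2 + 1) ^ 2)⁻¹ * (2 * ⟪x, v⟫))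
        + (‖x‖ ^ 2 + 1)⁻¹ * (2 * ⟪x, v⟫) := by
    have e : (fun x : Plane => stereo x 2) = fun x => (‖x‖ ^ 2 - 1) * (‖x‖ ^ 2 + 1)⁻¹ := by
      funext x; simp [stereo, div_eq_mul_inv]
    have d := (hn.sub_const 1).fun_mul hi
    rw [e, d.fderiv]; simp
  rw [PiLp.inner_apply, Fin.sum_univ_three, hcomp, hcomp, hcomp, h0, h1, h2]
  simp [stereoCovector, PiLp.inner_apply, Fin.sum_univ_two, hx]
  field_simp
  ring

/-- The regularization `Φ ∘ Ψ`: exchange position and momentum by `q = y`, `p = -x`,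
and apply the canonical chart of `T*S²`. It pulls `λ_can` back to `-q dp`. -/
def regularize (q p : Plane) : Space × Space := cotangentLift (-p) q

/-- The closure in `T*S²` of the image of the energy hypersurface `H_R⁻¹(-c)`. -/
def closedLevel (c : ℝ) : Set (Space × Space) :=
  cotangentSphere ∩ closure ((fun z => regularize z.1 z.2) '' energyLevel c)

/-- The regularized energy hypersurface `Σ_R^c`: the bounded component of `closedLevel c`,
i.e. the points whose connected component in `closedLevel c` is bounded. -/
def hypersurface (c : ℝ) : Set (Space × Space) :=
  {z ∈ closedLevel c | Bornology.IsBounded (connectedComponentIn (closedLevel c) z)}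

/-! ### Circular orbits -/

/-- `t ↦ (q t, p t)` solves Hamilton's equations `q̇ = ∂H_R/∂p`, `ṗ = -∂H_R/∂q`. -/
structure IsSolution (q p : ℝ → Plane) : Prop where
  ne_zero : ∀ t, q t ≠ 0
  deriv_q : ∀ t, HasDerivAt q (gradient (fun p' => hamiltonian (q t) p') (p t)) t
  deriv_p : ∀ t, HasDerivAt p (-gradient (fun q' => hamiltonian q' (p t)) (q t)) t

/-- A circular orbit of the rotating Kepler problem on `Σ_R^c`: a solution of energy `-c` in the
bounded component whose distance from the origin is constant. -/
structure IsCircularOrbit (c : ℝ) (q p : ℝ → Plane) : Prop where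
  solution : IsSolution q p
  energy : ∀ t, hamiltonian (q t) (p t) = -c
  mem : ∀ t, regularize (q t) (p t) ∈ hypersurface c
  circular : ∃ r : ℝ, ∀ t, ‖q t‖ = r

/-- The retrograde circular orbit, revolving against the rotation of the coordinates: `L > 0`. -/
def IsRetrograde (c : ℝ) (q p : ℝ → Plane) : Prop :=
  IsCircularOrbit c q p ∧ ∀ t, 0 < angular (q t) (p t)

/-- The direct circular orbit, revolving with the rotation of the coordinates: `L < 0`. -/
def IsDirect (c : ℝ) (q p : ℝ → Plane) : Prop :=
  IsCircularOrbit c q p ∧ ∀ t, angular (q t) (p t) < 0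

/-- `T` is the minimal positive period of `t ↦ (q t, p t)`. -/
def IsSimplePeriod (q p : ℝ → Plane) (T : ℝ) : Prop :=
  IsLeast {S : ℝ | 0 < S ∧ Function.Periodic (fun t => (q t, p t)) S} T

/-- The action over `[0, T]` of an orbit in the original coordinates:
the integral of `λ_can` along its image in `T*S²`. -/
def action (q p : ℝ → Plane) (T : ℝ) : ℝ :=
  ∫ t in (0 : ℝ)..T,
    liouville (regularize (q t) (p t)) (deriv (fun s => regularize (q s) (p s)) t)

/-- The curve `γ` in `T*S²` runs along the image of the orbit `(q, p)`, up to parametrization and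
possibly covering it several times. -/
def Traces (γ : ℝ → Space × Space) (q p : ℝ → Plane) : Prop :=
  Set.range γ = Set.range (fun t => regularize (q t) (p t))

end RotatingKepler

end

noncomputable section

namespace RotatingKepler


/-! ### Coordinates -/

/-! Write `(ξ, η)` for a point of `T*S²`, `N = ‖η‖` and `L = ang (ξ, η)`. Multiplying `H_R + c` by
`|q| = N (1 - ξ₂)` turns the energy equation into `N (1 + (1 - ξ₂)(c - 1/2 + L)) = 1`, which is
regular over the north pole; this is `level`. On a ray of a cotangent fibre it is an equation of
degree at most two in `N`, with positive discriminant because `c > 3/2`. Hence `radial` never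
vanishes on `level`. Where it is positive, `N < 2`; where it is negative, a curve in the fibre
escapes to infinity. So `Σ_R^c` is `level` with `radial > 0` (`mem_hypersurface_iff`).

The Reeb field is the Hamiltonian field of the regularized Hamiltonian divided by `1 + L|q|`, and
Reeb orbits are exactly its integral curves (`isReebOrbit_iff`). Along them `L` is constant, and in
inertial coordinates the motion is Keplerian of energy `-(c + L)`. Put `w² = 2(c + L)` and `e² = 1 -
w² L²`. Besides the Reeb time `t` there are the regularized time `s` and the physical time `τ`, with
`dτ = |q| ds` and `dt = ds + L dτ`. The planar vector `(w²|q| - 1, -w η₂)` turns by the angle `w s`,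
the Runge-Lenz vector turns by the angle `τ` of the rotating frame, and both have length `e`. If `e
≠ 0`, a period `T` therefore forces `w s = 2πk` and `τ = 2πl`. Kepler's equation gives `τ = s / w²`
over a period, so `k = l w³` and `T = s + Lτ = 2π(k/w + lL)` (`noncircular_period`). Substituting `L
= w²/2 - c` yields the third family (`exists_frequency_iff`). If `e = 0`, the position turns at the
constant rate `1/L` in Reeb time, so the periods are the positive multiples of `2π|L|`
(`circular_periodic_iff`).

Conversely, every ellipse with admissible `L` is written down explicitly through its eccentric
anomaly (`exists_orbit`); collisions are the case `L = 0`. The range of `L` comes from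
`neg_one_lt_ang`: on `Σ_R^c` one has `L > -1`, and there `e² = 0` exactly at `L_R` and `L_D`, while
`e² > 0` exactly between them. -/

theorem plane_inner (a b : Plane) : ⟪a, b⟫ = a 0 * b 0 + a 1 * b 1 := by
  simp [PiLp.inner_apply, Fin.sum_univ_two, mul_comm]

theorem plane_norm_sq (a : Plane) : ‖a‖ ^ 2 = a 0 ^ 2 + a 1 ^ 2 := by
  rw [EuclideanSpace.norm_sq_eq, Fin.sum_univ_two]; simp

theorem space_inner (a b : Space) : ⟪a, b⟫ = a 0 * b 0 + a 1 * b 1 + a 2 * b 2 := by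
  simp [PiLp.inner_apply, Fin.sum_univ_three, mul_comm]

theorem space_norm_sq (a : Space) : ‖a‖ ^ 2 = a 0 ^ 2 + a 1 ^ 2 + a 2 ^ 2 := by
  rw [EuclideanSpace.norm_sq_eq, Fin.sum_univ_three]; simp

theorem plane_ext {a b : Plane} (h0 : a 0 = b 0) (h1 : a 1 = b 1) : a = b := by
  ext i; fin_cases i <;> assumption

theorem space_ext {a b : Space} (h0 : a 0 = b 0) (h1 : a 1 = b 1) (h2 : a 2 = b 2) : a = b := by
  ext i; fin_cases i <;> assumption

theorem space_norm_eq_one {a : Space} : ‖a‖ = 1 ↔ a 0 ^ 2 + a 1 ^ 2 + a 2 ^ 2 = 1 := by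
  rw [← space_norm_sq]
  constructor
  · intro h; rw [h]; norm_num
  · intro h
    have := norm_nonneg a
    nlinarith

theorem hasDerivAt_euclidean_iff {n : ℕ} {f : ℝ → EuclideanSpace ℝ (Fin n)}
    {v : EuclideanSpace ℝ (Fin n)} {t : ℝ} :
    HasDerivAt f v t ↔ ∀ i, HasDerivAt (fun s => f s i) (v i) t := by
  rw [← hasDerivWithinAt_univ, hasDerivWithinAt_iff_hasFDerivWithinAt, hasFDerivWithinAt_euclidean]
  refine forall_congr' fun i => ?_
  rw [hasFDerivWithinAt_univ, hasDerivAt_iff_hasFDerivAt]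
  have : (PiLp.proj 2 (fun _ : Fin n => ℝ) i : EuclideanSpace ℝ (Fin n) →L[ℝ] ℝ).comp
      (ContinuousLinearMap.toSpanSingleton ℝ v) = ContinuousLinearMap.toSpanSingleton ℝ (v i) := by
    ext; simp
  rw [this]

theorem hasDerivAt_plane_iff {f : ℝ → Plane} {v : Plane} {t : ℝ} :
    HasDerivAt f v t ↔
      HasDerivAt (fun s => f s 0) (v 0) t ∧ HasDerivAt (fun s => f s 1) (v 1) t := by
  rw [hasDerivAt_euclidean_iff, Fin.forall_fin_two]

theorem hasDerivAt_space_iff {f : ℝ → Space} {v : Space} {t : ℝ} :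
    HasDerivAt f v t ↔ HasDerivAt (fun s => f s 0) (v 0) t ∧
      HasDerivAt (fun s => f s 1) (v 1) t ∧ HasDerivAt (fun s => f s 2) (v 2) t := by
  rw [hasDerivAt_euclidean_iff, Fin.forall_fin_succ, Fin.forall_fin_two]; rfl

theorem hasDerivAt_fst {f : ℝ → Space × Space} {v : Space × Space} {t : ℝ}
    (h : HasDerivAt f v t) : HasDerivAt (fun s => (f s).1) v.1 t :=
  (ContinuousLinearMap.fst ℝ Space Space).hasFDerivAt.comp_hasDerivAt t h

theorem hasDerivAt_snd {f : ℝ → Space × Space} {v : Space × Space} {t : ℝ}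
    (h : HasDerivAt f v t) : HasDerivAt (fun s => (f s).2) v.2 t :=
  (ContinuousLinearMap.snd ℝ Space Space).hasFDerivAt.comp_hasDerivAt t h

/-! ### The regularizing chart -/

/-- The integral `L` as a function on `T*S²`. -/
def ang (z : Space × Space) : ℝ := z.1 1 * z.2 0 - z.1 0 * z.2 1

/-- The position `q`, as a function on `T*S²`. -/
def pos (z : Space × Space) : Plane :=
  !₂[(1 - z.1 2) * z.2 0 + z.2 2 * z.1 0, (1 - z.1 2) * z.2 1 + z.2 2 * z.1 1]

/-- The momentum `p`, as a function on `T*S²` without the fibre over the north pole. -/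
def mom (z : Space × Space) : Plane :=
  !₂[-z.1 0 / (1 - z.1 2), -z.1 1 / (1 - z.1 2)]

theorem regularize_fst_zero (q p : Plane) : (regularize q p).1 0 = -2 * p 0 / (‖p‖ ^ 2 + 1) := by
  simp [regularize, cotangentLift, stereo]

theorem regularize_fst_one (q p : Plane) : (regularize q p).1 1 = -2 * p 1 / (‖p‖ ^ 2 + 1) := by
  simp [regularize, cotangentLift, stereo]

theorem regularize_fst_two (q p : Plane) :
    (regularize q p).1 2 = (‖p‖ ^ 2 - 1) / (‖p‖ ^ 2 + 1) := by
  simp [regularize, cotangentLift, stereo]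

theorem regularize_snd_zero (q p : Plane) :
    (regularize q p).2 0 = (‖p‖ ^ 2 + 1) / 2 * q 0 - ⟪p, q⟫ * p 0 := by
  simp [regularize, cotangentLift, stereoCovector]

theorem regularize_snd_one (q p : Plane) :
    (regularize q p).2 1 = (‖p‖ ^ 2 + 1) / 2 * q 1 - ⟪p, q⟫ * p 1 := by
  simp [regularize, cotangentLift, stereoCovector]

theorem regularize_snd_two (q p : Plane) : (regularize q p).2 2 = -⟪p, q⟫ := by
  simp [regularize, cotangentLift, stereoCovector]

theorem one_sub_regularize_fst_two (q p : Plane) :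
    1 - (regularize q p).1 2 = 2 / (‖p‖ ^ 2 + 1) := by
  rw [regularize_fst_two]
  have : ‖p‖ ^ 2 + 1 ≠ 0 := by positivity
  field_simp; ring

/-- Stereographic projection is conformal with factor `2 / (‖p‖² + 1)`, so covectors are stretched
by the inverse factor. -/
theorem norm_regularize_snd (q p : Plane) :
    ‖(regularize q p).2‖ = (‖p‖ ^ 2 + 1) / 2 * ‖q‖ := by
  rw [← sq_eq_sq₀ (norm_nonneg _) (by positivity), space_norm_sq, mul_pow, plane_norm_sq q,
    regularize_snd_zero, regularize_snd_one, regularize_snd_two, plane_inner, plane_norm_sq p]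
  ring

theorem norm_mul_regularize (q p : Plane) :
    ‖(regularize q p).2‖ * (1 - (regularize q p).1 2) = ‖q‖ := by
  rw [norm_regularize_snd, one_sub_regularize_fst_two]
  have : ‖p‖ ^ 2 + 1 ≠ 0 := by positivity
  field_simp

theorem ang_regularize (q p : Plane) : ang (regularize q p) = angular q p := by
  rw [ang, angular, regularize_fst_zero, regularize_fst_one, regularize_snd_zero,
    regularize_snd_one]
  have : ‖p‖ ^ 2 + 1 ≠ 0 := by positivity
  field_simp; ring

theorem regularize_mem (q p : Plane) : regularize q p ∈ cotangentSphere := cotangentLift_mem _ _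

theorem regularize_pos_mom {z : Space × Space} (hz : z ∈ cotangentSphere) (h : z.1 2 ≠ 1) :
    regularize (pos z) (mom z) = z := by
  obtain ⟨h1, h2⟩ := hz
  rw [space_norm_eq_one] at h1
  rw [space_inner] at h2
  have hW : 1 - z.1 2 ≠ 0 := fun h' => h (by linarith)
  have hn : ‖mom z‖ ^ 2 + 1 = 2 / (1 - z.1 2) := by
    rw [plane_norm_sq]; simp [mom]; field_simp; linear_combination h1
  have hi : ⟪mom z, pos z⟫ = -z.2 2 := by
    rw [plane_inner]; simp [mom, pos]; field_simp
    linear_combination (1 - z.1 2) * -h2 + -z.2 2 * h1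
  have e0 : (pos z) 0 = (1 - z.1 2) * z.2 0 + z.2 2 * z.1 0 := rfl
  have e1 : (pos z) 1 = (1 - z.1 2) * z.2 1 + z.2 2 * z.1 1 := rfl
  have e2 : (mom z) 0 = -z.1 0 / (1 - z.1 2) := rfl
  have e3 : (mom z) 1 = -z.1 1 / (1 - z.1 2) := rfl
  refine Prod.ext (space_ext ?_ ?_ ?_) (space_ext ?_ ?_ ?_)
  · rw [regularize_fst_zero, hn, e2]; field_simp
  · rw [regularize_fst_one, hn, e3]; field_simp
  · have := one_sub_regularize_fst_two (pos z) (mom z)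
    rw [hn] at this; field_simp at this; linarith
  · rw [regularize_snd_zero, hn, hi, e0, e2]; field_simp; ring
  · rw [regularize_snd_one, hn, hi, e1, e3]; field_simp; ring
  · rw [regularize_snd_two, hi]; ring

/-- The regularized Hamiltonian constraint. -/
def level (c : ℝ) : Set (Space × Space) :=
  {z | ‖z.1‖ = 1 ∧ ⟪z.1, z.2⟫ = 0 ∧ ‖z.2‖ * (1 + (1 - z.1 2) * (c - 1 / 2 + ang z)) = 1}

/-- The defining function of `level`, minus 1, pulls back to `‖q‖ (H_R + c)`; away from `q = 0` the
two have the same zeros. -/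
theorem regularize_mem_level_iff {c : ℝ} {q p : Plane} (hq : q ≠ 0) :
    regularize q p ∈ level c ↔ hamiltonian q p = -c := by
  have h := regularize_mem q p
  have hq' : ‖q‖ ≠ 0 := norm_ne_zero_iff.2 hq
  have hp : ‖p‖ ^ 2 + 1 ≠ 0 := by positivity
  have key : ‖(regularize q p).2‖ *
      (1 + (1 - (regularize q p).1 2) * (c - 1 / 2 + ang (regularize q p))) - 1
        = ‖q‖ * (hamiltonian q p + c) := by
    rw [norm_regularize_snd, one_sub_regularize_fst_two, ang_regularize, hamiltonian]
    field_simp; ring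
  constructor
  · rintro ⟨-, -, h3⟩
    rw [h3, sub_self, eq_comm, mul_eq_zero] at key
    rcases key with h | h
    · exact absurd h hq'
    · linarith
  · intro h4
    refine ⟨h.1, h.2, ?_⟩
    rw [h4] at key
    linarith

theorem continuous_ang : Continuous ang := by unfold ang; fun_prop

theorem isClosed_level (c : ℝ) : IsClosed (level c) := by
  have := continuous_ang
  refine IsClosed.inter (isClosed_eq (by fun_prop) continuous_const)
    (IsClosed.inter (isClosed_eq (by fun_prop) continuous_const)
      (isClosed_eq (by fun_prop) continuous_const))

theorem norm_snd_pos {c : ℝ} {z : Space × Space} (hz : z ∈ level c) :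
    0 < ‖z.2‖ := by
  rcases (norm_nonneg z.2).eq_or_lt with h | h
  · have := hz.2.2; rw [← h] at this; simp at this
  · exact h

theorem fst_two_le_one {z : Space × Space} (h : ‖z.1‖ = 1) : z.1 2 ≤ 1 ∧ -1 ≤ z.1 2 := by
  rw [space_norm_eq_one] at h
  constructor <;> nlinarith [sq_nonneg (z.1 0), sq_nonneg (z.1 1)]

theorem norm_pos_eq {z : Space × Space} (hz : z ∈ cotangentSphere) (h : z.1 2 ≠ 1) :
    ‖pos z‖ = ‖z.2‖ * (1 - z.1 2) := by
  rw [← norm_mul_regularize (pos z) (mom z), regularize_pos_mom hz h]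

theorem mem_image_of_level {c : ℝ} {z : Space × Space} (hz : z ∈ level c) (h : z.1 2 ≠ 1) :
    z ∈ (fun z => regularize z.1 z.2) '' energyLevel c := by
  have hc : z ∈ cotangentSphere := ⟨hz.1, hz.2.1⟩
  have e := regularize_pos_mom hc h
  have hq : pos z ≠ 0 := by
    rw [← norm_ne_zero_iff, norm_pos_eq hc h]
    exact mul_ne_zero (norm_snd_pos hz).ne' fun h' => h (by linarith)
  refine ⟨(pos z, mom z), ⟨hq, ?_⟩, e⟩
  rw [← regularize_mem_level_iff hq, e]
  exact hz

/-- The energy level reaches the fibre over the north pole along collision orbits. -/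
theorem mem_closure_of_north {c : ℝ} (hc : 3 / 2 < c) {z : Space × Space} (hz : z ∈ level c)
    (h : z.1 2 = 1) : z ∈ closure ((fun z => regularize z.1 z.2) '' energyLevel c) := by
  obtain ⟨h1, h2, h3⟩ := hz
  rw [space_norm_eq_one, h] at h1
  have h10 : z.1 0 = 0 := by nlinarith [sq_nonneg (z.1 0), sq_nonneg (z.1 1)]
  have h11 : z.1 1 = 0 := by nlinarith [sq_nonneg (z.1 0), sq_nonneg (z.1 1)]
  rw [space_inner, h, h10, h11] at h2
  have h22 : z.2 2 = 0 := by linarith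
  rw [h] at h3
  have hn : ‖z.2‖ = 1 := by simpa using h3
  have hn' := hn
  rw [space_norm_eq_one, h22] at hn'
  -- A curve with `L = 0` inside `level` starting at `z`: the base point runs along the great circle
  -- in direction `z.2`, the covector stays tangent to that circle, and `r` is the norm that the
  -- energy constraint imposes when `L = 0`.
  let r : ℝ → ℝ := fun s => 1 / (1 + (1 - Real.cos s) * (c - 1 / 2))
  have hpos : ∀ s, 0 < 1 + (1 - Real.cos s) * (c - 1 / 2) := fun s => by
    have := Real.cos_le_one s
    nlinarith [mul_nonneg (sub_nonneg.2 this) (by linarith : 0 ≤ c - 1 / 2)]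
  let σ : ℝ → Space × Space := fun s =>
    (!₂[Real.sin s * z.2 0, Real.sin s * z.2 1, Real.cos s],
      !₂[r s * (Real.cos s * z.2 0), r s * (Real.cos s * z.2 1), -(r s * Real.sin s)])
  have hr : Continuous r := by
    refine Continuous.div continuous_const (by fun_prop) fun s => (hpos s).ne'
  have hσ : Continuous σ := by
    refine Continuous.prodMk ?_ ?_
    · refine (PiLp.continuous_toLp 2 _).comp (continuous_pi fun i => ?_)
      fin_cases i <;> simp <;> fun_prop
    · refine (PiLp.continuous_toLp 2 _).comp (continuous_pi fun i => ?_)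
      fin_cases i <;> simp <;> fun_prop
  have hσ0 : σ 0 = z := by
    refine Prod.ext (space_ext ?_ ?_ ?_) (space_ext ?_ ?_ ?_) <;> simp [σ, r, h, h10, h11, h22]
  have hnorm : ∀ s, ‖(σ s).2‖ = r s := fun s => by
    have h0 : 0 ≤ r s := (one_div_pos.2 (hpos s)).le
    rw [← sq_eq_sq₀ (norm_nonneg _) h0, space_norm_sq]
    simp [σ]
    linear_combination r s ^ 2 * Real.cos s ^ 2 * hn' + r s ^ 2 * Real.sin_sq_add_cos_sq s
  have hlev : ∀ s, σ s ∈ level c := fun s => by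
    refine ⟨?_, ?_, ?_⟩
    · rw [space_norm_eq_one]
      simp [σ]
      linear_combination Real.sin s ^ 2 * hn' + Real.sin_sq_add_cos_sq s
    · rw [space_inner]
      simp [σ]
      linear_combination r s * Real.sin s * Real.cos s * hn'
    · have ha : ang (σ s) = 0 := by simp [ang, σ]; ring
      rw [hnorm, ha, add_zero]
      exact one_div_mul_cancel (hpos s).ne'
  have hev : ∀ᶠ s in nhdsWithin (0 : ℝ) (Set.Ioi 0),
      σ s ∈ (fun z => regularize z.1 z.2) '' energyLevel c := by
    filter_upwards [Ioo_mem_nhdsGT Real.pi_pos] with s hs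
    refine mem_image_of_level (hlev s) ?_
    have hs' := Real.sin_pos_of_pos_of_lt_pi hs.1 hs.2
    have : (σ s).1 2 = Real.cos s := rfl
    rw [this]
    intro h'
    have := Real.sin_sq_add_cos_sq s
    rw [h'] at this
    nlinarith
  refine mem_closure_of_tendsto (f := σ) (b := nhdsWithin (0 : ℝ) (Set.Ioi 0)) ?_ hev
  have := (hσ.tendsto 0).mono_left (nhdsWithin_le_nhds (s := Set.Ioi 0))
  rwa [hσ0] at this

theorem closedLevel_eq {c : ℝ} (hc : 3 / 2 < c) : closedLevel c = level c := by
  ext z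
  constructor
  · rintro ⟨-, h⟩
    refine closure_minimal ?_ (isClosed_level c) h
    rintro _ ⟨w, ⟨hw, hE⟩, rfl⟩
    exact (regularize_mem_level_iff hw).2 hE
  · intro h
    refine ⟨⟨h.1, h.2.1⟩, ?_⟩
    by_cases h' : z.1 2 = 1
    · exact mem_closure_of_north hc h h'
    · exact subset_closure (mem_image_of_level h h')


/-! ### The bounded component -/

/-- The radial derivative of the regularized Hamiltonian, divided by the norm of the covector. -/
def radial (c : ℝ) (z : Space × Space) : ℝ := 1 + (1 - z.1 2) * (c - 1 / 2 + 2 * ang z)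

theorem continuous_radial (c : ℝ) : Continuous (radial c) := by
  have := continuous_ang
  unfold radial; fun_prop

/-- Cauchy-Schwarz: `ang` pairs the covector with the rotation field about the vertical axis, whose
squared length is `1 - ξ₂²`. -/
theorem ang_sq_le {z : Space × Space} (h : ‖z.1‖ = 1) :
    ang z ^ 2 ≤ (1 - z.1 2) * (1 + z.1 2) * ‖z.2‖ ^ 2 := by
  rw [space_norm_eq_one] at h
  have h' : (1 - z.1 2) * (1 + z.1 2) = z.1 0 ^ 2 + z.1 1 ^ 2 := by linear_combination -h
  rw [h', space_norm_sq, ang]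
  nlinarith [sq_nonneg (z.1 0 * z.2 0 + z.1 1 * z.2 1), sq_nonneg (z.1 0 * z.2 2),
    sq_nonneg (z.1 1 * z.2 2)]

theorem norm_mul_radial {c : ℝ} {z : Space × Space} (hz : z ∈ level c) :
    ‖z.2‖ * radial c z = 1 + ang z * (‖z.2‖ * (1 - z.1 2)) := by
  rw [radial]; linear_combination hz.2.2

/-- At a root of a quadratic polynomial, the square of the derivative is the discriminant. Here the
variable is the norm of the covector along a fixed direction, and both sides carry the factor
`‖z.2‖²`. -/
theorem radial_sq {c : ℝ} {z : Space × Space} (hz : z ∈ level c) :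
    (‖z.2‖ * radial c z) ^ 2 =
      ‖z.2‖ ^ 2 * (1 + (1 - z.1 2) * (c - 1 / 2)) ^ 2 + 4 * ‖z.2‖ * ((1 - z.1 2) * ang z) := by
  rw [radial]
  linear_combination 4 * ‖z.2‖ * ((1 - z.1 2) * ang z) * hz.2.2

/-- The worst case is `l = -1`; then `c > 3/2` makes the expression larger than `(1 + w)² - 4w = (1
- w)²` for `w > 0`. This is where the critical energy enters. -/
theorem discrim_pos {c : ℝ} (hc : 3 / 2 < c) {w l : ℝ} (hw : 0 ≤ w) (hl : |l| ≤ 1) :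
    0 < (1 + w * (c - 1 / 2)) ^ 2 + 4 * (w * l) := by
  have h1 := neg_le_of_abs_le hl
  have h2 : 0 ≤ w * (l + 1) := mul_nonneg hw (by linarith)
  rcases hw.eq_or_lt with rfl | hw
  · norm_num
  · have h3 : 0 < w * (c - 3 / 2) := mul_pos hw (by linarith)
    nlinarith [sq_nonneg (w - 1)]

theorem radial_ne_zero {c : ℝ} (hc : 3 / 2 < c) {z : Space × Space} (hz : z ∈ level c) :
    radial c z ≠ 0 := by
  intro h
  have hN := norm_snd_pos hz
  have h1 := radial_sq hz
  obtain ⟨h2, h3⟩ := fst_two_le_one hz.1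
  have hl : |ang z / ‖z.2‖| ≤ 1 := by
    rw [abs_div, abs_of_pos hN, div_le_one hN]
    refine abs_le_of_sq_le_sq ?_ hN.le
    have := ang_sq_le hz.1
    nlinarith [sq_nonneg (z.1 2 * ‖z.2‖)]
  have h4 := discrim_pos hc (sub_nonneg.2 h2) hl
  have h5 : 0 < ‖z.2‖ ^ 2 * ((1 + (1 - z.1 2) * (c - 1 / 2)) ^ 2
      + 4 * ((1 - z.1 2) * (ang z / ‖z.2‖))) := by positivity
  rw [h, mul_zero] at h1
  have h6 : ‖z.2‖ ^ 2 * ((1 + (1 - z.1 2) * (c - 1 / 2)) ^ 2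
      + 4 * ((1 - z.1 2) * (ang z / ‖z.2‖))) = ‖z.2‖ ^ 2 * (1 + (1 - z.1 2) * (c - 1 / 2)) ^ 2
        + 4 * ‖z.2‖ * ((1 - z.1 2) * ang z) := by field_simp
  rw [h6, ← h1] at h5
  norm_num at h5

theorem norm_lt_two {c : ℝ} (hc : 3 / 2 < c) {z : Space × Space} (hz : z ∈ level c)
    (h : 0 < radial c z) : ‖z.2‖ < 2 := by
  have hN := norm_snd_pos hz
  obtain ⟨h2, h3⟩ := fst_two_le_one hz.1
  have h1 : ‖z.2‖ * (1 + (1 - z.1 2) * (c - 1 / 2) + radial c z) = 2 := by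
    rw [radial]; linear_combination 2 * hz.2.2
  have h4 : 0 ≤ (1 - z.1 2) * (c - 1 / 2) := mul_nonneg (by linarith) (by linarith)
  have h5 : 0 ≤ ‖z.2‖ * ((1 - z.1 2) * (c - 1 / 2)) := by positivity
  have h6 : 0 < ‖z.2‖ * radial c z := by positivity
  linarith

/-- Since `radial` has no zero on `level`, its sign is constant on a connected component, and
`norm_lt_two` bounds the covector wherever it is positive. -/
theorem isBounded_component {c : ℝ} (hc : 3 / 2 < c) {z : Space × Space} (hz : z ∈ level c)
    (h : 0 < radial c z) : Bornology.IsBounded (connectedComponentIn (level c) z) := by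
  have hsub : ∀ w ∈ connectedComponentIn (level c) z, 0 < radial c w := by
    intro w hw
    by_contra hn
    obtain ⟨v, hv, hv0⟩ := isPreconnected_connectedComponentIn.intermediate_value hw
      (mem_connectedComponentIn hz) (continuous_radial c).continuousOn ⟨not_lt.1 hn, h.le⟩
    exact radial_ne_zero hc (connectedComponentIn_subset _ _ hv) hv0
  refine (Metric.isBounded_closedBall (x := (0 : Space × Space)) (r := 2)).subset ?_
  intro w hw
  have hl := connectedComponentIn_subset _ _ hw
  rw [mem_closedBall_zero_iff, Prod.norm_def]
  exact max_le (by rw [hl.1]; norm_num) (norm_lt_two hc hl (hsub w hw)).le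

/-- A point of the level in the fibre over a given `ξ`, with a given value of `L`. -/
def escape (c ε : ℝ) (ξ : Space) (L : ℝ) : Space × Space :=
  let S := ξ 0 ^ 2 + ξ 1 ^ 2
  let B := ε * (√(S / (1 + (1 - ξ 2) * (c - 1 / 2 + L)) ^ 2 - L ^ 2) / S)
  (ξ, !₂[L / S * ξ 1 - B * (ξ 0 * ξ 2), -(L / S * ξ 0) - B * (ξ 1 * ξ 2), B * S])

theorem ang_escape (c ε : ℝ) {ξ : Space} (hS : 0 < ξ 0 ^ 2 + ξ 1 ^ 2) (L : ℝ) :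
    ang (escape c ε ξ L) = L := by
  simp only [escape, ang]
  simp
  field_simp
  ring

/-- The covector is split along the orthogonal tangent vectors `(ξ₁, -ξ₀, 0)` and `(-ξ₀ξ₂, -ξ₁ξ₂,
S)`, both of squared length `S`. The first coefficient fixes `L`; the square root in the second is
chosen to produce the norm that the energy constraint demands. -/
theorem norm_escape {c ε : ℝ} {ξ : Space} (hξ : ‖ξ‖ = 1) (hS : 0 < ξ 0 ^ 2 + ξ 1 ^ 2) {L : ℝ}
    (hε : ε ^ 2 = 1) (hD : 0 < 1 + (1 - ξ 2) * (c - 1 / 2 + L))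
    (hrad : 0 ≤ (ξ 0 ^ 2 + ξ 1 ^ 2) / (1 + (1 - ξ 2) * (c - 1 / 2 + L)) ^ 2 - L ^ 2) :
    ‖(escape c ε ξ L).2‖ = 1 / (1 + (1 - ξ 2) * (c - 1 / 2 + L)) := by
  rw [space_norm_eq_one] at hξ
  rw [← sq_eq_sq₀ (norm_nonneg _) (by positivity), space_norm_sq]
  have hsq := Real.sq_sqrt hrad
  set S := ξ 0 ^ 2 + ξ 1 ^ 2 with hSdef
  set D := 1 + (1 - ξ 2) * (c - 1 / 2 + L) with hDdef
  set Q := √(S / D ^ 2 - L ^ 2) with hQ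
  have : (escape c ε ξ L).2 0 ^ 2 + (escape c ε ξ L).2 1 ^ 2 + (escape c ε ξ L).2 2 ^ 2
      = L ^ 2 / S + ε ^ 2 * Q ^ 2 / S := by
    simp only [escape, ← hSdef, ← hDdef, ← hQ]
    simp
    have hx : ξ 0 ^ 2 = S - ξ 1 ^ 2 := by rw [hSdef]; ring
    have hx2 : ξ 2 ^ 2 = 1 - S := by rw [hSdef]; linear_combination hξ
    field_simp
    ring_nf
    rw [hx, hx2]
    ring
  rw [this, hε, hsq]
  field_simp
  ring

theorem escape_mem_level {c ε : ℝ} {ξ : Space} (hξ : ‖ξ‖ = 1) (hS : 0 < ξ 0 ^ 2 + ξ 1 ^ 2)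
    {L : ℝ} (hε : ε ^ 2 = 1) (hD : 0 < 1 + (1 - ξ 2) * (c - 1 / 2 + L))
    (hrad : 0 ≤ (ξ 0 ^ 2 + ξ 1 ^ 2) / (1 + (1 - ξ 2) * (c - 1 / 2 + L)) ^ 2 - L ^ 2) :
    escape c ε ξ L ∈ level c := by
  refine ⟨hξ, ?_, ?_⟩
  · rw [space_inner]
    simp only [escape]
    simp
    ring
  · rw [norm_escape hξ hS hε hD hrad, ang_escape c ε hS]
    exact one_div_mul_cancel hD.ne'

theorem escape_ang {c ε : ℝ} {ξ η : Space} (hS : 0 < ξ 0 ^ 2 + ξ 1 ^ 2) (h2 : ⟪ξ, η⟫ = 0)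
    (hε : ε * |η 2| = η 2)
    (hη : (ξ 0 ^ 2 + ξ 1 ^ 2) / (1 + (1 - ξ 2) * (c - 1 / 2 + ang (ξ, η))) ^ 2
      - ang (ξ, η) ^ 2 = η 2 ^ 2) :
    escape c ε ξ (ang (ξ, η)) = (ξ, η) := by
  rw [space_inner] at h2
  have e1 : ξ 0 * η 0 + ξ 1 * η 1 = -(ξ 2 * η 2) := by linarith
  refine Prod.ext rfl (space_ext ?_ ?_ ?_) <;>
    simp only [escape, hη, Real.sqrt_sq_eq_abs] <;> rw [← mul_div_assoc, hε] <;> simp [ang]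
  · field_simp
    linear_combination ξ 0 * -e1
  · field_simp
    linear_combination ξ 1 * -e1
  · field_simp

theorem continuousOn_escape {c ε : ℝ} {ξ : Space} {I : Set ℝ}
    (hD : ∀ L ∈ I, 0 < 1 + (1 - ξ 2) * (c - 1 / 2 + L)) : ContinuousOn (escape c ε ξ) I := by
  have hc0 : ContinuousOn (fun L => √((ξ 0 ^ 2 + ξ 1 ^ 2) /
      (1 + (1 - ξ 2) * (c - 1 / 2 + L)) ^ 2 - L ^ 2)) I := by
    refine ContinuousOn.sqrt (ContinuousOn.sub (ContinuousOn.div continuousOn_const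
      (by fun_prop) fun L hL => ?_) (by fun_prop))
    have := hD L hL
    positivity
  refine ContinuousOn.prodMk continuousOn_const ?_
  refine (PiLp.continuous_toLp 2 _).comp_continuousOn (continuousOn_pi.2 fun i => ?_)
  fin_cases i
  · exact ((by fun_prop : Continuous fun L : ℝ => L / (ξ 0 ^ 2 + ξ 1 ^ 2) * ξ 1).continuousOn).sub
      ((continuousOn_const.mul (hc0.div_const _)).mul continuousOn_const)
  · exact ((by fun_prop : Continuous fun L : ℝ =>
      -(L / (ξ 0 ^ 2 + ξ 1 ^ 2) * ξ 0)).continuousOn).sub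
      ((continuousOn_const.mul (hc0.div_const _)).mul continuousOn_const)
  · exact (continuousOn_const.mul (hc0.div_const _)).mul continuousOn_const

/-- With the base point fixed, let `L` decrease from its value `L₀` towards the zero `-A / (1 - ξ₂)`
of `D = A + (1 - ξ₂) L`. The constraint makes the norm of the covector `1 / D`, which is unbounded
along this connected path. -/
theorem not_isBounded_component {c : ℝ} (hc : 3 / 2 < c) {ξ η : Space} (h1 : ‖ξ‖ = 1)
    (h2 : ⟪ξ, η⟫ = 0) (hK : ‖η‖ * (1 + (1 - ξ 2) * (c - 1 / 2 + ang (ξ, η))) = 1) (hN : 0 < ‖η‖)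
    (h : radial c (ξ, η) < 0) :
    ¬ Bornology.IsBounded (connectedComponentIn (level c) (ξ, η)) := by
  have hle : ξ 2 ≤ 1 ∧ -1 ≤ ξ 2 := fst_two_le_one (z := (ξ, η)) h1
  have hsqle := ang_sq_le (z := (ξ, η)) h1
  have hL0' : ang (ξ, η) = ξ 1 * η 0 - ξ 0 * η 1 := rfl
  -- The sign `ε` selects the branch of the square root through the given covector, so that the path
  -- really starts at `(ξ, η)`.
  obtain ⟨ε, hε, hε'⟩ : ∃ ε : ℝ, ε ^ 2 = 1 ∧ ε * |η 2| = η 2 := by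
    rcases le_total 0 (η 2) with h' | h'
    · exact ⟨1, by norm_num, by rw [abs_of_nonneg h']; ring⟩
    · exact ⟨-1, by norm_num, by rw [abs_of_nonpos h']; ring⟩
  have hback := fun hS => escape_ang (c := c) (ε := ε) (ξ := ξ) (η := η) hS h2 hε'
  simp only [radial] at h
  generalize ang (ξ, η) = L₀ at *
  simp only at h1 h2 hle hK hsqle
  have hlt : ξ 2 < 1 := by
    refine lt_of_le_of_ne hle.1 fun h' => ?_
    rw [h'] at h; norm_num at h
  have hW : 0 < 1 - ξ 2 := by linarith
  obtain ⟨A, hA⟩ : ∃ A, A = 1 + (1 - ξ 2) * (c - 1 / 2) := ⟨_, rfl⟩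
  have hA1 : 1 ≤ A := by rw [hA]; nlinarith
  have hD : ∀ L, 1 + (1 - ξ 2) * (c - 1 / 2 + L) = A + (1 - ξ 2) * L := fun L => by rw [hA]; ring
  rw [hD] at hK
  have hg : A + 2 * (1 - ξ 2) * L₀ < 0 := by linarith
  have hL0neg : L₀ < 0 := by
    by_contra h'
    have : 0 ≤ 2 * (1 - ξ 2) * L₀ := by have := not_lt.1 h'; positivity
    linarith
  have hneg : ξ 2 ≠ -1 := by
    intro h'
    rw [h'] at hsqle
    nlinarith
  have hξ := h1
  rw [space_norm_eq_one] at hξ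
  rw [space_inner] at h2
  have hS2 : ξ 0 ^ 2 + ξ 1 ^ 2 = 1 - ξ 2 ^ 2 := by linear_combination hξ
  have hS : 0 < ξ 0 ^ 2 + ξ 1 ^ 2 := by
    have : -1 < ξ 2 := lt_of_le_of_ne hle.2 (Ne.symm hneg)
    nlinarith
  have hdec : (ξ 0 ^ 2 + ξ 1 ^ 2) * ‖η‖ ^ 2 = L₀ ^ 2 + η 2 ^ 2 := by
    have e1 : ξ 0 * η 0 + ξ 1 * η 1 = -(ξ 2 * η 2) := by linarith
    have e2 : (ξ 0 ^ 2 + ξ 1 ^ 2) * (η 0 ^ 2 + η 1 ^ 2)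
        = L₀ ^ 2 + (ξ 0 * η 0 + ξ 1 * η 1) ^ 2 := by
      rw [hL0']; ring
    rw [space_norm_sq η, mul_add, e2, e1]
    linear_combination η 2 ^ 2 * hS2
  have hD0 : 0 < A + (1 - ξ 2) * L₀ := by
    by_contra h'
    have := mul_nonpos_of_nonneg_of_nonpos hN.le (not_lt.1 h')
    linarith
  have hID : ∀ L ∈ Set.Ioc (-A / (1 - ξ 2)) L₀, 0 < A + (1 - ξ 2) * L := by
    intro L hL
    have := hL.1
    rw [div_lt_iff₀ hW] at this
    linarith
  have hL0I : L₀ ∈ Set.Ioc (-A / (1 - ξ 2)) L₀ := by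
    refine ⟨?_, le_rfl⟩
    rw [div_lt_iff₀ hW]; linarith
  have hend : (-L₀ * (A + (1 - ξ 2) * L₀)) ^ 2 ≤ ξ 0 ^ 2 + ξ 1 ^ 2 := by
    have e1 : ξ 0 ^ 2 + ξ 1 ^ 2 = (ξ 0 ^ 2 + ξ 1 ^ 2) * (‖η‖ * (A + (1 - ξ 2) * L₀)) ^ 2 := by
      rw [hK]; ring
    rw [e1]
    have : L₀ ^ 2 ≤ (ξ 0 ^ 2 + ξ 1 ^ 2) * ‖η‖ ^ 2 := by rw [hdec]; nlinarith [sq_nonneg (η 2)]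
    have := mul_le_mul_of_nonneg_right this (sq_nonneg (A + (1 - ξ 2) * L₀))
    calc _ = L₀ ^ 2 * (A + (1 - ξ 2) * L₀) ^ 2 := by ring
      _ ≤ _ := this
      _ = _ := by ring
  have hrad : ∀ L ∈ Set.Ioc (-A / (1 - ξ 2)) L₀,
      0 ≤ (ξ 0 ^ 2 + ξ 1 ^ 2) / (A + (1 - ξ 2) * L) ^ 2 - L ^ 2 := by
    intro L hL
    have hd := hID L hL
    have hLL := hL.2
    -- The parabola `L D(L)` decreases to the left of its vertex `-A / (2(1 - ξ₂))`, and `radial <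
    -- 0` says that `L₀` lies to the left of it. Hence the radicand, nonnegative at `L₀`, remains so
    -- along the path.
    have hmono : -L * (A + (1 - ξ 2) * L) ≤ -L₀ * (A + (1 - ξ 2) * L₀) := by
      have h5 : (1 - ξ 2) * L ≤ (1 - ξ 2) * L₀ := mul_le_mul_of_nonneg_left hLL hW.le
      have h6 : 0 ≤ (L₀ - L) * -(A + (1 - ξ 2) * (L₀ + L)) :=
        mul_nonneg (by linarith) (by linarith)
      linarith
    have h0 : 0 ≤ -L * (A + (1 - ξ 2) * L) := mul_nonneg (by linarith) hd.le
    have hsq := pow_le_pow_left₀ h0 hmono 2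
    rw [sub_nonneg, le_div_iff₀ (by positivity)]
    calc _ = (-L * (A + (1 - ξ 2) * L)) ^ 2 := by ring
      _ ≤ _ := hsq.trans hend
  have hstart : escape c ε ξ L₀ = (ξ, η) := by
    refine hback hS ?_
    rw [hD]
    have : 1 / (A + (1 - ξ 2) * L₀) = ‖η‖ := by field_simp; linarith
    rw [div_eq_mul_one_div, ← one_div_pow, this, hdec]; ring
  simp only [← hD] at hID hrad
  have himg : escape c ε ξ '' Set.Ioc (-A / (1 - ξ 2)) L₀ ⊆
      connectedComponentIn (level c) (ξ, η) := by
    refine IsPreconnected.subset_connectedComponentIn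
      (isPreconnected_Ioc.image _ (continuousOn_escape hID)) ⟨L₀, hL0I, hstart⟩ ?_
    rintro _ ⟨L, hL, rfl⟩
    exact escape_mem_level h1 hS hε (hID L hL) (hrad L hL)
  intro hb
  obtain ⟨M, hM⟩ := (hb.subset himg).exists_norm_le
  obtain ⟨M', hM'⟩ : ∃ M', M' = max M (1 / (A + (1 - ξ 2) * L₀)) + 1 := ⟨_, rfl⟩
  have hM1 : 1 / (A + (1 - ξ 2) * L₀) < M' := by
    rw [hM']; linarith [le_max_right M (1 / (A + (1 - ξ 2) * L₀))]
  have hM0 : 0 < M' := lt_trans (by positivity) hM1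
  -- The value of `L` at which `D = 1 / M'`, so that the covector has norm `M' > M`.
  obtain ⟨L, hL⟩ : ∃ L, L = (1 / M' - A) / (1 - ξ 2) := ⟨_, rfl⟩
  have hDL : A + (1 - ξ 2) * L = 1 / M' := by rw [hL]; field_simp; ring
  have hLI : L ∈ Set.Ioc (-A / (1 - ξ 2)) L₀ := by
    constructor
    · rw [hL]
      refine div_lt_div_of_pos_right ?_ hW
      have : 0 < 1 / M' := by positivity
      linarith
    · have h7 : 1 / M' < A + (1 - ξ 2) * L₀ := by
        rw [div_lt_iff₀ hM0]; rw [div_lt_iff₀ hD0] at hM1; linarith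
      rw [← hDL] at h7
      exact le_of_mul_le_mul_left (by linarith) hW
  have h3 := hM _ ⟨L, hLI, rfl⟩
  have h4 : ‖(escape c ε ξ L).2‖ = M' := by
    rw [norm_escape h1 hS hε (hID L hLI) (hrad L hLI), hD, hDL]; simp
  have h5 : ‖(escape c ε ξ L).2‖ ≤ ‖escape c ε ξ L‖ := by
    rw [Prod.norm_def]; exact le_max_right _ _
  have h6 : M < M' := by rw [hM']; linarith [le_max_left M (1 / (A + (1 - ξ 2) * L₀))]
  linarith

/-- The hypersurface `Σ_R^c` is cut out by the regularized energy constraint and an open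
condition. -/
theorem mem_hypersurface_iff {c : ℝ} (hc : 3 / 2 < c) {z : Space × Space} :
    z ∈ hypersurface c ↔ z ∈ level c ∧ 0 < radial c z := by
  unfold hypersurface
  rw [closedLevel_eq hc]
  constructor
  · rintro ⟨h1, h2⟩
    refine ⟨h1, ?_⟩
    rcases (radial_ne_zero hc h1).lt_or_gt with h | h
    · exact absurd h2 (not_isBounded_component hc h1.1 h1.2.1 h1.2.2
        (norm_snd_pos h1) h)
    · exact h
  · rintro ⟨h1, h2⟩
    exact ⟨h1, isBounded_component hc h1 h2⟩


/-! ### The Reeb vector field -/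

/-- The distance `|q|` from the origin, as a function on `T*S²`. -/
def dist0 (z : Space × Space) : ℝ := ‖z.2‖ * (1 - z.1 2)

/-- The rate `ds/dτ` of the regularized time with respect to the Reeb time. -/
def rate (z : Space × Space) : ℝ := 1 / (1 + ang z * dist0 z)

/-- The Reeb vector field of `Σ_R^c`. -/
def reeb (c : ℝ) (z : Space × Space) : Space × Space :=
  (!₂[rate z * (z.2 0 / ‖z.2‖ ^ 2 + dist0 z * z.1 1),
      rate z * (z.2 1 / ‖z.2‖ ^ 2 - dist0 z * z.1 0),
      rate z * (z.2 2 / ‖z.2‖ ^ 2)],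
    !₂[rate z * (dist0 z * z.2 1 - ‖z.2‖ * (c + 1 / 2 + ang z) * z.1 0),
      rate z * (-(dist0 z * z.2 0) - ‖z.2‖ * (c + 1 / 2 + ang z) * z.1 1),
      rate z * (‖z.2‖ * (c - 1 / 2 + ang z) - ‖z.2‖ * (c + 1 / 2 + ang z) * z.1 2)])

theorem reeb_fst_zero (c : ℝ) (z : Space × Space) :
    (reeb c z).1 0 = rate z * (z.2 0 / ‖z.2‖ ^ 2 + dist0 z * z.1 1) := rfl

theorem reeb_fst_one (c : ℝ) (z : Space × Space) :
    (reeb c z).1 1 = rate z * (z.2 1 / ‖z.2‖ ^ 2 - dist0 z * z.1 0) := rfl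

theorem reeb_fst_two (c : ℝ) (z : Space × Space) :
    (reeb c z).1 2 = rate z * (z.2 2 / ‖z.2‖ ^ 2) := rfl

theorem reeb_snd_zero (c : ℝ) (z : Space × Space) : (reeb c z).2 0 =
    rate z * (dist0 z * z.2 1 - ‖z.2‖ * (c + 1 / 2 + ang z) * z.1 0) := rfl

theorem reeb_snd_one (c : ℝ) (z : Space × Space) : (reeb c z).2 1 =
    rate z * (-(dist0 z * z.2 0) - ‖z.2‖ * (c + 1 / 2 + ang z) * z.1 1) := rfl

theorem reeb_snd_two (c : ℝ) (z : Space × Space) : (reeb c z).2 2 =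
    rate z * (‖z.2‖ * (c - 1 / 2 + ang z) - ‖z.2‖ * (c + 1 / 2 + ang z) * z.1 2) := rfl

/-- The linearized constraints that define `Σ_R^c`. -/
structure IsLinTangent (c : ℝ) (z v : Space × Space) : Prop where
  sphere : z.1 0 * v.1 0 + z.1 1 * v.1 1 + z.1 2 * v.1 2 = 0
  fibre : z.2 0 * v.1 0 + z.2 1 * v.1 1 + z.2 2 * v.1 2
    + (z.1 0 * v.2 0 + z.1 1 * v.2 1 + z.1 2 * v.2 2) = 0
  energy : z.2 0 * v.2 0 + z.2 1 * v.2 1 + z.2 2 * v.2 2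
    + ‖z.2‖ ^ 3 * (-v.1 2 * (c - 1 / 2 + ang z) + (1 - z.1 2) *
      (v.1 1 * z.2 0 + z.1 1 * v.2 0 - v.1 0 * z.2 1 - z.1 0 * v.2 1)) = 0

theorem one_add_ang_mul_pos {c : ℝ} {z : Space × Space} (hz : z ∈ level c)
    (h : 0 < radial c z) : 0 < 1 + ang z * dist0 z := by
  rw [dist0, ← norm_mul_radial hz]
  exact mul_pos (norm_snd_pos hz) h

theorem eq_zero_of_hasDerivAt_eventually_const {f : ℝ → ℝ} {a k t : ℝ} (h : HasDerivAt f a t)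
    (hc : ∀ᶠ s in nhds t, f s = k) : a = 0 :=
  h.unique ((hasDerivAt_const t k).congr_of_eventuallyEq hc)

theorem isLinTangent_of_mem {c : ℝ} {S : Set (Space × Space)} (hS : S ⊆ level c)
    {z v : Space × Space} (hz : z ∈ S) (hv : v ∈ tangentVectors S z) : IsLinTangent c z v := by
  obtain ⟨σ, h0, hσ, hd⟩ := hv
  have hl : ∀ᶠ s in nhds 0, σ s ∈ level c := hσ.mono fun s hs => hS hs
  obtain ⟨x0, x1, x2⟩ := hasDerivAt_space_iff.1 (hasDerivAt_fst hd)
  obtain ⟨y0, y1, y2⟩ := hasDerivAt_space_iff.1 (hasDerivAt_snd hd)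
  refine ⟨?_, ?_, ?_⟩
  · have := eq_zero_of_hasDerivAt_eventually_const (k := 1)
      (((x0.pow 2).add (x1.pow 2)).add (x2.pow 2))
      (hl.mono fun s hs => by simpa using space_norm_eq_one.1 hs.1)
    simp [h0] at this
    linarith
  · have := eq_zero_of_hasDerivAt_eventually_const (k := 0)
      (((x0.mul y0).add (x1.mul y1)).add (x2.mul y2))
      (hl.mono fun s hs => by simpa [space_inner] using hs.2.1)
    simp [h0] at this
    linarith
  -- The square of the energy constraint is differentiated, since `‖η‖²` is a polynomial in the
  -- coordinates; the factor `‖z.2‖² / 2` below then recovers the linearized constraint.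
  · have h1 := eq_zero_of_hasDerivAt_eventually_const (k := 1)
      ((((y0.pow 2).add (y1.pow 2)).add (y2.pow 2)).mul
        ((((x2.const_sub 1).mul
          (((x1.mul y0).sub (x0.mul y1)).const_add (c - 1 / 2))).const_add 1).pow 2))
      (hl.mono fun s hs => by
        have := hs.2.2
        have h2 := space_norm_sq (σ s).2
        simp only [ang] at this
        simp
        rw [← h2, ← mul_pow]
        simp only [one_div] at this
        rw [this]; norm_num)
    simp [h0] at h1
    have hK := (hS hz).2.2
    have hN := norm_snd_pos (hS hz)
    have h2 := space_norm_sq z.2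
    rw [← h2] at h1
    have ha : ang z = z.1 1 * z.2 0 - z.1 0 * z.2 1 := rfl
    norm_num at hK
    rw [← ha] at h1
    set D := 1 + (1 - z.1 2) * (c - 1 / 2 + ang z) with hD
    set N := ‖z.2‖
    have hND : N ^ 2 * D ^ 2 = 1 := by rw [← mul_pow, hK]; norm_num
    have h3 := congrArg (fun x => x * N ^ 2 / 2) h1
    simp only [zero_mul, zero_div] at h3
    linear_combination h3 - (z.2 0 * v.2 0 + z.2 1 * v.2 1 + z.2 2 * v.2 2) * hND -
      N ^ 3 * (-v.1 2 * (c - 1 / 2 + ang z) + (1 - z.1 2) *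
      (v.1 1 * z.2 0 + z.1 1 * v.2 0 - v.1 0 * z.2 1 - z.1 0 * v.2 1)) * hK

/-- Up to the positive factor `rate`, `ι_R dλ` is minus the differential of the energy constraint
plus a multiple of the differential of `‖ξ‖²`, and both differentials kill tangent vectors. That
normal term is the one needed to keep `R` tangent to `T*S²`. -/
theorem dLiouville_reeb {c : ℝ} {z v : Space × Space} (hz : z ∈ level c)
    (hv : IsLinTangent c z v) : dLiouville (reeb c z) v = 0 := by
  have hN := (norm_snd_pos hz).ne'
  obtain ⟨h1, h2, h3⟩ := hv
  rw [dLiouville, space_inner, space_inner, reeb_fst_zero, reeb_fst_one, reeb_fst_two,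
    reeb_snd_zero, reeb_snd_one, reeb_snd_two, dist0]
  set N := ‖z.2‖
  have hi : (N ^ 2)⁻¹ * N ^ 2 = 1 := inv_mul_cancel₀ (pow_ne_zero 2 hN)
  simp only [div_eq_mul_inv _ (N ^ 2)]
  set i := (N ^ 2)⁻¹
  linear_combination (-rate z * i) * h3 - rate z * N * (c + 1 / 2 + ang z) * h1
    + rate z * N * ((1 - z.1 2) * (v.1 1 * z.2 0 + z.1 1 * v.2 0 - v.1 0 * z.2 1 - z.1 0 * v.2 1)
      - (c - 1 / 2 + ang z) * v.1 2) * hi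

theorem liouville_reeb {c : ℝ} {z : Space × Space} (hz : z ∈ level c)
    (hr : 0 < radial c z) : liouville z (reeb c z) = 1 := by
  have hN := (norm_snd_pos hz).ne'
  have hp := (one_add_ang_mul_pos hz hr).ne'
  rw [liouville, space_inner, reeb_fst_zero, reeb_fst_one, reeb_fst_two]
  have h2 := space_norm_sq z.2
  have e : z.2 0 * (rate z * (z.2 0 / ‖z.2‖ ^ 2 + dist0 z * z.1 1))
      + z.2 1 * (rate z * (z.2 1 / ‖z.2‖ ^ 2 - dist0 z * z.1 0))
      + z.2 2 * (rate z * (z.2 2 / ‖z.2‖ ^ 2))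
      = rate z * ((z.2 0 ^ 2 + z.2 1 ^ 2 + z.2 2 ^ 2) / ‖z.2‖ ^ 2 + ang z * dist0 z) := by
    rw [ang]; ring
  rw [e, ← h2, div_self (pow_ne_zero 2 hN), rate, one_div_mul_cancel hp]

theorem isLinTangent_reeb {c : ℝ} {z : Space × Space} (hz : z ∈ level c)
    (hr : 0 < radial c z) : IsLinTangent c z (reeb c z) := by
  have hN := (norm_snd_pos hz).ne'
  have hp := (one_add_ang_mul_pos hz hr).ne'
  have h1 := liouville_reeb hz hr
  rw [liouville, space_inner] at h1
  have hx := space_norm_eq_one.1 hz.1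
  have hy := space_norm_sq z.2
  have hi := hz.2.1
  rw [space_inner] at hi
  have hK := hz.2.2
  have hrate : rate z * (1 + ang z * dist0 z) = 1 := one_div_mul_cancel hp
  refine ⟨?_, ?_, ?_⟩
  · rw [reeb_fst_zero, reeb_fst_one, reeb_fst_two]
    linear_combination rate z / ‖z.2‖ ^ 2 * hi
  · rw [h1, reeb_snd_zero, reeb_snd_one, reeb_snd_two]
    rw [dist0] at hrate ⊢
    have ha : ang z = z.1 1 * z.2 0 - z.1 0 * z.2 1 := rfl
    linear_combination -hrate - rate z * ‖z.2‖ * (c + 1 / 2 + ang z) * hx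
      + rate z * ‖z.2‖ * (1 - z.1 2) * ha - rate z * hK
  · rw [reeb_fst_zero, reeb_fst_one, reeb_fst_two, reeb_snd_zero, reeb_snd_one, reeb_snd_two,
      dist0]
    set N := ‖z.2‖
    have hi' : (N ^ 2)⁻¹ * N ^ 2 = 1 := inv_mul_cancel₀ (pow_ne_zero 2 hN)
    simp only [div_eq_mul_inv _ (N ^ 2)]
    set i := (N ^ 2)⁻¹
    linear_combination -rate z * N * (c + 1 / 2 + ang z) * hi
      - rate z * N * (c - 1 / 2 + ang z) * z.2 2 * hi'


/-! ### Uniqueness of the Reeb vector. -/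

theorem hypersurface_subset_level {c : ℝ} (hc : 3 / 2 < c) : hypersurface c ⊆ level c :=
  fun _ hz => ((mem_hypersurface_iff hc).1 hz).1

/-- The cross product in Euclidean three-space. -/
def cross (a b : Space) : Space :=
  !₂[a 1 * b 2 - a 2 * b 1, a 2 * b 0 - a 0 * b 2, a 0 * b 1 - a 1 * b 0]

theorem inner_cross_left (a b : Space) : ⟪a, cross a b⟫ = 0 := by
  rw [space_inner]; simp [cross]; ring

theorem inner_cross_right (a b : Space) : ⟪b, cross a b⟫ = 0 := by
  rw [space_inner]; simp [cross]; ring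

theorem norm_cross_eq_one {a b : Space} (ha : ‖a‖ = 1) (hb : ‖b‖ = 1) (hab : ⟪a, b⟫ = 0) :
    ‖cross a b‖ = 1 := by
  rw [space_norm_eq_one] at *
  rw [space_inner] at hab
  simp [cross]
  linear_combination (b 0 ^ 2 + b 1 ^ 2 + b 2 ^ 2) * ha + hb
    - (a 0 * b 0 + a 1 * b 1 + a 2 * b 2) * hab

/-- With `E = a × b` a unit vector, the first two hypotheses give `E × d = 0`, and Lagrange's
identity `‖d‖² = ‖E × d‖² + ⟪E, d⟫²` finishes. -/
theorem eq_zero_of_orthogonal {a b d : Space} (ha : ‖a‖ = 1) (hb : ‖b‖ = 1) (hab : ⟪a, b⟫ = 0)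
    (h1 : ⟪a, d⟫ = 0) (h2 : ⟪b, d⟫ = 0) (h3 : ⟪cross a b, d⟫ = 0) : d = 0 := by
  have hE := space_norm_eq_one.1 (norm_cross_eq_one ha hb hab)
  rw [space_inner] at h1 h2 h3
  have e0 : (cross a b) 0 = a 1 * b 2 - a 2 * b 1 := rfl
  have e1 : (cross a b) 1 = a 2 * b 0 - a 0 * b 2 := rfl
  have e2 : (cross a b) 2 = a 0 * b 1 - a 1 * b 0 := rfl
  have c0 : cross a b 1 * d 2 - cross a b 2 * d 1 = 0 := by
    rw [e1, e2]; linear_combination b 0 * h1 - a 0 * h2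
  have c1 : cross a b 2 * d 0 - cross a b 0 * d 2 = 0 := by
    rw [e0, e2]; linear_combination b 1 * h1 - a 1 * h2
  have c2 : cross a b 0 * d 1 - cross a b 1 * d 0 = 0 := by
    rw [e0, e1]; linear_combination b 2 * h1 - a 2 * h2
  have : ‖d‖ ^ 2 = 0 := by
    rw [space_norm_sq]
    linear_combination (-(d 0 ^ 2 + d 1 ^ 2 + d 2 ^ 2)) * hE
      + (cross a b 1 * d 2 - cross a b 2 * d 1) * c0
      + (cross a b 2 * d 0 - cross a b 0 * d 2) * c1
      + (cross a b 0 * d 1 - cross a b 1 * d 0) * c2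
      + (cross a b 0 * d 0 + cross a b 1 * d 1 + cross a b 2 * d 2) * h3
  simpa using this

/-- `Σ_R^c` as a graph over the unit cotangent bundle: the norm of the covector in direction `u`
over `ξ`. -/
def radius (c : ℝ) (ξ u : Space) : ℝ :=
  2 / (1 + (1 - ξ 2) * (c - 1 / 2) +
    √((1 + (1 - ξ 2) * (c - 1 / 2)) ^ 2 + 4 * ((1 - ξ 2) * ang (ξ, u))))

theorem discrim_pos_of_unit {c : ℝ} (hc : 3 / 2 < c) {ξ u : Space} (hξ : ‖ξ‖ = 1)
    (hu : ‖u‖ = 1) :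
    0 < (1 + (1 - ξ 2) * (c - 1 / 2)) ^ 2 + 4 * ((1 - ξ 2) * ang (ξ, u)) := by
  obtain ⟨h1, h2⟩ : ξ 2 ≤ 1 ∧ -1 ≤ ξ 2 := fst_two_le_one (z := (ξ, u)) hξ
  refine discrim_pos hc (sub_nonneg.2 h1) ?_
  have h : ang (ξ, u) ^ 2 ≤ (1 - ξ 2) * (1 + ξ 2) * ‖u‖ ^ 2 := ang_sq_le (z := (ξ, u)) hξ
  rw [hu] at h
  refine abs_le_of_sq_le_sq ?_ zero_le_one
  nlinarith [sq_nonneg (ξ 2)]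

theorem radius_denom_pos {c : ℝ} (hc : 3 / 2 < c) {ξ : Space} (u : Space) (hξ : ‖ξ‖ = 1) :
    0 < 1 + (1 - ξ 2) * (c - 1 / 2) +
      √((1 + (1 - ξ 2) * (c - 1 / 2)) ^ 2 + 4 * ((1 - ξ 2) * ang (ξ, u))) := by
  obtain ⟨h1, h2⟩ : ξ 2 ≤ 1 ∧ -1 ≤ ξ 2 := fst_two_le_one (z := (ξ, u)) hξ
  have h3 : 0 ≤ (1 - ξ 2) * (c - 1 / 2) := mul_nonneg (by linarith) (by linarith)
  positivity

theorem ang_smul (ξ u : Space) (r : ℝ) : ang (ξ, r • u) = r * ang (ξ, u) := by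
  simp [ang]; ring

/-- `radius` is the root of the quadratic equation for the norm at which the derivative is `+√Δ`,
and this derivative is `radial`. Rationalizing the root keeps it meaningful where the quadratic
coefficient vanishes. -/
theorem radius_mem {c : ℝ} (hc : 3 / 2 < c) {ξ u : Space} (hξ : ‖ξ‖ = 1) (hu : ‖u‖ = 1)
    (h : ⟪ξ, u⟫ = 0) : (ξ, radius c ξ u • u) ∈ hypersurface c := by
  have hd := discrim_pos_of_unit hc hξ hu
  have hden := radius_denom_pos hc u hξ
  have hr : 0 < radius c ξ u := div_pos two_pos hden
  have hn : ‖radius c ξ u • u‖ = radius c ξ u := by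
    rw [norm_smul, hu, mul_one, Real.norm_of_nonneg hr.le]
  have hsq := Real.sq_sqrt hd.le
  have hpos := Real.sqrt_pos.2 hd
  have hr2 : radius c ξ u * (1 + (1 - ξ 2) * (c - 1 / 2) +
      √((1 + (1 - ξ 2) * (c - 1 / 2)) ^ 2 + 4 * ((1 - ξ 2) * ang (ξ, u)))) = 2 :=
    div_mul_cancel₀ _ hden.ne'
  rw [mem_hypersurface_iff hc]
  set Δ := √((1 + (1 - ξ 2) * (c - 1 / 2)) ^ 2 + 4 * ((1 - ξ 2) * ang (ξ, u)))
  set r := radius c ξ u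
  have hrW : r * ((1 - ξ 2) * ang (ξ, u)) = (Δ - (1 + (1 - ξ 2) * (c - 1 / 2))) / 2 := by
    linear_combination (-r / 4) * hsq + (Δ - (1 + (1 - ξ 2) * (c - 1 / 2))) / 4 * hr2
  refine ⟨⟨hξ, ?_, ?_⟩, ?_⟩
  · change ⟪ξ, r • u⟫ = 0
    rw [inner_smul_right, h, mul_zero]
  · rw [ang_smul]
    change ‖r • u‖ * (1 + (1 - ξ 2) * (c - 1 / 2 + r * ang (ξ, u))) = 1
    rw [hn]
    linear_combination r * hrW + hr2 / 2
  · rw [radial, ang_smul]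
    change 0 < 1 + (1 - ξ 2) * (c - 1 / 2 + 2 * (r * ang (ξ, u)))
    have : 1 + (1 - ξ 2) * (c - 1 / 2 + 2 * (r * ang (ξ, u))) = Δ := by
      linear_combination 2 * hrW
    rwa [this]

theorem radius_eq {c : ℝ} (hc : 3 / 2 < c) {z : Space × Space} (hz : z ∈ hypersurface c) :
    radius c z.1 (‖z.2‖⁻¹ • z.2) = ‖z.2‖ := by
  obtain ⟨h1, h2⟩ := (mem_hypersurface_iff hc).1 hz
  have hN := norm_snd_pos h1
  have hsq := radial_sq h1
  have ha : ang (z.1, ‖z.2‖⁻¹ • z.2) = ‖z.2‖⁻¹ * ang z := ang_smul _ _ _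
  have hs : √((1 + (1 - z.1 2) * (c - 1 / 2)) ^ 2 + 4 * ((1 - z.1 2) * ang (z.1, ‖z.2‖⁻¹ • z.2)))
      = radial c z := by
    have ha' : ang z = ‖z.2‖ * ang (z.1, ‖z.2‖⁻¹ • z.2) := by
      rw [ha, ← mul_assoc, mul_inv_cancel₀ hN.ne', one_mul]
    rw [Real.sqrt_eq_iff_mul_self_eq_of_pos h2]
    rw [ha'] at hsq
    refine mul_left_cancel₀ (pow_ne_zero 2 hN.ne') ?_
    linear_combination hsq
  have hden := radius_denom_pos hc (‖z.2‖⁻¹ • z.2) h1.1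
  rw [hs] at hden
  rw [radius, hs, div_eq_iff hden.ne', radial]
  linear_combination -2 * h1.2.2

/-- Curves in the unit cotangent bundle lift to `Σ_R^c`. -/
theorem exists_tangentVector {c : ℝ} (hc : 3 / 2 < c) {z : Space × Space}
    (hz : z ∈ hypersurface c) {ξ u : ℝ → Space} {ξ' u' : Space} (hξ : HasDerivAt ξ ξ' 0)
    (hu : HasDerivAt u u' 0) (hξ1 : ∀ s, ‖ξ s‖ = 1) (hu1 : ∀ s, ‖u s‖ = 1)
    (h : ∀ s, ⟪ξ s, u s⟫ = 0) (hξ0 : ξ 0 = z.1) (hu0 : u 0 = ‖z.2‖⁻¹ • z.2) :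
    ∃ μ : ℝ, (ξ', μ • z.2 + ‖z.2‖ • u') ∈ tangentVectors (hypersurface c) z := by
  have hN := norm_snd_pos (hypersurface_subset_level hc hz)
  have hd := discrim_pos_of_unit hc (hξ1 0) (hu1 0)
  have hden := radius_denom_pos hc (u 0) (hξ1 0)
  have hdiff : DifferentiableAt ℝ (fun s => radius c (ξ s) (u s)) 0 := by
    have hξi := fun i => (hasDerivAt_euclidean_iff.1 hξ i).differentiableAt
    have hui := fun i => (hasDerivAt_euclidean_iff.1 hu i).differentiableAt
    have h0 := hξi 0
    have h1 := hξi 1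
    have h2 := hξi 2
    have h3 := hui 0
    have h4 := hui 1
    unfold radius
    refine DifferentiableAt.fun_div (by fun_prop) (DifferentiableAt.fun_add (by fun_prop)
      (DifferentiableAt.sqrt ?_ hd.ne')) hden.ne'
    simp only [ang]
    fun_prop
  obtain ⟨r', hr'⟩ : ∃ r', HasDerivAt (fun s => radius c (ξ s) (u s)) r' 0 := ⟨_, hdiff.hasDerivAt⟩
  have hr0 : radius c (ξ 0) (u 0) = ‖z.2‖ := by rw [hξ0, hu0, radius_eq hc hz]
  refine ⟨r' * ‖z.2‖⁻¹, fun s => (ξ s, radius c (ξ s) (u s) • u s), ?_, ?_, ?_⟩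
  · refine Prod.ext hξ0 ?_
    change radius c (ξ 0) (u 0) • u 0 = z.2
    rw [hr0, hu0, smul_smul, mul_inv_cancel₀ hN.ne', one_smul]
  · exact Filter.Eventually.of_forall fun s => radius_mem hc (hξ1 s) (hu1 s) (h s)
  · have := hξ.prodMk (hr'.smul hu)
    rw [hr0, hu0, smul_smul, add_comm (‖z.2‖ • u')] at this
    exact this

theorem IsLinTangent.sub {c : ℝ} {z v w : Space × Space} (hv : IsLinTangent c z v)
    (hw : IsLinTangent c z w) : IsLinTangent c z (v - w) := by
  obtain ⟨h1, h2, h3⟩ := hv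
  obtain ⟨h4, h5, h6⟩ := hw
  refine ⟨?_, ?_, ?_⟩ <;>
    simp only [Prod.fst_sub, Prod.snd_sub, PiLp.sub_apply]
  · linear_combination h1 - h4
  · linear_combination h2 - h5
  · linear_combination h3 - h6

theorem hasDerivAt_great_circle (a b : Space) :
    HasDerivAt (fun s => Real.cos s • a + Real.sin s • b) b 0 := by
  have := ((Real.hasDerivAt_cos 0).smul_const a).fun_add ((Real.hasDerivAt_sin 0).smul_const b)
  simpa using this

theorem norm_great_circle {a b : Space} (ha : ‖a‖ = 1) (hb : ‖b‖ = 1) (hab : ⟪a, b⟫ = 0) (s : ℝ) :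
    ‖Real.cos s • a + Real.sin s • b‖ = 1 := by
  rw [space_norm_eq_one] at *
  rw [space_inner] at hab
  simp
  linear_combination Real.cos s ^ 2 * ha + Real.sin s ^ 2 * hb
    + 2 * Real.cos s * Real.sin s * hab + Real.sin_sq_add_cos_sq s

/-- The difference `D` of two candidates satisfies the linearized constraints, is annihilated by
`λ`, and pairs to zero under `dλ` with velocities of curves in `Σ_R^c`. Two such curves suffice: one
turning the covector, one moving the base point. The unknown radial part `μ` of their velocities is
harmless since `⟪z.2, D.1⟫ = 0`. What remains is a radial covector, excluded because `Σ_R^c` is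
transverse to the rays. -/
theorem eq_reeb_of_isReebVector {c : ℝ} (hc : 3 / 2 < c) {z R : Space × Space}
    (hz : z ∈ hypersurface c) (hR : IsReebVector (hypersurface c) z R) : R = reeb c z := by
  have hsub := hypersurface_subset_level hc
  obtain ⟨hl, hr⟩ := (mem_hypersurface_iff hc).1 hz
  have hN := norm_snd_pos hl
  obtain ⟨u, hu⟩ : ∃ u, u = ‖z.2‖⁻¹ • z.2 := ⟨_, rfl⟩
  have hzu : z.2 = ‖z.2‖ • u := by rw [hu, smul_smul, mul_inv_cancel₀ hN.ne', one_smul]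
  have hu1 : ‖u‖ = 1 := by
    rw [hu, norm_smul, norm_inv, norm_norm, inv_mul_cancel₀ hN.ne']
  have hξu : ⟪z.1, u⟫ = 0 := by rw [hu, inner_smul_right, hl.2.1, mul_zero]
  have he1 := norm_cross_eq_one hl.1 hu1 hξu
  have hD := (isLinTangent_of_mem hsub hz hR.tangent).sub (isLinTangent_reeb hl hr)
  have hker : ∀ v ∈ tangentVectors (hypersurface c) z, dLiouville (R - reeb c z) v = 0 := by
    intro v hv
    have h1 := hR.kernel v hv
    have h2 := dLiouville_reeb hl (isLinTangent_of_mem hsub hz hv)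
    rw [dLiouville] at *
    rw [Prod.fst_sub, Prod.snd_sub, inner_sub_left, inner_sub_right]
    linarith
  have hnorm : ⟪z.2, (R - reeb c z).1⟫ = 0 := by
    have h1 := hR.normalized
    have h2 := liouville_reeb hl hr
    rw [liouville] at *
    rw [Prod.fst_sub, inner_sub_right]
    linarith
  obtain ⟨D, hDdef⟩ : ∃ D, D = R - reeb c z := ⟨_, rfl⟩
  rw [← hDdef] at hD hker hnorm
  have hud : ⟪u, D.1⟫ = 0 := by rw [hu, real_inner_smul_left, hnorm, mul_zero]
  have hξd : ⟪z.1, D.1⟫ = 0 := by rw [space_inner]; exact hD.sphere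
  -- vary the direction of the covector
  have hed : ⟪cross z.1 u, D.1⟫ = 0 := by
    obtain ⟨μ, hμ⟩ := exists_tangentVector hc hz (hasDerivAt_const 0 z.1)
      (hasDerivAt_great_circle u (cross z.1 u)) (fun _ => hl.1)
      (norm_great_circle hu1 he1 (inner_cross_right _ _))
      (fun s => by
        rw [inner_add_right, inner_smul_right, inner_smul_right, hξu, inner_cross_left]; ring)
      rfl (by simp [hu])
    have := hker _ hμ
    rw [dLiouville] at this
    simp only [inner_zero_right, inner_add_left, real_inner_smul_left, hnorm] at this
    have h' : ‖z.2‖ * ⟪cross z.1 u, D.1⟫ = 0 := by linarith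
    exact (mul_eq_zero.1 h').resolve_left hN.ne'
  have hD1 : D.1 = 0 := eq_zero_of_orthogonal hl.1 hu1 hξu hξd hud hed
  -- vary the base point
  have hed2 : ⟪cross z.1 u, D.2⟫ = 0 := by
    obtain ⟨μ, hμ⟩ := exists_tangentVector hc hz (hasDerivAt_great_circle z.1 (cross z.1 u))
      (hasDerivAt_const 0 u) (norm_great_circle hl.1 he1 (inner_cross_left _ _)) (fun _ => hu1)
      (fun s => by
        rw [inner_add_left, real_inner_smul_left, real_inner_smul_left, hξu, real_inner_comm,
          inner_cross_right]; ring)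
      (by simp) hu
    have := hker _ hμ
    rw [dLiouville, hD1, inner_zero_right, sub_zero, real_inner_comm] at this
    exact this
  have hξd2 : ⟪z.1, D.2⟫ = 0 := by
    have := hD.fibre
    rw [hD1] at this
    rw [space_inner]
    simpa using this
  have hrad : D.2 = (⟪u, D.2⟫) • u := by
    rw [← sub_eq_zero]
    refine eq_zero_of_orthogonal hl.1 hu1 hξu ?_ ?_ ?_
    · rw [inner_sub_right, inner_smul_right, hξd2, hξu]; ring
    · rw [inner_sub_right, inner_smul_right, real_inner_self_eq_norm_sq, hu1]; ring
    · rw [inner_sub_right, inner_smul_right, hed2, real_inner_comm u, inner_cross_right]; ring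
  have hζ : ⟪u, D.2⟫ = 0 := by
    have h1 := hD.energy
    generalize ⟪u, D.2⟫ = ζ at hrad
    rw [hD1, hrad] at h1
    have hp := one_add_ang_mul_pos hl hr
    have hang : ang z = ‖z.2‖ * (z.1 1 * u 0 - z.1 0 * u 1) := by
      rw [ang, hzu, norm_smul, hu1]; simp; ring
    have hu2 := space_norm_eq_one.1 hu1
    have hz0 : z.2 0 = ‖z.2‖ * u 0 := congrFun (congrArg WithLp.ofLp hzu) 0
    have hz1 : z.2 1 = ‖z.2‖ * u 1 := congrFun (congrArg WithLp.ofLp hzu) 1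
    have hz2 : z.2 2 = ‖z.2‖ * u 2 := congrFun (congrArg WithLp.ofLp hzu) 2
    rw [hz0, hz1, hz2] at h1
    simp at h1
    have h2 : ζ * ‖z.2‖ * (1 + ang z * dist0 z) = 0 := by
      rw [dist0]
      linear_combination h1 - ζ * ‖z.2‖ * hu2 + ζ * ‖z.2‖ ^ 2 * (1 - z.1 2) * hang
    have h3 := (mul_eq_zero.1 h2).resolve_right hp.ne'
    exact (mul_eq_zero.1 h3).resolve_right hN.ne'
  rw [hζ, zero_smul] at hrad
  have : D = 0 := Prod.ext hD1 hrad
  rw [hDdef, sub_eq_zero] at this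
  exact this

theorem isReebVector_reeb {c : ℝ} (hc : 3 / 2 < c) {z : Space × Space} (hz : z ∈ hypersurface c)
    (ht : reeb c z ∈ tangentVectors (hypersurface c) z) :
    IsReebVector (hypersurface c) z (reeb c z) := by
  obtain ⟨hl, hr⟩ := (mem_hypersurface_iff hc).1 hz
  exact ⟨ht, liouville_reeb hl hr, fun v hv =>
    dLiouville_reeb hl (isLinTangent_of_mem (hypersurface_subset_level hc) hz hv)⟩

/-- Reeb orbits on `Σ_R^c` are the integral curves of `reeb`. -/
theorem isReebOrbit_iff {c : ℝ} (hc : 3 / 2 < c) {γ : ℝ → Space × Space} :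
    IsReebOrbit (hypersurface c) γ ↔
      ∀ t, γ t ∈ hypersurface c ∧ HasDerivAt γ (reeb c (γ t)) t := by
  constructor
  · intro h t
    obtain ⟨R, h1, h2⟩ := h.reeb t
    refine ⟨h.mem t, ?_⟩
    rwa [eq_reeb_of_isReebVector hc (h.mem t) h2] at h1
  · intro h
    refine ⟨fun t => (h t).1, fun t => ⟨_, (h t).2, isReebVector_reeb hc (h t).1 ?_⟩⟩
    -- The orbit itself is the curve witnessing that `reeb` is tangent, so no separate integration
    -- of the field is needed.
    refine ⟨fun s => γ (t + s), by simp, Filter.Eventually.of_forall fun s => (h _).1, ?_⟩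
    have := (h (t + 0)).2
    have := HasDerivAt.comp_const_add t 0 this
    simpa using this


/-! ### Integrals and evolution along Reeb orbits -/

theorem pos_zero (z : Space × Space) : pos z 0 = (1 - z.1 2) * z.2 0 + z.2 2 * z.1 0 := rfl

theorem pos_one (z : Space × Space) : pos z 1 = (1 - z.1 2) * z.2 1 + z.2 2 * z.1 1 := rfl

/-- The Runge-Lenz vector, as a function on `T*S²`. -/
def lenz (c : ℝ) (z : Space × Space) : Plane :=
  !₂[z.2 0 - (c + ang z + 1 / 2) * pos z 0, z.2 1 - (c + ang z + 1 / 2) * pos z 1]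

theorem lenz_zero (c : ℝ) (z : Space × Space) :
    lenz c z 0 = z.2 0 - (c + ang z + 1 / 2) * pos z 0 := rfl

theorem lenz_one (c : ℝ) (z : Space × Space) :
    lenz c z 1 = z.2 1 - (c + ang z + 1 / 2) * pos z 1 := rfl

theorem norm_snd_eq {c : ℝ} {z : Space × Space} (hz : z ∈ level c) :
    ‖z.2‖ = 1 - (c + ang z - 1 / 2) * dist0 z := by
  rw [dist0]; linear_combination hz.2.2

theorem snd_two_sq_of_sphere {z : Space × Space} (h1 : ‖z.1‖ = 1) (h2 : ⟪z.1, z.2⟫ = 0) :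
    z.2 2 ^ 2 = 2 * ‖z.2‖ * dist0 z - dist0 z ^ 2 - ang z ^ 2 := by
  rw [space_norm_eq_one] at h1
  rw [space_inner] at h2
  have h3 := space_norm_sq z.2
  rw [dist0, ang]
  linear_combination (z.2 0 ^ 2 + z.2 1 ^ 2) * h1 - (1 - z.1 2 ^ 2) * h3
    - (z.1 0 * z.2 0 + z.1 1 * z.2 1 - z.1 2 * z.2 2) * h2

/-- Conservation of energy for the radial Kepler motion: `η₂ = -⟪p, q⟫`, and the Kepler energy in
inertial coordinates is `-(c + L)`. -/
theorem snd_two_sq {c : ℝ} {z : Space × Space} (hz : z ∈ level c) :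
    z.2 2 ^ 2 = 2 * dist0 z - 2 * (c + ang z) * dist0 z ^ 2 - ang z ^ 2 := by
  rw [snd_two_sq_of_sphere hz.1 hz.2.1, norm_snd_eq hz]; ring

theorem pos_sq {z : Space × Space} (h1 : ‖z.1‖ = 1) (h2 : ⟪z.1, z.2⟫ = 0) :
    pos z 0 ^ 2 + pos z 1 ^ 2 = dist0 z ^ 2 := by
  rw [space_norm_eq_one] at h1
  rw [space_inner] at h2
  have h3 := space_norm_sq z.2
  rw [dist0, mul_pow, h3, pos_zero, pos_one]
  linear_combination z.2 2 ^ 2 * h1 + 2 * (1 - z.1 2) * z.2 2 * h2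

/-- The classical relation `e² = 1 + 2 E L²` with Kepler energy `E = -(c + L)`. -/
theorem lenz_sq {c : ℝ} {z : Space × Space} (hz : z ∈ level c) :
    lenz c z 0 ^ 2 + lenz c z 1 ^ 2 = 1 - 2 * (c + ang z) * ang z ^ 2 := by
  have h1 := pos_sq hz.1 hz.2.1
  have h2 := snd_two_sq_of_sphere hz.1 hz.2.1
  have h3 := norm_snd_eq hz
  have h4 := space_norm_sq z.2
  have h5 := hz.2.1
  rw [space_inner] at h5
  have h6 : z.2 0 * pos z 0 + z.2 1 * pos z 1 = ‖z.2‖ * dist0 z - z.2 2 ^ 2 := by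
    rw [pos_zero, pos_one, dist0]
    linear_combination z.2 2 * h5 - (1 - z.1 2) * h4
  have h7 : lenz c z 0 ^ 2 + lenz c z 1 ^ 2 = ‖z.2‖ ^ 2 - z.2 2 ^ 2
      - 2 * (c + ang z + 1 / 2) * (‖z.2‖ * dist0 z - z.2 2 ^ 2)
      + (c + ang z + 1 / 2) ^ 2 * dist0 z ^ 2 := by
    rw [← h1, ← h6, lenz_zero, lenz_one, h4]; ring
  rw [h7, h2, h3]
  ring

theorem dist0_nonneg {z : Space × Space} (hz : ‖z.1‖ = 1) : 0 ≤ dist0 z :=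
  mul_nonneg (norm_nonneg _) (by linarith [(fst_two_le_one hz).1])

/-- If `L = -l` with `l ≥ 1`, then `radial > 0` gives `lr < 1` for the distance `r`. Inserting this
and `c > 3/2` into the nonnegativity of `η₂²` yields `l⁴ < 4l - 3`, contrary to `l⁴ - 4l + 3 = (l -
1)²((l + 1)² + 2) ≥ 0`. -/
theorem neg_one_lt_ang {c : ℝ} (hc : 3 / 2 < c) {z : Space × Space} (hz : z ∈ hypersurface c) :
    -1 < ang z := by
  obtain ⟨hl, hr⟩ := (mem_hypersurface_iff hc).1 hz
  have h1 := one_add_ang_mul_pos hl hr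
  have h2 := snd_two_sq hl
  have h3 := dist0_nonneg hl.1
  have h4 := sq_nonneg (z.2 2)
  rw [h2] at h4
  generalize dist0 z = r at *
  generalize ang z = L at *
  by_contra hL
  obtain ⟨l, rfl⟩ : ∃ l, L = -l := ⟨-L, by ring⟩
  have hl1 : 1 ≤ l := by linarith
  have hlr : l * r < 1 := by linarith
  have h5 : 2 * r + (2 * l - 3) * r ^ 2 - l ^ 2 ≥ 0 := by nlinarith [sq_nonneg r]
  have hr1 : r < 1 := by nlinarith
  have h6 : l ^ 2 * (2 * r + (2 * l - 3) * r ^ 2) < 4 * l - 3 := by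
    have : l ^ 2 * (2 * r + (2 * l - 3) * r ^ 2)
        = 4 * l - 3 - (1 - l * r) * (4 * l - 3 + (2 * l - 3) * (l * r)) := by ring
    rw [this]
    have h8 : 0 ≤ l * r := by positivity
    have : 0 < (1 - l * r) * (4 * l - 3 + (2 * l - 3) * (l * r)) := by
      refine mul_pos (by linarith) ?_
      nlinarith
    linarith
  have h7 : l ^ 4 - 4 * l + 3 ≥ 0 := by
    have : l ^ 4 - 4 * l + 3 = (l - 1) ^ 2 * ((l + 1) ^ 2 + 2) := by ring
    rw [this]; positivity
  nlinarith [mul_le_mul_of_nonneg_left h5 (sq_nonneg l)]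

/-! ### Derivatives along a Reeb orbit. -/

section Orbit

variable {c : ℝ} {γ : ℝ → Space × Space} {t : ℝ}

theorem hasDerivAt_ang (h : HasDerivAt γ (reeb c (γ t)) t) :
    HasDerivAt (fun s => ang (γ s)) 0 t := by
  obtain ⟨x0, x1, x2⟩ := hasDerivAt_space_iff.1 (hasDerivAt_fst h)
  obtain ⟨y0, y1, y2⟩ := hasDerivAt_space_iff.1 (hasDerivAt_snd h)
  refine ((x1.mul y0).sub (x0.mul y1)).congr_deriv ?_
  rw [reeb_fst_zero, reeb_fst_one, reeb_snd_zero, reeb_snd_one]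
  ring

/-- The energy constraint expresses the norm as the reciprocal of an affine function of `ξ₂`,
because `L` is constant; the norm itself is never differentiated. -/
theorem hasDerivAt_norm_snd (hl : ∀ s, γ s ∈ level c) (h : HasDerivAt γ (reeb c (γ t)) t) :
    HasDerivAt (fun s => ‖(γ s).2‖) (rate (γ t) * ((c + ang (γ t) - 1 / 2) * (γ t).2 2)) t := by
  obtain ⟨x0, x1, x2⟩ := hasDerivAt_space_iff.1 (hasDerivAt_fst h)
  have hN := norm_snd_pos (hl t)
  have hK := (hl t).2.2
  have hD : ∀ s, 1 + (1 - (γ s).1 2) * (c - 1 / 2 + ang (γ s)) ≠ 0 := fun s hs => by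
    have := (hl s).2.2
    rw [hs, mul_zero] at this
    norm_num at this
  have h1 := (((x2.const_sub 1).mul ((hasDerivAt_ang h).const_add (c - 1 / 2))).const_add 1).inv
    (hD t)
  refine (h1.congr_of_eventuallyEq (Filter.Eventually.of_forall fun s => ?_)).congr_deriv ?_
  · exact eq_inv_of_mul_eq_one_left (hl s).2.2
  · change -(_ * _ + _ * 0) / (1 + (1 - (γ t).1 2) * (c - 1 / 2 + ang (γ t))) ^ 2 = _
    rw [eq_inv_of_mul_eq_one_right hK, reeb_fst_two]
    field_simp
    ring

theorem hasDerivAt_snd_two (hl : γ t ∈ level c) (h : HasDerivAt γ (reeb c (γ t)) t) :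
    HasDerivAt (fun s => (γ s).2 2)
      (-(rate (γ t) * (1 - 2 * (c + ang (γ t)) * dist0 (γ t)))) t := by
  obtain ⟨y0, y1, y2⟩ := hasDerivAt_space_iff.1 (hasDerivAt_snd h)
  refine y2.congr_deriv ?_
  rw [reeb_snd_two, dist0]
  linear_combination -rate (γ t) * hl.2.2

theorem hasDerivAt_dist0 (hl : ∀ s, γ s ∈ level c) (h : HasDerivAt γ (reeb c (γ t)) t) :
    HasDerivAt (fun s => dist0 (γ s)) (-(rate (γ t) * (γ t).2 2)) t := by
  obtain ⟨x0, x1, x2⟩ := hasDerivAt_space_iff.1 (hasDerivAt_fst h)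
  have hN := (norm_snd_pos (hl t)).ne'
  refine ((hasDerivAt_norm_snd hl h).mul (x2.const_sub 1)).congr_deriv ?_
  rw [reeb_fst_two]
  have hK := (hl t).2.2
  field_simp
  linear_combination (2 * rate (γ t) * (γ t).2 2) * hK

theorem hasDerivAt_pos_zero (h : HasDerivAt γ (reeb c (γ t)) t) :
    HasDerivAt (fun s => pos (γ s) 0)
      (rate (γ t) * (-(‖(γ t).2‖ * (γ t).1 0) + dist0 (γ t) * pos (γ t) 1)) t := by
  obtain ⟨x0, x1, x2⟩ := hasDerivAt_space_iff.1 (hasDerivAt_fst h)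
  obtain ⟨y0, y1, y2⟩ := hasDerivAt_space_iff.1 (hasDerivAt_snd h)
  refine (((x2.const_sub 1).mul y0).add (y2.mul x0)).congr_deriv ?_
  rw [reeb_fst_zero, reeb_fst_two, reeb_snd_zero, reeb_snd_two, pos_one]
  ring

theorem hasDerivAt_pos_one (h : HasDerivAt γ (reeb c (γ t)) t) :
    HasDerivAt (fun s => pos (γ s) 1)
      (rate (γ t) * (-(‖(γ t).2‖ * (γ t).1 1) - dist0 (γ t) * pos (γ t) 0)) t := by
  obtain ⟨x0, x1, x2⟩ := hasDerivAt_space_iff.1 (hasDerivAt_fst h)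
  obtain ⟨y0, y1, y2⟩ := hasDerivAt_space_iff.1 (hasDerivAt_snd h)
  refine (((x2.const_sub 1).mul y1).add (y2.mul x1)).congr_deriv ?_
  rw [reeb_fst_one, reeb_fst_two, reeb_snd_one, reeb_snd_two, pos_zero]
  ring

/-- The Kepler part of the motion preserves the Runge-Lenz vector, so only the rotation of the frame
is left, at unit rate in physical time. -/
theorem hasDerivAt_lenz_zero (h : HasDerivAt γ (reeb c (γ t)) t) :
    HasDerivAt (fun s => lenz c (γ s) 0) (rate (γ t) * dist0 (γ t) * lenz c (γ t) 1) t := by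
  obtain ⟨y0, y1, y2⟩ := hasDerivAt_space_iff.1 (hasDerivAt_snd h)
  refine (y0.sub ((((hasDerivAt_ang h).const_add c).add_const (1 / 2)).mul
    (hasDerivAt_pos_zero h))).congr_deriv ?_
  rw [reeb_snd_zero, lenz_one]
  ring

theorem hasDerivAt_lenz_one (h : HasDerivAt γ (reeb c (γ t)) t) :
    HasDerivAt (fun s => lenz c (γ s) 1) (-(rate (γ t) * dist0 (γ t)) * lenz c (γ t) 0) t := by
  obtain ⟨y0, y1, y2⟩ := hasDerivAt_space_iff.1 (hasDerivAt_snd h)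
  refine (y1.sub ((((hasDerivAt_ang h).const_add c).add_const (1 / 2)).mul
    (hasDerivAt_pos_one h))).congr_deriv ?_
  rw [reeb_snd_one, lenz_zero]
  ring

theorem ang_eq_ang_zero (h : ∀ t, HasDerivAt γ (reeb c (γ t)) t) (t : ℝ) :
    ang (γ t) = ang (γ 0) :=
  is_const_of_deriv_eq_zero (fun s => (hasDerivAt_ang (h s)).differentiableAt)
    (fun s => (hasDerivAt_ang (h s)).deriv) t 0

end Orbit

/-- A planar vector whose velocity is its rotation by a right angle with rate `θ'`. -/
theorem eq_rotation_of_hasDerivAt {x y θ g : ℝ → ℝ} (hx : ∀ t, HasDerivAt x (g t * y t) t)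
    (hy : ∀ t, HasDerivAt y (-(g t) * x t) t) (hθ : ∀ t, HasDerivAt θ (g t) t) (h0 : θ 0 = 0)
    (t : ℝ) : x t = x 0 * Real.cos (θ t) + y 0 * Real.sin (θ t) ∧
      y t = y 0 * Real.cos (θ t) - x 0 * Real.sin (θ t) := by
  have h1 : ∀ t, HasDerivAt (fun t => x t * Real.cos (θ t) - y t * Real.sin (θ t)) 0 t :=
    fun t => (((hx t).mul (hθ t).cos).sub ((hy t).mul (hθ t).sin)).congr_deriv (by ring)
  have h2 : ∀ t, HasDerivAt (fun t => y t * Real.cos (θ t) + x t * Real.sin (θ t)) 0 t :=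
    fun t => (((hy t).mul (hθ t).cos).add ((hx t).mul (hθ t).sin)).congr_deriv (by ring)
  have e1 := is_const_of_deriv_eq_zero (fun s => (h1 s).differentiableAt)
    (fun s => (h1 s).deriv) t 0
  have e2 := is_const_of_deriv_eq_zero (fun s => (h2 s).differentiableAt)
    (fun s => (h2 s).deriv) t 0
  simp only [h0, Real.cos_zero, Real.sin_zero] at e1 e2
  have h3 := Real.sin_sq_add_cos_sq (θ t)
  constructor
  · linear_combination (-x t) * h3 + Real.cos (θ t) * e1 + Real.sin (θ t) * e2
  · linear_combination (-y t) * h3 + Real.cos (θ t) * e2 - Real.sin (θ t) * e1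

theorem exists_int_of_rotation {x y θ : ℝ} (h : x ^ 2 + y ^ 2 ≠ 0)
    (hx : x = x * Real.cos θ + y * Real.sin θ) (hy : y = y * Real.cos θ - x * Real.sin θ) :
    ∃ n : ℤ, θ = 2 * Real.pi * n := by
  have : Real.cos θ = 1 := by
    refine mul_left_cancel₀ h ?_
    linear_combination -x * hx - y * hy
  obtain ⟨n, hn⟩ := (Real.cos_eq_one_iff θ).1 this
  exact ⟨n, by linarith⟩

theorem exists_nat_of_int {n : ℤ} (h : (0 : ℝ) < n) : ∃ k : ℕ, 1 ≤ k ∧ (n : ℝ) = k := by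
  have h' : 0 < n := by exact_mod_cast h
  obtain ⟨k, rfl⟩ := Int.eq_ofNat_of_zero_le h'.le
  exact ⟨k, by omega, by simp⟩


/-! ### Periods -/

theorem continuous_dist0 : Continuous dist0 := by unfold dist0; fun_prop

theorem noncircular_period {c : ℝ} (hc : 3 / 2 < c) {γ : ℝ → Space × Space}
    (h : ∀ t, γ t ∈ hypersurface c ∧ HasDerivAt γ (reeb c (γ t)) t) {T : ℝ} (hT : 0 < T)
    (hper : Function.Periodic γ T) (hne : 2 * (c + ang (γ 0)) * ang (γ 0) ^ 2 ≠ 1) :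
    ∃ k l : ℕ, 1 ≤ k ∧ 1 ≤ l ∧ ∃ w : ℝ, 0 < w ∧ w ^ 2 = 2 * (c + ang (γ 0)) ∧
      (k : ℝ) = l * w ^ 3 ∧ T = 2 * Real.pi * (k / w + l * ang (γ 0)) := by
  have hd := fun t => (h t).2
  have hlev := fun t => hypersurface_subset_level hc (h t).1
  have hL := ang_eq_ang_zero hd
  have hLm := neg_one_lt_ang hc (h 0).1
  have hp : ∀ t, 0 < 1 + ang (γ t) * dist0 (γ t) := fun t =>
    one_add_ang_mul_pos (hlev t) ((mem_hypersurface_iff hc).1 (h t).1).2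
  have hlenz := lenz_sq (hlev 0)
  have hsnd := snd_two_sq (hlev 0)
  set L := ang (γ 0) with hLdef
  have hΛ : 0 < 2 * (c + L) := by linarith
  set w := √(2 * (c + L)) with hw
  have hwpos : 0 < w := Real.sqrt_pos.2 hΛ
  have hw2 : w ^ 2 = 2 * (c + L) := Real.sq_sqrt hΛ.le
  have hγc : Continuous γ := continuous_iff_continuousAt.2 fun t => (hd t).continuousAt
  have hrpos : ∀ t, 0 < rate (γ t) := fun t => one_div_pos.2 (hp t)
  have hrc : Continuous fun t => rate (γ t) := by
    have h1 := continuous_ang.comp hγc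
    have h2 := continuous_dist0.comp hγc
    exact continuous_const.div (continuous_const.add (h1.mul h2)) fun t => (hp t).ne'
  -- the regularized time
  set s : ℝ → ℝ := fun t => ∫ x in (0 : ℝ)..t, rate (γ x) with hs
  have hsd : ∀ t, HasDerivAt s (rate (γ t)) t := fun t =>
    intervalIntegral.integral_hasDerivAt_right (hrc.intervalIntegrable _ _)
      (hrc.stronglyMeasurableAtFilter _ _) hrc.continuousAt
  have hs0 : s 0 = 0 := by simp [hs]
  have hsT : 0 < s T :=
    intervalIntegral.intervalIntegral_pos_of_pos (hrc.intervalIntegrable _ _) hrpos hT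
  -- the physical time
  set τ : ℝ → ℝ := fun t => (s t + ((γ t).2 2 - (γ 0).2 2)) / w ^ 2 with hτ
  have hτd : ∀ t, HasDerivAt τ (rate (γ t) * dist0 (γ t)) t := fun t => by
    refine (((hsd t).add ((hasDerivAt_snd_two (hlev t) (hd t)).sub_const _)).div_const
      _).congr_deriv ?_
    rw [hL t, ← hw2]
    field_simp
    ring
  have hτ0 : τ 0 = 0 := by simp [hτ, hs0]
  have hτT : τ T = s T / w ^ 2 := by
    have : γ T = γ 0 := by simpa using hper 0
    simp [hτ, this]
  -- Integrates `1 = rate * (1 + L * dist0)`: Reeb time is regularized time plus `L` times physical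
  -- time.
  have htime : T = s T + L * τ T := by
    have hcon : ∀ t, HasDerivAt (fun t => s t + L * τ t - t) 0 t := fun t => by
      refine (((hsd t).add ((hτd t).const_mul L)).sub (hasDerivAt_id t)).congr_deriv ?_
      have : rate (γ t) * (1 + ang (γ t) * dist0 (γ t)) = 1 := one_div_mul_cancel (hp t).ne'
      rw [hL t] at this
      linear_combination this
    have := is_const_of_deriv_eq_zero (fun t => (hcon t).differentiableAt)
      (fun t => (hcon t).deriv) T 0
    simp only [hs0, hτ0] at this
    linarith
  have hγT : γ T = γ 0 := by simpa using hper 0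
  -- the Runge-Lenz vector rotates with the physical time
  obtain ⟨hA0, hA1⟩ := eq_rotation_of_hasDerivAt (fun t => hasDerivAt_lenz_zero (hd t))
    (fun t => hasDerivAt_lenz_one (hd t)) hτd hτ0 T
  rw [hγT] at hA0 hA1
  obtain ⟨n, hn⟩ := exists_int_of_rotation (by rw [hlenz]; intro h'; exact hne (by linarith))
    hA0 hA1
  -- the distance oscillates with the regularized time
  have hx : ∀ t, HasDerivAt (fun t => w ^ 2 * dist0 (γ t) - 1)
      ((w * rate (γ t)) * (-w * (γ t).2 2)) t := fun t =>
    (((hasDerivAt_dist0 hlev (hd t)).const_mul (w ^ 2)).sub_const 1).congr_deriv (by ring)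
  have hy : ∀ t, HasDerivAt (fun t => -w * (γ t).2 2)
      (-(w * rate (γ t)) * (w ^ 2 * dist0 (γ t) - 1)) t := fun t =>
    ((hasDerivAt_snd_two (hlev t) (hd t)).const_mul (-w)).congr_deriv (by
      rw [hL t, ← hw2]; ring)
  obtain ⟨hB0, hB1⟩ := eq_rotation_of_hasDerivAt hx hy (fun t => (hsd t).const_mul w)
    (by rw [hs0, mul_zero]) T
  simp only [hγT] at hB0 hB1
  -- The squared length of the rotating vector is `1 - w² L²`, the same eccentricity as for the
  -- Runge-Lenz vector, hence nonzero by `hne`.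
  obtain ⟨m, hm⟩ := exists_int_of_rotation (by
    intro h'
    rw [← hw2] at hsnd
    refine hne ?_
    rw [← hw2]
    linear_combination w ^ 2 * hsnd - h') hB0 hB1
  have hπ := Real.pi_pos
  have hmpos : (0 : ℝ) < m := by
    have : 0 < w * s T := mul_pos hwpos hsT
    rw [hm] at this
    exact (mul_pos_iff_of_pos_left (by positivity)).1 this
  have hnpos : (0 : ℝ) < n := by
    have : 0 < τ T := by rw [hτT]; positivity
    rw [hn] at this
    exact (mul_pos_iff_of_pos_left (by positivity)).1 this
  obtain ⟨k, hk, hmk⟩ := exists_nat_of_int hmpos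
  obtain ⟨l, hl, hnl⟩ := exists_nat_of_int hnpos
  rw [hmk] at hm
  rw [hnl] at hn
  have hsT' : s T = 2 * Real.pi * k / w := by field_simp; linarith
  refine ⟨k, l, hk, hl, w, hwpos, hw2, ?_, ?_⟩
  · rw [hn, hsT'] at hτT
    field_simp at hτT
    linarith
  · rw [htime, hn, hsT']; ring

/-- The states of circular orbits. -/
theorem circular_state {c : ℝ} {z : Space × Space} (hz : z ∈ level c)
    (h : 2 * (c + ang z) * ang z ^ 2 = 1) :
    dist0 z = ang z ^ 2 ∧ z.2 2 = 0 ∧ ‖z.2‖ = (1 + ang z ^ 2) / 2 := by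
  have h1 := snd_two_sq hz
  have hne : ang z ≠ 0 := by rintro h'; rw [h'] at h; norm_num at h
  -- At eccentricity zero the radial energy equation times `L²` becomes a sum of two squares equal
  -- to zero.
  have h2 : (ang z * z.2 2) ^ 2 + (dist0 z - ang z ^ 2) ^ 2 = 0 := by
    linear_combination ang z ^ 2 * h1 - dist0 z ^ 2 * h
  have h3 : dist0 z = ang z ^ 2 := by nlinarith [sq_nonneg (ang z * z.2 2)]
  have h4 : ang z * z.2 2 = 0 := by nlinarith [sq_nonneg (dist0 z - ang z ^ 2)]
  refine ⟨h3, (mul_eq_zero.1 h4).resolve_left hne, ?_⟩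
  rw [norm_snd_eq hz, h3]
  linear_combination -h / 2

/-- On circular orbits, the state is a function of the position. -/
theorem circular_eq_pos {c : ℝ} {z : Space × Space} (hz : z ∈ level c)
    (h : 2 * (c + ang z) * ang z ^ 2 = 1) :
    ‖z.2‖ * z.1 0 * ang z = -pos z 1 ∧ ‖z.2‖ * z.1 1 * ang z = pos z 0 ∧
      ang z ^ 2 * z.2 0 = (1 + ang z ^ 2) / 2 * pos z 0 ∧
      ang z ^ 2 * z.2 1 = (1 + ang z ^ 2) / 2 * pos z 1 ∧
      (1 + ang z ^ 2) * (1 - z.1 2) = 2 * ang z ^ 2 := by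
  obtain ⟨h1, h2, h3⟩ := circular_state hz h
  have hN := norm_snd_pos hz
  have h4 := hz.2.1
  rw [space_inner, h2] at h4
  have h5 := space_norm_sq z.2
  rw [h2] at h5
  have hρ : ‖z.2‖ * (1 - z.1 2) = ang z ^ 2 := h1
  have h6 : ‖z.2‖ ^ 2 * z.1 0 = -(ang z * z.2 1) := by
    rw [h5, ang]; linear_combination z.2 0 * h4
  have h7 : ‖z.2‖ ^ 2 * z.1 1 = ang z * z.2 0 := by
    rw [h5, ang]; linear_combination z.2 1 * h4
  refine ⟨?_, ?_, ?_, ?_, ?_⟩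
  · refine mul_left_cancel₀ hN.ne' ?_
    rw [pos_one, h2]
    linear_combination ang z * h6 + z.2 1 * hρ
  · refine mul_left_cancel₀ hN.ne' ?_
    rw [pos_zero, h2]
    linear_combination ang z * h7 - z.2 0 * hρ
  · rw [pos_zero, h2, ← h3, ← hρ]; ring
  · rw [pos_one, h2, ← h3, ← hρ]; ring
  · rw [h3] at hρ; linarith

theorem circular_ext {c : ℝ} {z w : Space × Space} (hz : z ∈ level c) (hw : w ∈ level c)
    (h : 2 * (c + ang z) * ang z ^ 2 = 1) (hL : ang w = ang z) (hpos : pos w = pos z) : w = z := by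
  have h' : 2 * (c + ang w) * ang w ^ 2 = 1 := by rw [hL]; exact h
  obtain ⟨-, z1, z2⟩ := circular_state hz h
  obtain ⟨-, w1, w2⟩ := circular_state hw h'
  obtain ⟨z3, z4, z5, z6, z7⟩ := circular_eq_pos hz h
  obtain ⟨w3, w4, w5, w6, w7⟩ := circular_eq_pos hw h'
  have hne : ang z ≠ 0 := by rintro h0; rw [h0] at h; norm_num at h
  have hN := norm_snd_pos hz
  have hNw : ‖w.2‖ = ‖z.2‖ := by rw [z2, w2, hL]
  rw [hL, hpos] at w3 w4 w5 w6
  rw [hL] at w7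
  rw [hNw] at w3 w4
  have hsq : ang z ^ 2 ≠ 0 := pow_ne_zero 2 hne
  refine Prod.ext (space_ext ?_ ?_ ?_) (space_ext ?_ ?_ ?_)
  · refine mul_left_cancel₀ (mul_ne_zero hN.ne' hne) ?_; linarith
  · refine mul_left_cancel₀ (mul_ne_zero hN.ne' hne) ?_; linarith
  · have : 0 < 1 + ang z ^ 2 := by positivity
    refine mul_left_cancel₀ this.ne' ?_; linarith
  · refine mul_left_cancel₀ hsq ?_; linarith
  · refine mul_left_cancel₀ hsq ?_; linarith
  · rw [z1, w1]

section Circular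

variable {c : ℝ} {γ : ℝ → Space × Space}

theorem circular_hasDerivAt_pos (hc : 3 / 2 < c)
    (h : ∀ t, γ t ∈ hypersurface c ∧ HasDerivAt γ (reeb c (γ t)) t)
    (hcirc : 2 * (c + ang (γ 0)) * ang (γ 0) ^ 2 = 1) (t : ℝ) :
    HasDerivAt (fun s => pos (γ s) 0) ((ang (γ 0))⁻¹ * pos (γ t) 1) t ∧
      HasDerivAt (fun s => pos (γ s) 1) (-(ang (γ 0))⁻¹ * pos (γ t) 0) t := by
  have hd := fun t => (h t).2
  have hl := hypersurface_subset_level hc (h t).1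
  have hL := ang_eq_ang_zero hd t
  have hp := one_add_ang_mul_pos hl ((mem_hypersurface_iff hc).1 (h t).1).2
  have hcirc' : 2 * (c + ang (γ t)) * ang (γ t) ^ 2 = 1 := by rw [hL]; exact hcirc
  obtain ⟨h1, h2, h3⟩ := circular_state hl hcirc'
  obtain ⟨h4, h5, -⟩ := circular_eq_pos hl hcirc'
  have hne : ang (γ 0) ≠ 0 := by rintro h0; rw [h0] at hcirc; norm_num at hcirc
  have hr : rate (γ t) * (1 + ang (γ t) * dist0 (γ t)) = 1 := one_div_mul_cancel hp.ne'
  rw [h1] at hr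
  rw [hL] at *
  constructor
  · refine (hasDerivAt_pos_zero (hd t)).congr_deriv ?_
    rw [h1]
    field_simp
    linear_combination -rate (γ t) * h4 + pos (γ t) 1 * hr
  · refine (hasDerivAt_pos_one (hd t)).congr_deriv ?_
    rw [h1]
    field_simp
    linear_combination -rate (γ t) * h5 - pos (γ t) 0 * hr

/-- The position turns at the constant rate `1 / L` in Reeb time, and by `circular_ext` the position
determines the whole state. -/
theorem circular_periodic_iff (hc : 3 / 2 < c)
    (h : ∀ t, γ t ∈ hypersurface c ∧ HasDerivAt γ (reeb c (γ t)) t)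
    (hcirc : 2 * (c + ang (γ 0)) * ang (γ 0) ^ 2 = 1) {T : ℝ} :
    Function.Periodic γ T ↔ ∃ n : ℤ, T = 2 * Real.pi * ang (γ 0) * n := by
  have hd := fun t => (h t).2
  have hlev := fun t => hypersurface_subset_level hc (h t).1
  have hL := ang_eq_ang_zero hd
  have hne : ang (γ 0) ≠ 0 := by rintro h0; rw [h0] at hcirc; norm_num at hcirc
  have hder := circular_hasDerivAt_pos hc h hcirc
  have hcirc' : ∀ t, 2 * (c + ang (γ t)) * ang (γ t) ^ 2 = 1 := fun t => by rw [hL]; exact hcirc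
  have hrot := eq_rotation_of_hasDerivAt (θ := fun t => (ang (γ 0))⁻¹ * t)
    (fun t => (hder t).1) (fun t => (hder t).2)
    (fun t => by simpa using (hasDerivAt_id t).const_mul (ang (γ 0))⁻¹) (by simp)
  constructor
  · intro hper
    have hγT : γ T = γ 0 := by simpa using hper 0
    obtain ⟨e1, e2⟩ := hrot T
    rw [hγT] at e1 e2
    obtain ⟨n, hn⟩ := exists_int_of_rotation (by
      rw [pos_sq (hlev 0).1 (hlev 0).2.1, (circular_state (hlev 0) hcirc).1]
      positivity) e1 e2
    exact ⟨n, by field_simp at hn; linarith⟩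
  · rintro ⟨n, rfl⟩ t
    refine circular_ext (hlev _) (hlev _) (hcirc' _) (by rw [hL, hL t]) ?_
    have harg : (ang (γ 0))⁻¹ * (t + 2 * Real.pi * ang (γ 0) * n)
        = (ang (γ 0))⁻¹ * t + n * (2 * Real.pi) := by field_simp
    obtain ⟨e1, e2⟩ := hrot (t + 2 * Real.pi * ang (γ 0) * n)
    obtain ⟨e3, e4⟩ := hrot t
    simp only [harg, Real.cos_add_int_mul_two_pi, Real.sin_add_int_mul_two_pi] at e1 e2
    exact plane_ext (by rw [e1, e3]) (by rw [e2, e4])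

end Circular

/-! ### The range of the angular momentum -/

theorem eq_iff_of_ne_zero {c x : ℝ} (hx : x ≠ 0) :
    c = 1 / (2 * x ^ 2) - x ↔ 2 * (c + x) * x ^ 2 = 1 := by
  rw [eq_sub_iff_add_eq, eq_div_iff (by positivity)]
  constructor <;> intro h <;> linarith

theorem cubic_lt_of_nonneg {c x y : ℝ} (hc : 3 / 2 < c) (hx : 0 ≤ x) (hxy : x < y) :
    2 * (c + x) * x ^ 2 < 2 * (c + y) * y ^ 2 := by
  have h1 : x ^ 2 < y ^ 2 := by nlinarith
  have h2 : 0 < 2 * (c + x) := by linarith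
  nlinarith [mul_lt_mul_of_pos_left h1 h2, mul_nonneg (sub_nonneg.2 hxy.le) (sq_nonneg y)]

/-- The difference of the two values is `2(y - x)` times `c(x + y) + x² + xy + y²`; since `x + y <
0`, replacing `c` by `3/2` bounds the second factor from above, and on `[-1, 0]²` the result is
nonpositive. -/
theorem cubic_lt_of_nonpos {c x y : ℝ} (hc : 3 / 2 < c) (hx : -1 < x) (hxy : x < y) (hy : y ≤ 0) :
    2 * (c + y) * y ^ 2 < 2 * (c + x) * x ^ 2 := by
  have h1 : c * (x + y) + x ^ 2 + x * y + y ^ 2 < 0 := by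
    have : (c - 3 / 2) * (x + y) < 0 := mul_neg_of_pos_of_neg (by linarith) (by linarith)
    nlinarith [mul_nonneg (by linarith : 0 ≤ -x) (by linarith : 0 ≤ x + 1),
      mul_nonneg (by linarith : 0 ≤ -y) (by linarith : 0 ≤ y + 1),
      mul_nonneg (by linarith : 0 ≤ -x) (by linarith : 0 ≤ y + 1),
      mul_nonneg (by linarith : 0 ≤ -y) (by linarith : 0 ≤ x + 1)]
  nlinarith [mul_pos_of_neg_of_neg (sub_neg.2 hxy) h1]

theorem existsUnique_retrograde {c : ℝ} (hc : 3 / 2 < c) :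
    ∃! x : ℝ, 0 < x ∧ c = 1 / (2 * x ^ 2) - x := by
  have hcont : ContinuousOn (fun x : ℝ => 2 * (c + x) * x ^ 2) (Set.Icc 0 1) := by fun_prop
  obtain ⟨x, hx, hx1⟩ := intermediate_value_Icc zero_le_one hcont
    (show (1 : ℝ) ∈ Set.Icc _ _ by constructor <;> norm_num; linarith)
  have hx0 : x ≠ 0 := by rintro rfl; norm_num at hx1
  refine ⟨x, ⟨lt_of_le_of_ne hx.1 hx0.symm, (eq_iff_of_ne_zero hx0).2 hx1⟩, ?_⟩
  rintro y ⟨hy, hy1⟩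
  rw [eq_iff_of_ne_zero hy.ne'] at hy1
  simp only at hx1
  rcases lt_trichotomy y x with h | h | h
  · linarith [cubic_lt_of_nonneg hc hy.le h]
  · exact h
  · linarith [cubic_lt_of_nonneg hc hx.1 h]

theorem existsUnique_direct {c : ℝ} (hc : 3 / 2 < c) :
    ∃! x : ℝ, -1 < x ∧ x < 0 ∧ c = 1 / (2 * x ^ 2) - x := by
  have hcont : ContinuousOn (fun x : ℝ => 2 * (c + x) * x ^ 2) (Set.Icc (-1) 0) := by fun_prop
  obtain ⟨x, hx, hx1⟩ := intermediate_value_Icc' (by norm_num) hcont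
    (show (1 : ℝ) ∈ Set.Icc _ _ by constructor <;> norm_num; linarith)
  simp only at hx1
  have hx0 : x ≠ 0 := by rintro rfl; norm_num at hx1
  have hxm : x ≠ -1 := by rintro rfl; norm_num at hx1; linarith
  have hx2 : -1 < x := lt_of_le_of_ne hx.1 hxm.symm
  refine ⟨x, ⟨hx2, lt_of_le_of_ne hx.2 hx0, (eq_iff_of_ne_zero hx0).2 hx1⟩, ?_⟩
  rintro y ⟨hy, hy0, hy1⟩
  rw [eq_iff_of_ne_zero hy0.ne] at hy1
  rcases lt_trichotomy y x with h | h | h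
  · linarith [cubic_lt_of_nonpos hc hy h hx.2]
  · exact h
  · linarith [cubic_lt_of_nonpos hc hx2 h hy0.le]

theorem eq_or_eq_of_cubic_eq_one {c LR LD L : ℝ} (hc : 3 / 2 < c)
    (hR : 0 < LR ∧ c = 1 / (2 * LR ^ 2) - LR)
    (hD : -1 < LD ∧ LD < 0 ∧ c = 1 / (2 * LD ^ 2) - LD) (hL : -1 < L)
    (h : 2 * (c + L) * L ^ 2 = 1) : L = LR ∨ L = LD := by
  have hL0 : L ≠ 0 := by rintro rfl; norm_num at h
  have h' := (eq_iff_of_ne_zero hL0).2 h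
  rcases hL0.lt_or_gt with h0 | h0
  · exact Or.inr ((existsUnique_direct hc).unique ⟨hL, h0, h'⟩ hD)
  · exact Or.inl ((existsUnique_retrograde hc).unique ⟨h0, h'⟩ hR)

theorem cubic_lt_one_iff {c LR LD L : ℝ} (hc : 3 / 2 < c)
    (hR : 0 < LR ∧ c = 1 / (2 * LR ^ 2) - LR)
    (hD : -1 < LD ∧ LD < 0 ∧ c = 1 / (2 * LD ^ 2) - LD) (hL : -1 < L) :
    2 * (c + L) * L ^ 2 < 1 ↔ LD < L ∧ L < LR := by
  have hR1 := (eq_iff_of_ne_zero hR.1.ne').1 hR.2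
  have hD1 := (eq_iff_of_ne_zero hD.2.1.ne).1 hD.2.2
  constructor
  · intro h
    constructor
    · by_contra hlt
      rcases (not_lt.1 hlt).eq_or_lt with rfl | hlt
      · linarith
      · linarith [cubic_lt_of_nonpos hc hL hlt hD.2.1.le]
    · by_contra hlt
      rcases (not_lt.1 hlt).eq_or_lt with rfl | hlt
      · linarith
      · linarith [cubic_lt_of_nonneg hc hR.1.le hlt]
  · rintro ⟨h1, h2⟩
    rcases le_total L 0 with h0 | h0
    · linarith [cubic_lt_of_nonpos hc hD.1 h1 h0]
    · linarith [cubic_lt_of_nonneg hc h0 h2]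

/-- The third part of the spectrum, in terms of the frequency `w = (k / l) ^ (1 / 3)` of the
Kepler ellipse. -/
theorem exists_frequency_iff {c LR LD a : ℝ}
    (hR : 0 < LR ∧ c = 1 / (2 * LR ^ 2) - LR)
    (hD : -1 < LD ∧ LD < 0 ∧ c = 1 / (2 * LD ^ 2) - LD) :
    (∃ k l : ℕ, 1 ≤ l ∧ l < k ∧ LR ^ 3 < (l : ℝ) / k ∧ (l : ℝ) / k < -LD ^ 3 ∧
      a = 2 * Real.pi * (-l * c + 3 / 2 * (k : ℝ) ^ (2 / 3 : ℝ) * (l : ℝ) ^ (1 / 3 : ℝ))) ↔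
    ∃ k l : ℕ, 1 ≤ k ∧ 1 ≤ l ∧ ∃ w L : ℝ, 0 < w ∧ w ^ 2 = 2 * (c + L) ∧ (LD < L ∧ L < LR) ∧
      (k : ℝ) = l * w ^ 3 ∧ a = 2 * Real.pi * (k / w + l * L) := by
  have hR1 := (eq_iff_of_ne_zero hR.1.ne').1 hR.2
  have hD1 := (eq_iff_of_ne_zero hD.2.1.ne).1 hD.2.2
  -- Since `l / k = 1 / w³` and `2(c + L_R) = 1 / L_R²`, `2(c + L_D) = 1 / L_D²`, comparing `L` with
  -- the endpoints amounts to comparing `1 / w` with `L_R` and `-L_D`. The period is `2π l (w² + L)`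
  -- with `L = w²/2 - c`.
  have key : ∀ (k l : ℕ) (w L : ℝ), 1 ≤ l → 0 < w → w ^ 2 = 2 * (c + L) → (k : ℝ) = l * w ^ 3 →
      ((LD < L ↔ (l : ℝ) / k < -LD ^ 3) ∧ (L < LR ↔ LR ^ 3 < (l : ℝ) / k) ∧
      2 * Real.pi * (k / w + l * L) = 2 * Real.pi *
        (-l * c + 3 / 2 * (k : ℝ) ^ (2 / 3 : ℝ) * (l : ℝ) ^ (1 / 3 : ℝ))) := by
    intro k l w L hl hw hw2 hk
    have hl' : (0 : ℝ) < l := by exact_mod_cast hl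
    have hlk : (l : ℝ) / k = (1 / w) ^ 3 := by rw [hk]; field_simp
    have hD' : (0 : ℝ) < -LD := by linarith
    have hR2 : 2 * (c + LR) = (1 / LR) ^ 2 := by
      have := hR.1
      field_simp; linarith
    have hD2 : 2 * (c + LD) = (1 / -LD) ^ 2 := by
      have := hD.2.1.ne
      rw [one_div_pow, neg_sq]
      field_simp; linarith
    refine ⟨?_, ?_, ?_⟩
    · have e : -LD ^ 3 = (-LD) ^ 3 := by ring
      rw [hlk, e, pow_lt_pow_iff_left₀ (by positivity) hD'.le (by norm_num),
        one_div_lt hw hD', ← pow_lt_pow_iff_left₀ (by positivity) hw.le two_ne_zero, hw2, ← hD2]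
      constructor <;> intro h <;> linarith
    · rw [hlk, pow_lt_pow_iff_left₀ hR.1.le (by positivity) (by norm_num),
        lt_one_div hR.1 hw, ← pow_lt_pow_iff_left₀ hw.le (by have := hR.1; positivity) two_ne_zero,
        hw2, ← hR2]
      constructor <;> intro h <;> linarith
    · have e1 : (k : ℝ) ^ (2 / 3 : ℝ) = (l : ℝ) ^ (2 / 3 : ℝ) * w ^ 2 := by
        rw [hk, Real.mul_rpow hl'.le (by positivity), ← Real.rpow_natCast w 3, ← Real.rpow_mul hw.le]
        norm_num
      have e2 : (l : ℝ) ^ (2 / 3 : ℝ) * (l : ℝ) ^ (1 / 3 : ℝ) = l := by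
        rw [← Real.rpow_add hl']; norm_num
      have e3 : (k : ℝ) / w = l * w ^ 2 := by rw [hk]; field_simp
      rw [e1, e3]
      linear_combination (-3 * Real.pi * w ^ 2) * e2 - Real.pi * l * hw2
  constructor
  · rintro ⟨k, l, hl, hlk, h1, h2, rfl⟩
    have hl' : (0 : ℝ) < l := by exact_mod_cast hl
    have hk' : (0 : ℝ) < k := by exact_mod_cast (hl.trans hlk.le)
    obtain ⟨w, hw⟩ : ∃ w : ℝ, w = ((k : ℝ) / l) ^ (1 / 3 : ℝ) := ⟨_, rfl⟩
    have hwpos : 0 < w := by rw [hw]; positivity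
    have hw3 : (k : ℝ) = l * w ^ 3 := by
      rw [hw, ← Real.rpow_natCast _ 3, ← Real.rpow_mul (by positivity)]
      norm_num
      field_simp
    have hw2 : w ^ 2 = 2 * (c + (w ^ 2 / 2 - c)) := by ring
    obtain ⟨e1, e2, e3⟩ := key k l w _ hl hwpos hw2 hw3
    exact ⟨k, l, hl.trans hlk.le, hl, w, _, hwpos, hw2, ⟨e1.2 h2, e2.2 h1⟩, hw3, e3.symm⟩
  · rintro ⟨k, l, hk, hl, w, L, hw, hw2, ⟨h1, h2⟩, hw3, rfl⟩
    obtain ⟨e1, e2, e3⟩ := key k l w L hl hw hw2 hw3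
    refine ⟨k, l, hl, ?_, e2.1 h2, e1.1 h1, e3⟩
    have h3 := e1.1 h1
    have hk' : (0 : ℝ) < k := by exact_mod_cast hk
    -- The condition `l < k` is automatic, because `-L_D < 1`.
    have h4 : -LD ^ 3 < 1 := by
      have : -LD ^ 3 = (-LD) ^ 3 := by ring
      rw [this]
      exact pow_lt_one₀ (by linarith) (by linarith) (by norm_num)
    have h5 : (l : ℝ) / k < 1 := h3.trans h4
    rw [div_lt_one hk'] at h5
    exact_mod_cast h5


/-! ### Construction of Reeb orbits -/

/-- The point of `ℝ³ × ℝ³` with given coordinates in a frame that has rotated by the angle `-θ`. -/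
def rotated (X0 X1 X2 Y0 Y1 Y2 θ : ℝ) : Space × Space :=
  (!₂[X0 * Real.cos θ + X1 * Real.sin θ, X1 * Real.cos θ - X0 * Real.sin θ, X2],
    !₂[Y0 * Real.cos θ + Y1 * Real.sin θ, Y1 * Real.cos θ - Y0 * Real.sin θ, Y2])

theorem ang_rotated (X0 X1 X2 Y0 Y1 Y2 θ : ℝ) :
    ang (rotated X0 X1 X2 Y0 Y1 Y2 θ) = X1 * Y0 - X0 * Y1 := by
  simp [ang, rotated]
  linear_combination (X1 * Y0 - X0 * Y1) * Real.sin_sq_add_cos_sq θ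

theorem norm_rotated_snd {X0 X1 X2 Y0 Y1 Y2 θ N : ℝ} (hN : 0 < N)
    (h : Y0 ^ 2 + Y1 ^ 2 + Y2 ^ 2 = N ^ 2) : ‖(rotated X0 X1 X2 Y0 Y1 Y2 θ).2‖ = N := by
  rw [← sq_eq_sq₀ (norm_nonneg _) hN.le, space_norm_sq, ← h]
  simp [rotated]
  linear_combination (Y0 ^ 2 + Y1 ^ 2) * Real.sin_sq_add_cos_sq θ

theorem rotated_mem {c L X0 X1 X2 Y0 Y1 Y2 θ N : ℝ} (hc : 3 / 2 < c) (hN : 0 < N)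
    (hX : X0 ^ 2 + X1 ^ 2 + X2 ^ 2 = 1) (hXY : X0 * Y0 + X1 * Y1 + X2 * Y2 = 0)
    (hY : Y0 ^ 2 + Y1 ^ 2 + Y2 ^ 2 = N ^ 2) (hK : N * (1 + (1 - X2) * (c - 1 / 2 + L)) = 1)
    (hL : X1 * Y0 - X0 * Y1 = L) (hr : 0 < 1 + L * (N * (1 - X2))) :
    rotated X0 X1 X2 Y0 Y1 Y2 θ ∈ hypersurface c := by
  have h1 := ang_rotated X0 X1 X2 Y0 Y1 Y2 θ
  have h2 : ‖(rotated X0 X1 X2 Y0 Y1 Y2 θ).2‖ = N := norm_rotated_snd hN hY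
  have h3 : (rotated X0 X1 X2 Y0 Y1 Y2 θ).1 2 = X2 := rfl
  have hl : rotated X0 X1 X2 Y0 Y1 Y2 θ ∈ level c := by
    refine ⟨?_, ?_, ?_⟩
    · rw [space_norm_eq_one, ← hX]
      simp [rotated]
      linear_combination (X0 ^ 2 + X1 ^ 2) * Real.sin_sq_add_cos_sq θ
    · rw [space_inner, ← hXY]
      simp [rotated]
      linear_combination (X0 * Y0 + X1 * Y1) * Real.sin_sq_add_cos_sq θ
    · rw [h1, h2, h3, hL, hK]
  refine (mem_hypersurface_iff hc).2 ⟨hl, ?_⟩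
  have h4 := norm_mul_radial hl
  rw [h1, h2, h3, hL] at h4
  rw [← h4] at hr
  exact (mul_pos_iff_of_pos_left hN).1 hr

theorem hasDerivAt_rotated {c L s : ℝ} {X0 X1 X2 Y0 Y1 Y2 θ N : ℝ → ℝ} (hN : 0 < N s)
    (hY : Y0 s ^ 2 + Y1 s ^ 2 + Y2 s ^ 2 = N s ^ 2) (hL : X1 s * Y0 s - X0 s * Y1 s = L)
    (hr : 0 < 1 + L * (N s * (1 - X2 s)))
    (hX0 : HasDerivAt X0 (Y0 s / N s ^ 2) s) (hX1 : HasDerivAt X1 (Y1 s / N s ^ 2) s)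
    (hX2 : HasDerivAt X2 (Y2 s / N s ^ 2) s)
    (hY0 : HasDerivAt Y0 (-(N s * (c + 1 / 2 + L) * X0 s)) s)
    (hY1 : HasDerivAt Y1 (-(N s * (c + 1 / 2 + L) * X1 s)) s)
    (hY2 : HasDerivAt Y2 (N s * (c - 1 / 2 + L) - N s * (c + 1 / 2 + L) * X2 s) s)
    (hθ : HasDerivAt θ (N s * (1 - X2 s)) s) :
    HasDerivAt (fun s => rotated (X0 s) (X1 s) (X2 s) (Y0 s) (Y1 s) (Y2 s) (θ s))
      ((1 + L * (N s * (1 - X2 s))) •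
        reeb c (rotated (X0 s) (X1 s) (X2 s) (Y0 s) (Y1 s) (Y2 s) (θ s))) s := by
  have h1 := ang_rotated (X0 s) (X1 s) (X2 s) (Y0 s) (Y1 s) (Y2 s) (θ s)
  have h2 : ‖(rotated (X0 s) (X1 s) (X2 s) (Y0 s) (Y1 s) (Y2 s) (θ s)).2‖ = N s :=
    norm_rotated_snd hN hY
  have h3 : dist0 (rotated (X0 s) (X1 s) (X2 s) (Y0 s) (Y1 s) (Y2 s) (θ s))
      = N s * (1 - X2 s) := by rw [dist0, h2]; rfl
  have h4 : (1 + L * (N s * (1 - X2 s))) *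
      rate (rotated (X0 s) (X1 s) (X2 s) (Y0 s) (Y1 s) (Y2 s) (θ s)) = 1 := by
    rw [rate, h1, hL, h3]; exact mul_one_div_cancel hr.ne'
  rw [hL] at h1
  have hc := hθ.cos
  have hs := hθ.sin
  set z := rotated (X0 s) (X1 s) (X2 s) (Y0 s) (Y1 s) (Y2 s) (θ s) with hz
  have h4' : ∀ x, (1 + L * (N s * (1 - X2 s))) * (rate z * x) = x := fun x => by
    rw [← mul_assoc, h4, one_mul]
  have z10 : z.1 0 = X0 s * Real.cos (θ s) + X1 s * Real.sin (θ s) := rfl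
  have z11 : z.1 1 = X1 s * Real.cos (θ s) - X0 s * Real.sin (θ s) := rfl
  have z12 : z.1 2 = X2 s := rfl
  have z20 : z.2 0 = Y0 s * Real.cos (θ s) + Y1 s * Real.sin (θ s) := rfl
  have z21 : z.2 1 = Y1 s * Real.cos (θ s) - Y0 s * Real.sin (θ s) := rfl
  have z22 : z.2 2 = Y2 s := rfl
  refine HasDerivAt.prodMk (hasDerivAt_space_iff.2 ⟨?_, ?_, ?_⟩)
    (hasDerivAt_space_iff.2 ⟨?_, ?_, ?_⟩)
  · refine ((hX0.mul hc).add (hX1.mul hs)).congr_deriv ?_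
    rw [PiLp.smul_apply, smul_eq_mul, reeb_fst_zero, h4', h2, h3, z11,
      z20]
    ring
  · refine ((hX1.mul hc).sub (hX0.mul hs)).congr_deriv ?_
    rw [PiLp.smul_apply, smul_eq_mul, reeb_fst_one, h4', h2, h3, z10,
      z21]
    ring
  · refine hX2.congr_deriv ?_
    rw [PiLp.smul_apply, smul_eq_mul, reeb_fst_two, h4', h2, z22]
  · refine ((hY0.mul hc).add (hY1.mul hs)).congr_deriv ?_
    rw [PiLp.smul_apply, smul_eq_mul, reeb_snd_zero, h4', h1, h2, h3,
      z10, z21]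
    ring
  · refine ((hY1.mul hc).sub (hY0.mul hs)).congr_deriv ?_
    rw [PiLp.smul_apply, smul_eq_mul, reeb_snd_one, h4', h1, h2, h3,
      z11, z20]
    ring
  · refine hY2.congr_deriv ?_
    rw [PiLp.smul_apply, smul_eq_mul, reeb_snd_two, h4', h1, h2, z12]

/-- A curve following `V` with positive speed factor `φ` becomes an integral curve once time is
changed by the inverse of `τ`; surjectivity of `τ` makes the new curve defined for all times. -/
theorem exists_reparametrization {E : Type*} [NormedAddCommGroup E] [NormedSpace ℝ E]
    {z : ℝ → E} {V : E → E} {φ τ : ℝ → ℝ} (hφ : ∀ s, 0 < φ s)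
    (hz : ∀ s, HasDerivAt z (φ s • V (z s)) s) (hτ : ∀ s, HasDerivAt τ (φ s) s)
    (hsurj : Function.Surjective τ) :
    ∃ σ : ℝ → ℝ, (∀ t, τ (σ t) = t) ∧ (∀ s, σ (τ s) = s) ∧
      ∀ t, HasDerivAt (fun t => z (σ t)) (V (z (σ t))) t := by
  have hmono : StrictMono τ := strictMono_of_deriv_pos fun s => by rw [(hτ s).deriv]; exact hφ s
  let f := hmono.orderIsoOfSurjective τ hsurj
  have h1 : ∀ t, τ (f.symm t) = t := fun t => f.apply_symm_apply t
  refine ⟨f.symm, h1, fun s => f.symm_apply_apply s, fun t => ?_⟩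
  have h2 : HasDerivAt f.symm (φ (f.symm t))⁻¹ t :=
    HasDerivAt.of_local_left_inverse f.symm.continuous.continuousAt (hτ _) (hφ _).ne'
      (Filter.Eventually.of_forall h1)
  have h3 := (hz (f.symm t)).scomp t h2
  rw [smul_smul, inv_mul_cancel₀ (hφ _).ne', one_smul] at h3
  exact h3

/-- This places the ellipse in the bounded component. For `L = -l < 0` the critical distance is the
largest one, `(1 + e) / w²`. From `c > 3/2` one gets `e < 1 - l³`, and then `w² l² = (1 + e)(1 - e)
> (1 + e) l³` gives `(1 + e) l < w²`. -/
theorem one_add_mul_pos_of_ellipse {c L w e : ℝ} (hc : 3 / 2 < c) (hL : -1 < L)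
    (hw2 : w ^ 2 = 2 * (c + L)) (he : 0 ≤ e) (he2 : e ^ 2 = 1 - w ^ 2 * L ^ 2) {C : ℝ}
    (hC : -1 ≤ C) (hC' : C ≤ 1) : 0 < 1 + L * ((1 - e * C) / w ^ 2) := by
  have hwpos : 0 < w ^ 2 := by rw [hw2]; linarith
  have he1 : e ≤ 1 := by nlinarith [mul_nonneg hwpos.le (sq_nonneg L)]
  rcases le_or_gt 0 L with h0 | h0
  · have : 0 ≤ 1 - e * C := by nlinarith
    positivity
  · obtain ⟨l, rfl⟩ : ∃ l, L = -l := ⟨-L, by ring⟩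
    have hl0 : 0 < l := by linarith
    have hl1 : l < 1 := by linarith
    have hl3 : l ^ 3 < 1 := pow_lt_one₀ hl0.le hl1 (by norm_num)
    have h4 : 0 ≤ 3 - 4 * l + l ^ 4 := by
      have : 3 - 4 * l + l ^ 4 = (l - 1) ^ 2 * ((l + 1) ^ 2 + 2) := by ring
      rw [this]; positivity
    have h5 : e < 1 - l ^ 3 := by
      refine lt_of_pow_lt_pow_left₀ 2 (by linarith) ?_
      rw [he2, hw2]
      have : 0 < l ^ 2 * (2 * c - 4 * l + l ^ 4) := mul_pos (by positivity) (by linarith)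
      nlinarith
    have h6 : (1 + e) * l < w ^ 2 := by
      have h7 : (1 + e) * l ^ 3 < (1 + e) * (1 - e) :=
        mul_lt_mul_of_pos_left (by linarith) (by linarith)
      have h8 : (1 + e) * (1 - e) = w ^ 2 * l ^ 2 := by linear_combination -he2
      rw [h8] at h7
      have h9 : 0 < l ^ 2 := by positivity
      nlinarith
    have h7 : 1 - e * C ≤ 1 + e := by nlinarith
    have h8 : l * (1 - e * C) < w ^ 2 := by nlinarith
    have h9 : l * ((1 - e * C) / w ^ 2) < 1 := by
      rw [← mul_div_assoc, div_lt_one hwpos]; exact h8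
    linarith

/-- Kepler ellipses with angular momentum `L`, frequency `w` and eccentricity `e`
give Reeb orbits. -/
theorem exists_orbit {c L w e : ℝ} (hc : 3 / 2 < c) (hL : -1 < L) (hw : 0 < w)
    (hw2 : w ^ 2 = 2 * (c + L)) (he : 0 ≤ e) (he2 : e ^ 2 = 1 - w ^ 2 * L ^ 2) :
    ∃ γ : ℝ → Space × Space, (∀ t, γ t ∈ hypersurface c ∧ HasDerivAt γ (reeb c (γ t)) t) ∧
      (∀ t, ang (γ t) = L) ∧ ∀ k l : ℕ, (k : ℝ) = l * w ^ 3 →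
        Function.Periodic γ (2 * Real.pi * (k / w + l * L)) := by
  have hc' : c = w ^ 2 / 2 - L := by linarith
  have he1 : e ≤ 1 := by nlinarith [sq_nonneg (w * L)]
  -- The parameter `s` is the regularized time and `w s` the eccentric anomaly, so below `ρ` is the
  -- distance on an ellipse of semi-major axis `1 / w²`. The `X` and `Y` are the regularized
  -- coordinates in the inertial frame, and `θ` is the physical time given by Kepler's equation.
  let C : ℝ → ℝ := fun s => Real.cos (w * s)
  let S : ℝ → ℝ := fun s => Real.sin (w * s)
  have hCS : ∀ s, S s ^ 2 + C s ^ 2 = 1 := fun s => Real.sin_sq_add_cos_sq _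
  have hC1 : ∀ s, -1 ≤ C s ∧ C s ≤ 1 := fun s => ⟨Real.neg_one_le_cos _, Real.cos_le_one _⟩
  have hws : ∀ s, HasDerivAt (fun s => w * s) w s := fun s => by
    simpa using (hasDerivAt_id s).const_mul w
  have hCd : ∀ s, HasDerivAt C (-(w * S s)) s := fun s =>
    (hws s).cos.congr_deriv (by simp only [S]; ring)
  have hSd : ∀ s, HasDerivAt S (w * C s) s := fun s =>
    (hws s).sin.congr_deriv (by simp only [C]; ring)
  let ρ : ℝ → ℝ := fun s => (1 - e * C s) / w ^ 2
  let N : ℝ → ℝ := fun s => (w ^ 2 + 1 + (w ^ 2 - 1) * e * C s) / (2 * w ^ 2)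
  have hρd : ∀ s, HasDerivAt ρ (e * S s / w) s := fun s =>
    ((((hCd s).const_mul e).const_sub 1).div_const (w ^ 2)).congr_deriv (by field_simp)
  have hNd : ∀ s, HasDerivAt N (-((w ^ 2 - 1) / 2 * (e * S s / w))) s := fun s =>
    ((((hCd s).const_mul ((w ^ 2 - 1) * e)).const_add (w ^ 2 + 1)).div_const
      (2 * w ^ 2)).congr_deriv (by field_simp)
  have hNpos : ∀ s, 0 < N s := fun s => by
    obtain ⟨h1, h2⟩ := hC1 s
    have h3 : -1 ≤ e * C s := by nlinarith
    have h4 : e * C s ≤ 1 := by nlinarith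
    have h5 : 0 ≤ w ^ 2 * (1 + e * C s) := mul_nonneg (sq_nonneg w) (by linarith)
    refine div_pos ?_ (by positivity)
    rcases h4.eq_or_lt with h6 | h6
    · rw [mul_assoc, h6]; nlinarith
    · nlinarith
  let X0 : ℝ → ℝ := fun s => S s / w / N s
  let X1 : ℝ → ℝ := fun s => L * C s / N s
  let X2 : ℝ → ℝ := fun s => 1 - ρ s / N s
  let Y0 : ℝ → ℝ := fun s => e + (w ^ 2 + 1) / 2 * ((C s - e) / w ^ 2)
  let Y1 : ℝ → ℝ := fun s => -((w ^ 2 + 1) / 2 * (L / w * S s))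
  let Y2 : ℝ → ℝ := fun s => -(e * S s / w)
  let θ : ℝ → ℝ := fun s => (s - e * S s / w) / w ^ 2
  have hNρ : ∀ s, N s * (1 - X2 s) = ρ s := fun s => by
    have := (hNpos s).ne'
    simp only [X2]; field_simp; ring
  have hNeq : ∀ s, N s = 1 - (w ^ 2 - 1) / 2 * ρ s := fun s => by
    simp only [N, ρ]; field_simp; ring
  have hwρ : ∀ s, w ^ 2 * ρ s = 1 - e * C s := fun s => by
    simp only [ρ]; field_simp
  have hlw : w ^ 2 * L ^ 2 = 1 - e ^ 2 := by linarith
  have hX : ∀ s, X0 s ^ 2 + X1 s ^ 2 + X2 s ^ 2 = 1 := fun s => by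
    have h1 := (hNpos s).ne'
    have h2 : S s ^ 2 / w ^ 2 + L ^ 2 * C s ^ 2 = 2 * N s * ρ s - ρ s ^ 2 := by
      simp only [N, ρ]
      field_simp
      linear_combination w ^ 2 * hCS s + w ^ 2 * C s ^ 2 * hlw
    simp only [X0, X1, X2]
    have h3 : (S s / w / N s) ^ 2 + (L * C s / N s) ^ 2 + (1 - ρ s / N s) ^ 2 =
        (S s ^ 2 / w ^ 2 + L ^ 2 * C s ^ 2 + (N s - ρ s) ^ 2) / N s ^ 2 := by
      field_simp
    rw [h3, h2, div_eq_one_iff_eq (pow_ne_zero 2 h1)]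
    ring
  have hXY : ∀ s, X0 s * Y0 s + X1 s * Y1 s + X2 s * Y2 s = 0 := fun s => by
    have h1 := (hNpos s).ne'
    refine mul_left_cancel₀ h1 ?_
    have h2 : N s * (X0 s * Y0 s + X1 s * Y1 s + X2 s * Y2 s)
        = S s / w * Y0 s + L * C s * Y1 s + (N s - ρ s) * Y2 s := by
      simp only [X0, X1, X2]; field_simp
    rw [h2]
    simp only [Y0, Y1, Y2, N, ρ]
    field_simp
    linear_combination (-S s * C s * (w ^ 2 + 1)) * hlw
  have hY : ∀ s, Y0 s ^ 2 + Y1 s ^ 2 + Y2 s ^ 2 = N s ^ 2 := fun s => by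
    simp only [Y0, Y1, Y2, N]
    field_simp
    linear_combination (w ^ 2 + 1) ^ 2 * S s ^ 2 * hlw
      + ((w ^ 2 + 1) ^ 2 - e ^ 2 * (w ^ 2 - 1) ^ 2) * hCS s
  have hK : ∀ s, N s * (1 + (1 - X2 s) * (c - 1 / 2 + L)) = 1 := fun s => by
    linear_combination (c - 1 / 2 + L) * hNρ s + hNeq s + ρ s * hc'
  have hang : ∀ s, X1 s * Y0 s - X0 s * Y1 s = L := fun s => by
    have h1 := (hNpos s).ne'
    refine mul_left_cancel₀ h1 ?_
    have h2 : N s * (X1 s * Y0 s - X0 s * Y1 s) = L * C s * Y0 s - S s / w * Y1 s := by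
      simp only [X0, X1]; field_simp
    rw [h2]
    simp only [Y0, Y1, N]
    field_simp
    linear_combination (w ^ 2 + 1) * L * hCS s
  have hφ : ∀ s, 0 < 1 + L * (N s * (1 - X2 s)) := fun s => by
    rw [hNρ]
    exact one_add_mul_pos_of_ellipse hc hL hw2 he he2 (hC1 s).1 (hC1 s).2
  have hθd : ∀ s, HasDerivAt θ (N s * (1 - X2 s)) s := fun s => by
    rw [hNρ]
    refine (((hasDerivAt_id s).sub (((hSd s).const_mul e).div_const w)).div_const
      (w ^ 2)).congr_deriv ?_
    simp only [ρ]; field_simp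
  have hX0d : ∀ s, HasDerivAt X0 (Y0 s / N s ^ 2) s := fun s => by
    have h1 := (hNpos s).ne'
    refine (((hSd s).div_const w).div (hNd s) h1).congr_deriv ?_
    congr 1
    simp only [Y0, N]
    field_simp
    linear_combination (w ^ 2 - 1) * e * hCS s
  have hX1d : ∀ s, HasDerivAt X1 (Y1 s / N s ^ 2) s := fun s => by
    have h1 := (hNpos s).ne'
    refine (((hCd s).const_mul L).div (hNd s) h1).congr_deriv ?_
    congr 1
    simp only [Y1, N]
    field_simp
    ring
  have hX2d : ∀ s, HasDerivAt X2 (Y2 s / N s ^ 2) s := fun s => by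
    have h1 := (hNpos s).ne'
    refine (((hρd s).div (hNd s) h1).const_sub 1).congr_deriv ?_
    rw [← neg_div]
    congr 1
    simp only [Y2]
    linear_combination (-(e * S s / w)) * hNeq s
  have hY0d : ∀ s, HasDerivAt Y0 (-(N s * (c + 1 / 2 + L) * X0 s)) s := fun s => by
    have h1 := (hNpos s).ne'
    refine (((((hCd s).sub_const e).div_const (w ^ 2)).const_mul
      ((w ^ 2 + 1) / 2)).const_add e).congr_deriv ?_
    simp only [X0]
    rw [hc']
    field_simp
    ring
  have hY1d : ∀ s, HasDerivAt Y1 (-(N s * (c + 1 / 2 + L) * X1 s)) s := fun s => by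
    have h1 := (hNpos s).ne'
    refine ((((hSd s).const_mul (L / w)).const_mul ((w ^ 2 + 1) / 2)).neg).congr_deriv ?_
    simp only [X1]
    rw [hc']
    field_simp
    ring
  have hY2d : ∀ s, HasDerivAt Y2 (N s * (c - 1 / 2 + L) - N s * (c + 1 / 2 + L) * X2 s) s :=
    fun s => by
    refine ((((hSd s).const_mul e).div_const w).neg).congr_deriv ?_
    have e1 : e * (w * C s) / w = e * C s := by field_simp
    rw [e1]
    linear_combination (-(c + 1 / 2 + L)) * hNρ s + hNeq s - hwρ s - ρ s * hc'
  let z : ℝ → Space × Space := fun s => rotated (X0 s) (X1 s) (X2 s) (Y0 s) (Y1 s) (Y2 s) (θ s)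
  have hzd : ∀ s, HasDerivAt z ((1 + L * (N s * (1 - X2 s))) • reeb c (z s)) s := fun s =>
    hasDerivAt_rotated (hNpos s) (hY s) (hang s) (hφ s) (hX0d s) (hX1d s) (hX2d s) (hY0d s)
      (hY1d s) (hY2d s) (hθd s)
  -- The Reeb time as a function of `s`. It is linear with positive slope `1 + L / w²` up to a
  -- bounded oscillation, which makes it surjective.
  let τ : ℝ → ℝ := fun s => s + L * θ s
  have hτd : ∀ s, HasDerivAt τ (1 + L * (N s * (1 - X2 s))) s := fun s =>
    (hasDerivAt_id s).add ((hθd s).const_mul L)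
  have hτc : Continuous τ := continuous_iff_continuousAt.2 fun s => (hτd s).continuousAt
  have hα : 0 < 1 + L / w ^ 2 := by
    have := one_add_mul_pos_of_ellipse hc hL hw2 he he2 (C := 0) (by norm_num) (by norm_num)
    simpa [div_eq_mul_inv] using this
  have hsurj : Function.Surjective τ := by
    intro y
    have hbound : ∀ s, |τ s - (1 + L / w ^ 2) * s| ≤ |L * (e / w) / w ^ 2| := fun s => by
      have h1 : τ s - (1 + L / w ^ 2) * s = -(L * (e / w) / w ^ 2) * S s := by
        simp only [τ, θ]; ring
      rw [h1, abs_mul, abs_neg]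
      exact mul_le_of_le_one_right (abs_nonneg _) (Real.abs_sin_le_one _)
    refine mem_range_of_exists_le_of_exists_ge hτc
      ⟨(y - |L * (e / w) / w ^ 2|) / (1 + L / w ^ 2), ?_⟩
      ⟨(y + |L * (e / w) / w ^ 2|) / (1 + L / w ^ 2), ?_⟩
    · have := (abs_le.1 (hbound ((y - |L * (e / w) / w ^ 2|) / (1 + L / w ^ 2)))).2
      rw [mul_div_cancel₀ _ hα.ne'] at this
      linarith
    · have := (abs_le.1 (hbound ((y + |L * (e / w) / w ^ 2|) / (1 + L / w ^ 2)))).1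
      rw [mul_div_cancel₀ _ hα.ne'] at this
      linarith
  obtain ⟨σ, hσ1, hσ2, hσ3⟩ := exists_reparametrization hφ hzd hτd hsurj
  refine ⟨fun t => z (σ t), fun t => ⟨?_, hσ3 t⟩, fun t => ?_, ?_⟩
  · exact rotated_mem hc (hNpos _) (hX _) (hXY _) (hY _) (hK _) (hang _) (hφ _)
  · exact (ang_rotated _ _ _ _ _ _ _).trans (hang _)
  · intro k l hkl t
    have hper : ∀ s, w * (s + 2 * Real.pi * k / w) = w * s + k * (2 * Real.pi) := fun s => by
      field_simp
    have hC2 : ∀ s, C (s + 2 * Real.pi * k / w) = C s := fun s => by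
      simp only [C, hper, Real.cos_add_nat_mul_two_pi]
    have hS2 : ∀ s, S (s + 2 * Real.pi * k / w) = S s := fun s => by
      simp only [S, hper, Real.sin_add_nat_mul_two_pi]
    have hθ2 : ∀ s, θ (s + 2 * Real.pi * k / w) = θ s + l * (2 * Real.pi) := fun s => by
      simp only [θ, hS2]; rw [hkl]; field_simp; ring
    have hz2 : ∀ s, z (s + 2 * Real.pi * k / w) = z s := fun s => by
      simp only [z, X0, X1, X2, Y0, Y1, Y2, N, ρ, hC2, hS2, hθ2, rotated,
        Real.cos_add_nat_mul_two_pi, Real.sin_add_nat_mul_two_pi]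
    have hτ2 : τ (σ t + 2 * Real.pi * k / w) = t + 2 * Real.pi * (k / w + l * L) := by
      have := hσ1 t
      simp only [τ, hθ2] at this ⊢
      linear_combination this
    change z (σ (t + 2 * Real.pi * (k / w + l * L))) = z (σ t)
    rw [← hτ2, hσ2, hz2]


/-! ### Hamilton's equations -/

theorem hasGradientAt_of_forall {f : Plane → ℝ} {f' : Plane →L[ℝ] ℝ} {g x : Plane}
    (h : HasFDerivAt f f' x) (hg : ∀ v, f' v = ⟪g, v⟫) : HasGradientAt f g x := by
  have e : f' = InnerProductSpace.toDual ℝ Plane g :=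
    ContinuousLinearMap.ext fun v => by rw [hg, InnerProductSpace.toDual_apply_apply]
  rw [hasGradientAt_iff_hasFDerivAt, ← e]
  exact h

theorem hasFDerivAt_coord (i : Fin 2) (x : Plane) :
    HasFDerivAt (fun x : Plane => x i) (EuclideanSpace.proj i : Plane →L[ℝ] ℝ) x :=
  (EuclideanSpace.proj i : Plane →L[ℝ] ℝ).hasFDerivAt

theorem gradient_momentum (q p : Plane) :
    gradient (fun p' => hamiltonian q p') p = !₂[p 0 + q 1, p 1 - q 0] := by
  refine HasGradientAt.gradient (hasGradientAt_of_forall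
    ((((hasStrictFDerivAt_norm_sq p).hasFDerivAt.const_mul (1 / 2)).sub_const (1 / ‖q‖)).add
      (((hasFDerivAt_coord 0 p).mul_const (q 1)).sub ((hasFDerivAt_coord 1 p).mul_const (q 0))))
      fun v => ?_)
  simp [plane_inner]
  ring

theorem gradient_position {q : Plane} (p : Plane) (hq : q ≠ 0) :
    gradient (fun q' => hamiltonian q' p) q =
      !₂[q 0 / ‖q‖ ^ 3 - p 1, q 1 / ‖q‖ ^ 3 + p 0] := by
  have hn : ‖q‖ ≠ 0 := norm_ne_zero_iff.2 hq
  have h1 : HasFDerivAt (fun x : Plane => ‖x‖) ((1 / (2 * √(‖q‖ ^ 2))) • (2 • innerSL ℝ q)) q := by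
    have := (hasStrictFDerivAt_norm_sq q).hasFDerivAt.sqrt (pow_ne_zero 2 hn)
    refine this.congr_of_eventuallyEq (Filter.Eventually.of_forall fun x => ?_)
    exact (Real.sqrt_sq (norm_nonneg x)).symm
  have h2 : HasFDerivAt (fun x : Plane => 1 / ‖x‖) _ q :=
    ((hasDerivAt_inv hn).comp_hasFDerivAt q h1).congr_of_eventuallyEq
      (Filter.Eventually.of_forall fun x => one_div _)
  refine HasGradientAt.gradient (hasGradientAt_of_forall
    ((h2.const_sub ((1 / 2) * ‖p‖ ^ 2)).add
      (((hasFDerivAt_coord 1 q).const_mul (p 0)).sub ((hasFDerivAt_coord 0 q).const_mul (p 1))))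
      fun v => ?_)
  simp [plane_inner]
  field_simp
  ring

theorem IsSolution.hasDerivAt {q p : ℝ → Plane} (h : IsSolution q p) (t : ℝ) :
    HasDerivAt (fun s => q s 0) (p t 0 + q t 1) t ∧
    HasDerivAt (fun s => q s 1) (p t 1 - q t 0) t ∧
    HasDerivAt (fun s => p s 0) (-(q t 0 / ‖q t‖ ^ 3 - p t 1)) t ∧
    HasDerivAt (fun s => p s 1) (-(q t 1 / ‖q t‖ ^ 3 + p t 0)) t := by
  have h1 := h.deriv_q t
  have h2 := h.deriv_p t
  rw [gradient_momentum] at h1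
  rw [gradient_position _ (h.ne_zero t)] at h2
  obtain ⟨a, b⟩ := hasDerivAt_plane_iff.1 h1
  obtain ⟨d, e⟩ := hasDerivAt_plane_iff.1 h2
  exact ⟨a, b, d, e⟩

/-- The geometry of circular orbits. -/
theorem IsCircularOrbit.exists_ang {c : ℝ} (hc : 3 / 2 < c) {q p : ℝ → Plane}
    (h : IsCircularOrbit c q p) : ∃ L : ℝ, -1 < L ∧ 2 * (c + L) * L ^ 2 = 1 ∧ ∀ t,
      angular (q t) (p t) = L ∧ ‖q t‖ = L ^ 2 ∧ p t 0 = q t 1 / L ^ 3 ∧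
        p t 1 = -(q t 0 / L ^ 3) := by
  obtain ⟨r, hr⟩ := h.circular
  have hr0 : 0 < r := by rw [← hr 0]; exact norm_pos_iff.2 (h.solution.ne_zero 0)
  have hq2 : ∀ t, q t 0 ^ 2 + q t 1 ^ 2 = r ^ 2 := fun t => by rw [← hr t, plane_norm_sq]
  have hqp : ∀ t, q t 0 * p t 0 + q t 1 * p t 1 = 0 := fun t => by
    obtain ⟨h1, h2, -, -⟩ := h.solution.hasDerivAt t
    have := eq_zero_of_hasDerivAt_eventually_const (k := r ^ 2) ((h1.pow 2).add (h2.pow 2))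
      (Filter.Eventually.of_forall hq2)
    simp at this
    linarith
  -- Differentiating `⟪q, p⟫ = 0` cancels the rotation terms and leaves `|p|² = 1 / r`, the balance
  -- of centrifugal and gravitational force.
  have hp2 : ∀ t, (p t 0 ^ 2 + p t 1 ^ 2) * r = 1 := fun t => by
    obtain ⟨h1, h2, h3, h4⟩ := h.solution.hasDerivAt t
    have := eq_zero_of_hasDerivAt_eventually_const (k := 0) ((h1.mul h3).add (h2.mul h4))
      (Filter.Eventually.of_forall hqp)
    rw [hr] at this
    have h5 : (q t 0 ^ 2 + q t 1 ^ 2) / r ^ 3 = 1 / r := by rw [hq2]; field_simp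
    have h6 : p t 0 ^ 2 + p t 1 ^ 2 = 1 / r := by rw [← h5]; linear_combination this
    rw [h6]; field_simp
  have hang : ∀ t, angular (q t) (p t) = 1 / (2 * r) - c := fun t => by
    have h1 := h.energy t
    rw [hamiltonian, hr, plane_norm_sq] at h1
    have h2 : p t 0 ^ 2 + p t 1 ^ 2 = 1 / r := eq_one_div_of_mul_eq_one_left (hp2 t)
    rw [h2] at h1
    have h3 : 1 / (2 * r) = 1 / r / 2 := by field_simp
    rw [h3]
    linarith
  have hL2 : (1 / (2 * r) - c) ^ 2 = r := by
    rw [← hang 0, angular]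
    have h1 := hq2 0
    have h2 := hp2 0
    have h3 := hqp 0
    linear_combination (p 0 0 ^ 2 + p 0 1 ^ 2) * h1 + r * h2
      - (q 0 0 * p 0 0 + q 0 1 * p 0 1) * h3
  obtain ⟨L, hL⟩ : ∃ L, L = 1 / (2 * r) - c := ⟨_, rfl⟩
  rw [← hL] at hL2
  simp only [← hL] at hang
  have hL0 : L ≠ 0 := by rintro h0; rw [h0] at hL2; norm_num at hL2; linarith
  refine ⟨L, ?_, ?_, fun t => ⟨hang t, by rw [hr, hL2], ?_, ?_⟩⟩
  · rw [← hang 0, ← ang_regularize]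
    exact neg_one_lt_ang hc (h.mem 0)
  · rw [hL2, hL]; field_simp; ring
  · have h1 := hang t
    have h2 := hq2 t
    rw [angular] at h1
    rw [eq_div_iff (pow_ne_zero 3 hL0)]
    refine mul_left_cancel₀ hL0 ?_
    rw [← hL2] at h2
    linear_combination (-p t 0) * h2 + q t 1 * h1 + q t 0 * hqp t
  · have h1 := hang t
    have h2 := hq2 t
    rw [angular] at h1
    rw [← neg_div, eq_div_iff (pow_ne_zero 3 hL0)]
    refine mul_left_cancel₀ hL0 ?_
    rw [← hL2] at h2
    linear_combination (-p t 1) * h2 - q t 0 * h1 + q t 1 * hqp t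

/-! ### Minimal period and action of circular orbits. -/

theorem one_add_cube_pos_and_abs_frequency {L : ℝ} (hL0 : L ≠ 0) (hL : -1 < L) :
    0 < 1 + L ^ 3 ∧ |1 / L ^ 3 + 1| = (1 + L ^ 3) / |L| ^ 3 := by
  have h1 : 0 < 1 + L ^ 3 := by
    have : 1 + L ^ 3 = (1 + L) * ((L - 1 / 2) ^ 2 + 3 / 4) := by ring
    rw [this]
    exact mul_pos (by linarith) (by positivity)
  refine ⟨h1, ?_⟩
  have h2 : 1 / L ^ 3 + 1 = (1 + L ^ 3) / L ^ 3 := by field_simp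
  rw [h2, abs_div, abs_of_pos h1, abs_pow]

/-- The position rotates with angular velocity `1 / L³ + 1`: the Kepler frequency plus the rotation
of the frame. -/
theorem IsCircularOrbit.isSimplePeriod {c L : ℝ} {q p : ℝ → Plane}
    (h : IsCircularOrbit c q p) (hL : -1 < L) (hL0 : L ≠ 0)
    (hf : ∀ t, ‖q t‖ = L ^ 2 ∧ p t 0 = q t 1 / L ^ 3 ∧ p t 1 = -(q t 0 / L ^ 3)) :
    IsSimplePeriod q p (2 * Real.pi * |L| ^ 3 / (1 + L ^ 3)) := by
  obtain ⟨h1, h2⟩ := one_add_cube_pos_and_abs_frequency hL0 hL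
  have hΩ : 1 / L ^ 3 + 1 ≠ 0 := by
    intro h0
    rw [h0, abs_zero, eq_comm, div_eq_zero_iff] at h2
    rcases h2 with h2 | h2
    · linarith
    · exact hL0 (by simpa using h2)
  have hrot := eq_rotation_of_hasDerivAt (x := fun t => q t 0) (y := fun t => q t 1)
    (θ := fun t => (1 / L ^ 3 + 1) * t) (g := fun _ => 1 / L ^ 3 + 1)
    (fun t => (h.solution.hasDerivAt t).1.congr_deriv (by rw [(hf t).2.1]; ring))
    (fun t => (h.solution.hasDerivAt t).2.1.congr_deriv (by rw [(hf t).2.2]; ring))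
    (fun t => ((hasDerivAt_id t).const_mul (1 / L ^ 3 + 1)).congr_deriv (mul_one _)) (by simp)
  have hT : 2 * Real.pi * |L| ^ 3 / (1 + L ^ 3) = 2 * Real.pi / |1 / L ^ 3 + 1| := by
    rw [h2]; field_simp
  rw [hT]
  constructor
  · refine ⟨by positivity, fun t => ?_⟩
    have hq : q (t + 2 * Real.pi / |1 / L ^ 3 + 1|) = q t := by
      obtain ⟨a1, a2⟩ := hrot t
      obtain ⟨b1, b2⟩ := hrot (t + 2 * Real.pi / |1 / L ^ 3 + 1|)
      have harg : ∃ n : ℤ, (1 / L ^ 3 + 1) * (t + 2 * Real.pi / |1 / L ^ 3 + 1|) =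
          (1 / L ^ 3 + 1) * t + n * (2 * Real.pi) := by
        generalize 1 / L ^ 3 + 1 = Ω at hΩ
        rcases hΩ.lt_or_gt with h0 | h0
        · exact ⟨-1, by rw [abs_of_neg h0]; push_cast; field_simp⟩
        · exact ⟨1, by rw [abs_of_pos h0]; push_cast; field_simp⟩
      obtain ⟨n, hn⟩ := harg
      simp only [hn, Real.cos_add_int_mul_two_pi, Real.sin_add_int_mul_two_pi] at b1 b2
      exact plane_ext (by rw [a1, b1]) (by rw [a2, b2])
    refine Prod.ext hq (plane_ext ?_ ?_)
    · change p _ 0 = p t 0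
      rw [(hf _).2.1, (hf t).2.1, hq]
    · change p _ 1 = p t 1
      rw [(hf _).2.2, (hf t).2.2, hq]
  · rintro S ⟨hS, hper⟩
    have hq : q S = q 0 := by
      have := congrArg Prod.fst (hper 0)
      simpa using this
    obtain ⟨a1, a2⟩ := hrot S
    simp only [hq] at a1 a2
    obtain ⟨n, hn⟩ := exists_int_of_rotation (by
      rw [← plane_norm_sq, (hf 0).1]
      positivity) a1 a2
    have hn0 : n ≠ 0 := by
      rintro rfl
      rw [Int.cast_zero, mul_zero] at hn
      exact mul_ne_zero hΩ hS.ne' hn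
    have hn1 : (1 : ℝ) ≤ |(n : ℝ)| := by exact_mod_cast Int.one_le_abs hn0
    have h3 : |1 / L ^ 3 + 1| * S = 2 * Real.pi * |(n : ℝ)| := by
      have := congrArg abs hn
      rwa [abs_mul, abs_mul, abs_of_pos hS, abs_of_pos Real.two_pi_pos] at this
    rw [div_le_iff₀ (abs_pos.2 hΩ), mul_comm S, h3]
    nlinarith [Real.pi_pos]

theorem differentiable_stereo : Differentiable ℝ stereo := by
  intro x
  rw [differentiableAt_euclidean]
  have h0 := (hasFDerivAt_coord 0 x).differentiableAt
  have h1 := (hasFDerivAt_coord 1 x).differentiableAt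
  have hne : x 0 ^ 2 + x 1 ^ 2 + 1 ≠ 0 := by positivity
  intro i
  fin_cases i
  · simp only [stereo, plane_norm_sq]
    simp
    fun_prop (disch := assumption)
  · simp only [stereo, plane_norm_sq]
    simp
    fun_prop (disch := assumption)
  · simp only [stereo, plane_norm_sq]
    simp
    fun_prop (disch := assumption)

/-- The regularization pulls the Liouville form back to `-q dp`. -/
theorem liouville_deriv_regularize {q p : ℝ → Plane} {q' p' : Plane} {t : ℝ}
    (hq : HasDerivAt q q' t) (hp : HasDerivAt p p' t) :
    liouville (regularize (q t) (p t)) (deriv (fun s => regularize (q s) (p s)) t)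
      = -⟪q t, p'⟫ := by
  have h1 : HasDerivAt (fun s => stereo (-p s)) (fderiv ℝ stereo (-p t) (-p')) t :=
    HasFDerivAt.comp_hasDerivAt (l := stereo) (f := fun s => -p s) t
      (differentiable_stereo (-p t)).hasFDerivAt hp.fun_neg
  have h2 : DifferentiableAt ℝ (fun s => stereoCovector (-p s) (q s)) t := by
    obtain ⟨a, b⟩ := hasDerivAt_plane_iff.1 hq
    obtain ⟨d, e⟩ := hasDerivAt_plane_iff.1 hp
    have a := a.differentiableAt
    have b := b.differentiableAt
    have d := d.differentiableAt
    have e := e.differentiableAt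
    rw [differentiableAt_euclidean]
    intro i
    fin_cases i
    · simp only [stereoCovector, plane_norm_sq, plane_inner]
      simp
      fun_prop
    · simp only [stereoCovector, plane_norm_sq, plane_inner]
      simp
      fun_prop
    · simp only [stereoCovector, plane_norm_sq, plane_inner]
      simp
      fun_prop
  have h3 : HasDerivAt (fun s => regularize (q s) (p s)) _ t := h1.prodMk h2.hasDerivAt
  rw [h3.deriv]
  change ⟪stereoCovector (-p t) (q t), fderiv ℝ stereo (-p t) (-p')⟫ = _
  rw [stereoCovector_spec, inner_neg_right]

/-- The integrand `-⟪q, p'⟫` is the constant `1 / L² + L = (1 + L³) / L²`, and the factor `1 + L³`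
cancels against the minimal period. -/
theorem IsCircularOrbit.action_eq {c L : ℝ} {q p : ℝ → Plane}
    (h : IsCircularOrbit c q p) (hL : -1 < L) (hL0 : L ≠ 0)
    (hf : ∀ t, ‖q t‖ = L ^ 2 ∧ p t 0 = q t 1 / L ^ 3 ∧ p t 1 = -(q t 0 / L ^ 3)) {T : ℝ}
    (hT : IsSimplePeriod q p T) : action q p T = 2 * Real.pi * |L| := by
  rw [hT.unique (h.isSimplePeriod hL hL0 hf), action]
  have hint : ∀ t, liouville (regularize (q t) (p t))
      (deriv (fun s => regularize (q s) (p s)) t) = 1 / L ^ 2 + L := fun t => by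
    rw [liouville_deriv_regularize (h.solution.deriv_q t) (h.solution.deriv_p t),
      gradient_position _ (h.solution.ne_zero t), inner_neg_right, neg_neg, plane_inner]
    simp
    obtain ⟨h1, h2, h3⟩ := hf t
    have h4 := plane_norm_sq (q t)
    rw [h1] at h4
    rw [h1, h2, h3]
    have h5 : q t 1 ^ 2 = (L ^ 2) ^ 2 - q t 0 ^ 2 := by linarith
    field_simp
    linear_combination (1 + L ^ 3) * h5
  simp only [hint]
  rw [intervalIntegral.integral_const, smul_eq_mul, sub_zero]
  have h1 := (one_add_cube_pos_and_abs_frequency hL0 hL).1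
  have h2 : |L| ^ 2 = L ^ 2 := sq_abs L
  field_simp
  linear_combination h2

/-- Reeb orbits of eccentricity zero trace circular orbits. -/
theorem exists_circular_of_reeb {c : ℝ} (hc : 3 / 2 < c) {γ : ℝ → Space × Space}
    (h : ∀ t, γ t ∈ hypersurface c ∧ HasDerivAt γ (reeb c (γ t)) t)
    (hcirc : 2 * (c + ang (γ 0)) * ang (γ 0) ^ 2 = 1) :
    ∃ q p : ℝ → Plane, IsCircularOrbit c q p ∧ Traces γ q p ∧
      ∀ t, angular (q t) (p t) = ang (γ 0) := by
  have hLm := neg_one_lt_ang hc (h 0).1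
  have hL := ang_eq_ang_zero fun t => (h t).2
  have hlev := fun t => hypersurface_subset_level hc (h t).1
  have hder := circular_hasDerivAt_pos hc h hcirc
  have hcirc' : ∀ t, 2 * (c + ang (γ t)) * ang (γ t) ^ 2 = 1 := fun t => by rw [hL]; exact hcirc
  have hst := fun t => circular_state (hlev t) (hcirc' t)
  have hep := fun t => circular_eq_pos (hlev t) (hcirc' t)
  simp only [hL] at hst hep
  generalize ang (γ 0) = L at *
  have hL0 : L ≠ 0 := by rintro rfl; norm_num at hcirc
  have hcub := (one_add_cube_pos_and_abs_frequency hL0 hLm).1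
  have hW : ∀ t, 1 - (γ t).1 2 = 2 * L ^ 2 / (1 + L ^ 2) := fun t => by
    have := (hep t).2.2.2.2
    field_simp; linarith
  have hWne : ∀ t, (γ t).1 2 ≠ 1 := fun t h1 => by
    have h2 := hW t
    rw [h1, sub_self, eq_comm, div_eq_zero_iff] at h2
    rcases h2 with h2 | h2
    · exact hL0 (by simpa using h2)
    · exact absurd h2 (by positivity)
  have hmem : ∀ t, γ t ∈ cotangentSphere := fun t => ⟨(hlev t).1, (hlev t).2.1⟩
  have hreg : ∀ t, regularize (pos (γ t)) (mom (γ t)) = γ t := fun t =>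
    regularize_pos_mom (hmem t) (hWne t)
  have hnorm : ∀ t, ‖pos (γ t)‖ = L ^ 2 := fun t => by
    rw [norm_pos_eq (hmem t) (hWne t)]; exact (hst t).1
  have hne : ∀ t, pos (γ t) ≠ 0 := fun t => by
    rw [← norm_ne_zero_iff, hnorm]; exact pow_ne_zero 2 hL0
  have hm0 : ∀ t, mom (γ t) 0 = pos (γ t) 1 / L ^ 3 := fun t => by
    obtain ⟨h1, -⟩ := hep t
    have e : mom (γ t) 0 = -(γ t).1 0 / (1 - (γ t).1 2) := rfl
    rw [(hst t).2.2] at h1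
    rw [e, hW]
    field_simp
    linear_combination -2 * h1
  have hm1 : ∀ t, mom (γ t) 1 = -(pos (γ t) 0 / L ^ 3) := fun t => by
    obtain ⟨-, h1, -⟩ := hep t
    have e : mom (γ t) 1 = -(γ t).1 1 / (1 - (γ t).1 2) := rfl
    rw [(hst t).2.2] at h1
    rw [e, hW]
    field_simp
    linear_combination -2 * h1
  -- Reeb time per unit of physical time: `1 / |q| + L` with `|q| = L²`. Being constant, it makes
  -- the change of time linear.
  obtain ⟨κ, hκ⟩ : ∃ κ, κ = 1 / L ^ 2 + L := ⟨_, rfl⟩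
  have hκ0 : κ ≠ 0 := by
    have : κ = (1 + L ^ 3) / L ^ 2 := by rw [hκ]; field_simp
    rw [this]; positivity
  have hscale : ∀ t, HasDerivAt (fun t => κ * t) κ t := fun t => by
    simpa using (hasDerivAt_id t).const_mul κ
  have hq0 : ∀ t, HasDerivAt (fun t => pos (γ (κ * t)) 0)
      ((1 / L ^ 3 + 1) * pos (γ (κ * t)) 1) t := fun t =>
    ((hder (κ * t)).1.comp t (hscale t)).congr_deriv (by rw [hκ]; field_simp)
  have hq1 : ∀ t, HasDerivAt (fun t => pos (γ (κ * t)) 1)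
      (-((1 / L ^ 3 + 1) * pos (γ (κ * t)) 0)) t := fun t =>
    ((hder (κ * t)).2.comp t (hscale t)).congr_deriv (by rw [hκ]; field_simp)
  refine ⟨fun t => pos (γ (κ * t)), fun t => mom (γ (κ * t)), ⟨⟨fun t => hne _, fun t => ?_,
    fun t => ?_⟩, fun t => ?_, fun t => ?_, L ^ 2, fun t => hnorm _⟩, ?_, fun t => ?_⟩
  · rw [gradient_momentum]
    refine hasDerivAt_plane_iff.2 ⟨?_, ?_⟩
    · exact (hq0 t).congr_deriv (by simp [hm0]; ring)
    · exact (hq1 t).congr_deriv (by simp [hm1]; ring)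
  · rw [gradient_position _ (hne _)]
    simp only [hnorm]
    refine hasDerivAt_plane_iff.2 ⟨?_, ?_⟩
    · simp only [hm0, hm1]
      exact ((hq1 t).div_const (L ^ 3)).congr_deriv (by simp; field_simp; ring)
    · simp only [hm0, hm1]
      exact ((hq0 t).div_const (L ^ 3)).neg.congr_deriv (by simp; field_simp; ring)
  · rw [← regularize_mem_level_iff (hne _), hreg]
    exact hlev _
  · rw [hreg]; exact (h _).1
  · unfold Traces
    simp only [hreg]
    ext z
    constructor
    · rintro ⟨t, rfl⟩
      exact ⟨t / κ, by change γ (κ * (t / κ)) = γ t; rw [mul_div_cancel₀ _ hκ0]⟩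
    · rintro ⟨t, rfl⟩
      exact ⟨κ * t, rfl⟩
  · rw [← ang_regularize, hreg, hL]


/-! ### The spectrum -/

theorem exists_nat_of_periodic {L T : ℝ} (hT : 0 < T) {n : ℤ}
    (h : T = 2 * Real.pi * L * n) : ∃ k : ℕ, 1 ≤ k ∧ T = 2 * Real.pi * |L| * k := by
  have hT' : T = 2 * Real.pi * |L| * |(n : ℝ)| := by
    rw [← abs_of_pos hT, h]
    simp only [abs_mul, abs_of_pos Real.pi_pos, abs_two]
  have hn : (0 : ℝ) < (|n| : ℤ) := by
    rw [Int.cast_abs]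
    refine abs_pos.2 fun h0 => ?_
    rw [h0, mul_zero] at h
    exact hT.ne' h
  obtain ⟨k, hk, hnk⟩ := exists_nat_of_int hn
  refine ⟨k, hk, ?_⟩
  rw [hT', ← Int.cast_abs, hnk]

/-- The circular Reeb orbits of angular momentum `L`. -/
theorem exists_circular_reeb {c L : ℝ} (hc : 3 / 2 < c) (hL : -1 < L)
    (h : 2 * (c + L) * L ^ 2 = 1) : ∃ γ : ℝ → Space × Space,
      (∀ t, γ t ∈ hypersurface c ∧ HasDerivAt γ (reeb c (γ t)) t) ∧ ∀ t, ang (γ t) = L := by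
  have hΛ : 0 < 2 * (c + L) := by linarith
  obtain ⟨γ, h1, h2, -⟩ := exists_orbit hc hL (Real.sqrt_pos.2 hΛ) (Real.sq_sqrt hΛ.le) le_rfl
    (by rw [Real.sq_sqrt hΛ.le, h]; norm_num)
  exact ⟨γ, h1, h2⟩

theorem exists_circular {c L : ℝ} (hc : 3 / 2 < c) (hL : -1 < L)
    (h : 2 * (c + L) * L ^ 2 = 1) : ∃ (γ : ℝ → Space × Space) (q p : ℝ → Plane),
      (∀ n : ℕ, 1 ≤ n → IsClosedReebOrbit (hypersurface c) γ (2 * Real.pi * |L| * n)) ∧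
      IsCircularOrbit c q p ∧ Traces γ q p ∧ ∀ t, angular (q t) (p t) = L := by
  obtain ⟨γ, h1, h2⟩ := exists_circular_reeb hc hL h
  obtain ⟨q, p, h3, h4, h5⟩ := exists_circular_of_reeb hc h1 (by rw [h2]; exact h)
  rw [h2] at h5
  have hL0 : L ≠ 0 := by rintro rfl; norm_num at h
  refine ⟨γ, q, p, fun n hn => ⟨(isReebOrbit_iff hc).2 h1, ?_, ?_⟩, h3, h4, h5⟩
  · have : (0 : ℝ) < n := by exact_mod_cast hn
    positivity
  · rw [circular_periodic_iff hc h1 (by rw [h2]; exact h), h2]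
    rcases hL0.lt_or_gt with h0 | h0
    · exact ⟨-n, by rw [abs_of_neg h0]; push_cast; ring⟩
    · exact ⟨n, by rw [abs_of_pos h0]; push_cast; ring⟩

theorem circular_period {c T : ℝ} (hc : 3 / 2 < c) {γ : ℝ → Space × Space}
    (h : IsClosedReebOrbit (hypersurface c) γ T)
    (hcirc : 2 * (c + ang (γ 0)) * ang (γ 0) ^ 2 = 1) :
    ∃ k : ℕ, 1 ≤ k ∧ T = 2 * Real.pi * |ang (γ 0)| * k := by
  have h1 := (isReebOrbit_iff hc).1 h.1
  obtain ⟨n, hn⟩ := (circular_periodic_iff hc h1 hcirc).1 h.2.2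
  exact exists_nat_of_periodic h.2.1 hn

theorem IsCircularOrbit.ang_of_traces {c : ℝ} (hc : 3 / 2 < c) {γ : ℝ → Space × Space}
    {q p : ℝ → Plane} (h : IsCircularOrbit c q p) (ht : Traces γ q p) :
    2 * (c + ang (γ 0)) * ang (γ 0) ^ 2 = 1 ∧ angular (q 0) (p 0) = ang (γ 0) := by
  obtain ⟨L, -, h2, h3⟩ := h.exists_ang hc
  have : γ 0 ∈ Set.range (fun t => regularize (q t) (p t)) := ht ▸ Set.mem_range_self 0
  obtain ⟨t, ht⟩ := this
  have h4 : ang (γ 0) = L := by rw [← ht, ang_regularize]; exact (h3 t).1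
  rw [h4]
  exact ⟨h2, (h3 0).1⟩

/-- The periods of the closed Reeb orbits that trace a circular orbit of angular momentum `L`. -/
theorem circular_spectrum {c L : ℝ} (hc : 3 / 2 < c) (hL : -1 < L)
    (h : 2 * (c + L) * L ^ 2 = 1) {P : (ℝ → Plane) → (ℝ → Plane) → Prop}
    (hP : ∀ q p, P q p ↔ IsCircularOrbit c q p ∧ ∀ t, angular (q t) (p t) = L) :
    {T : ℝ | ∃ γ q p, IsClosedReebOrbit (hypersurface c) γ T ∧ P q p ∧ Traces γ q p} =
      {a : ℝ | ∃ n : ℕ, 1 ≤ n ∧ a = 2 * Real.pi * |L| * n} := by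
  ext T
  constructor
  · rintro ⟨γ, q, p, h1, h2, h3⟩
    obtain ⟨h4, h5⟩ := (hP q p).1 h2
    obtain ⟨h6, h7⟩ := h4.ang_of_traces hc h3
    rw [h5] at h7
    obtain ⟨k, hk, hT⟩ := circular_period hc h1 h6
    exact ⟨k, hk, by rw [hT, h7]⟩
  · rintro ⟨n, hn, rfl⟩
    obtain ⟨γ, q, p, h1, h2, h3, h4⟩ := exists_circular hc hL h
    exact ⟨γ, q, p, h1 n hn, (hP q p).2 ⟨h2, h4⟩, h3⟩

/-- The periods of the closed Reeb orbits that trace no circular orbit. -/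
theorem noncircular_spectrum {c LR LD : ℝ} (hc : 3 / 2 < c)
    (hR : 0 < LR ∧ c = 1 / (2 * LR ^ 2) - LR)
    (hD : -1 < LD ∧ LD < 0 ∧ c = 1 / (2 * LD ^ 2) - LD) :
    {T : ℝ | ∃ γ, IsClosedReebOrbit (hypersurface c) γ T ∧
        ∀ q p, IsCircularOrbit c q p → ¬ Traces γ q p} =
      {a : ℝ | ∃ k l : ℕ, 1 ≤ l ∧ l < k ∧ LR ^ 3 < (l : ℝ) / k ∧ (l : ℝ) / k < -LD ^ 3 ∧
        a = 2 * Real.pi * (-l * c + 3 / 2 * (k : ℝ) ^ (2 / 3 : ℝ) * (l : ℝ) ^ (1 / 3 : ℝ))} := by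
  ext T
  rw [Set.mem_ofPred_eq, Set.mem_ofPred_eq, exists_frequency_iff hR hD]
  constructor
  · rintro ⟨γ, h1, h2⟩
    have h3 := (isReebOrbit_iff hc).1 h1.1
    have hne : 2 * (c + ang (γ 0)) * ang (γ 0) ^ 2 ≠ 1 := fun h4 => by
      obtain ⟨q, p, h5, h6, -⟩ := exists_circular_of_reeb hc h3 h4
      exact h2 q p h5 h6
    -- The squared length of the Runge-Lenz vector is nonnegative, so the eccentricity is real.
    have hlt : 2 * (c + ang (γ 0)) * ang (γ 0) ^ 2 < 1 := by
      refine lt_of_le_of_ne ?_ hne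
      have := lenz_sq (hypersurface_subset_level hc (h3 0).1)
      nlinarith [sq_nonneg (lenz c (γ 0) 0), sq_nonneg (lenz c (γ 0) 1)]
    obtain ⟨k, l, hk, hl, w, hw, hw2, hkl, hT⟩ := noncircular_period hc h3 h1.2.1 h1.2.2 hne
    exact ⟨k, l, hk, hl, w, ang (γ 0), hw, hw2,
      (cubic_lt_one_iff hc hR hD (neg_one_lt_ang hc (h3 0).1)).1 hlt, hkl, hT⟩
  · rintro ⟨k, l, hk, hl, w, L, hw, hw2, hL, hkl, rfl⟩
    have hL1 : -1 < L := hD.1.trans hL.1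
    have hlt := (cubic_lt_one_iff hc hR hD hL1).2 hL
    have he : 0 ≤ 1 - w ^ 2 * L ^ 2 := by rw [hw2]; linarith
    obtain ⟨γ, h1, h2, h3⟩ := exists_orbit hc hL1 hw hw2 (Real.sqrt_nonneg _) (Real.sq_sqrt he)
    refine ⟨γ, ⟨(isReebOrbit_iff hc).2 h1, ?_, h3 k l hkl⟩, fun q p h4 h5 => ?_⟩
    · have hl' : (0 : ℝ) < l := by exact_mod_cast hl
      have e : (k : ℝ) / w + l * L = l * (w ^ 2 + L) := by rw [hkl]; field_simp
      rw [e, hw2]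
      have : 0 < 2 * (c + L) + L := by linarith
      positivity
    · have := (h4.ang_of_traces hc h5).1
      rw [h2] at this
      linarith

theorem actionSpectrum_eq_union {c LR LD : ℝ} (hc : 3 / 2 < c)
    (hR : 0 < LR ∧ c = 1 / (2 * LR ^ 2) - LR)
    (hD : -1 < LD ∧ LD < 0 ∧ c = 1 / (2 * LD ^ 2) - LD) :
    actionSpectrum (hypersurface c) =
      {a : ℝ | ∃ n : ℕ, 1 ≤ n ∧ a = 2 * Real.pi * |LR| * n} ∪
      {a : ℝ | ∃ n : ℕ, 1 ≤ n ∧ a = 2 * Real.pi * |LD| * n} ∪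
      {T : ℝ | ∃ γ, IsClosedReebOrbit (hypersurface c) γ T ∧
        ∀ q p, IsCircularOrbit c q p → ¬ Traces γ q p} := by
  ext T
  constructor
  · rintro ⟨γ, hγ⟩
    by_cases h : ∀ q p, IsCircularOrbit c q p → ¬ Traces γ q p
    · exact Or.inr ⟨γ, hγ, h⟩
    · push Not at h
      obtain ⟨q, p, h1, h2⟩ := h
      have h3 := (h1.ang_of_traces hc h2).1
      obtain ⟨k, hk, hT⟩ := circular_period hc hγ h3
      left
      rcases eq_or_eq_of_cubic_eq_one hc hR hD (neg_one_lt_ang hc (hγ.1.mem 0)) h3 with h4 | h4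
      · exact Or.inl ⟨k, hk, by rw [hT, h4]⟩
      · exact Or.inr ⟨k, hk, by rw [hT, h4]⟩
  · rintro ((⟨n, hn, rfl⟩ | ⟨n, hn, rfl⟩) | ⟨γ, h, -⟩)
    · obtain ⟨γ, -, -, h, -⟩ := exists_circular hc (by linarith)
        ((eq_iff_of_ne_zero hR.1.ne').1 hR.2)
      exact ⟨γ, h n hn⟩
    · obtain ⟨γ, -, -, h, -⟩ := exists_circular hc hD.1 ((eq_iff_of_ne_zero hD.2.1.ne).1 hD.2.2)
      exact ⟨γ, h n hn⟩
    · exact ⟨γ, h⟩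

theorem isRetrograde_iff {c LR LD : ℝ} (hc : 3 / 2 < c)
    (hR : 0 < LR ∧ c = 1 / (2 * LR ^ 2) - LR)
    (hD : -1 < LD ∧ LD < 0 ∧ c = 1 / (2 * LD ^ 2) - LD) (q p : ℝ → Plane) :
    IsRetrograde c q p ↔ IsCircularOrbit c q p ∧ ∀ t, angular (q t) (p t) = LR := by
  refine and_congr_right fun h => ?_
  obtain ⟨L, h1, h2, h3⟩ := h.exists_ang hc
  constructor
  · intro h4 t
    have h5 := h4 t
    rw [(h3 t).1] at h5 ⊢
    rcases eq_or_eq_of_cubic_eq_one hc hR hD h1 h2 with h6 | h6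
    · exact h6
    · linarith [hD.2.1]
  · intro h4 t
    rw [h4]; exact hR.1

theorem isDirect_iff {c LR LD : ℝ} (hc : 3 / 2 < c)
    (hR : 0 < LR ∧ c = 1 / (2 * LR ^ 2) - LR)
    (hD : -1 < LD ∧ LD < 0 ∧ c = 1 / (2 * LD ^ 2) - LD) (q p : ℝ → Plane) :
    IsDirect c q p ↔ IsCircularOrbit c q p ∧ ∀ t, angular (q t) (p t) = LD := by
  refine and_congr_right fun h => ?_
  obtain ⟨L, h1, h2, h3⟩ := h.exists_ang hc
  constructor
  · intro h4 t
    have h5 := h4 t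
    rw [(h3 t).1] at h5 ⊢
    rcases eq_or_eq_of_cubic_eq_one hc hR hD h1 h2 with h6 | h6
    · linarith [hR.1]
    · exact h6
  · intro h4 t
    rw [h4]; exact hD.2.1

theorem IsCircularOrbit.geometry {c L : ℝ} (hc : 3 / 2 < c) {q p : ℝ → Plane}
    (h : IsCircularOrbit c q p) (hL : ∀ t, angular (q t) (p t) = L) :
    ∀ t, ‖q t‖ = L ^ 2 ∧ p t 0 = q t 1 / L ^ 3 ∧ p t 1 = -(q t 0 / L ^ 3) := by
  obtain ⟨L', -, -, h3⟩ := h.exists_ang hc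
  have : L' = L := by rw [← (h3 0).1, hL]
  rw [this] at h3
  exact fun t => (h3 t).2

end RotatingKepler

end

/-! ### The proposition, assembled from the spectra of the three kinds of orbits. -/

theorem proposition3p2 (c : ℝ) (hc : 3 / 2 < c) :
    (∃! x : ℝ, 0 < x ∧ c = 1 / (2 * x ^ 2) - x) ∧
    (∃! x : ℝ, -1 < x ∧ x < 0 ∧ c = 1 / (2 * x ^ 2) - x) ∧
    ∀ LR LD : ℝ, (0 < LR ∧ c = 1 / (2 * LR ^ 2) - LR) →
      (-1 < LD ∧ LD < 0 ∧ c = 1 / (2 * LD ^ 2) - LD) →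
      -- the action spectrum
      RotatingKepler.actionSpectrum (RotatingKepler.hypersurface c) =
        {a : ℝ | ∃ n : ℕ, 1 ≤ n ∧ a = 2 * Real.pi * LR * n} ∪
        {a : ℝ | ∃ n : ℕ, 1 ≤ n ∧ a = -2 * Real.pi * LD * n} ∪
        {a : ℝ | ∃ k l : ℕ, 1 ≤ l ∧ l < k ∧ LR ^ 3 < (l : ℝ) / k ∧ (l : ℝ) / k < -LD ^ 3 ∧
          a = 2 * Real.pi *
            (-l * c + 3 / 2 * (k : ℝ) ^ (2 / 3 : ℝ) * (l : ℝ) ^ (1 / 3 : ℝ))} ∧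
      -- the actions of the retrograde and of the direct orbit
      (∃ (q p : ℝ → RotatingKepler.Plane) (T : ℝ),
        RotatingKepler.IsRetrograde c q p ∧ RotatingKepler.IsSimplePeriod q p T) ∧
      (∀ (q p : ℝ → RotatingKepler.Plane) (T : ℝ),
        RotatingKepler.IsRetrograde c q p → RotatingKepler.IsSimplePeriod q p T →
          RotatingKepler.action q p T = 2 * Real.pi * LR) ∧
      (∃ (q p : ℝ → RotatingKepler.Plane) (T : ℝ),
        RotatingKepler.IsDirect c q p ∧ RotatingKepler.IsSimplePeriod q p T) ∧
      (∀ (q p : ℝ → RotatingKepler.Plane) (T : ℝ),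
        RotatingKepler.IsDirect c q p → RotatingKepler.IsSimplePeriod q p T →
          RotatingKepler.action q p T = -2 * Real.pi * LD) ∧
      -- the three parts: covers of the retrograde orbit, covers of the direct orbit, other orbits
      {T : ℝ | ∃ γ q p, RotatingKepler.IsClosedReebOrbit (RotatingKepler.hypersurface c) γ T ∧
          RotatingKepler.IsRetrograde c q p ∧ RotatingKepler.Traces γ q p} =
        {a : ℝ | ∃ n : ℕ, 1 ≤ n ∧ a = 2 * Real.pi * LR * n} ∧
      {T : ℝ | ∃ γ q p, RotatingKepler.IsClosedReebOrbit (RotatingKepler.hypersurface c) γ T ∧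
          RotatingKepler.IsDirect c q p ∧ RotatingKepler.Traces γ q p} =
        {a : ℝ | ∃ n : ℕ, 1 ≤ n ∧ a = -2 * Real.pi * LD * n} ∧
      {T : ℝ | ∃ γ, RotatingKepler.IsClosedReebOrbit (RotatingKepler.hypersurface c) γ T ∧
          ∀ q p, RotatingKepler.IsCircularOrbit c q p → ¬ RotatingKepler.Traces γ q p} =
        {a : ℝ | ∃ k l : ℕ, 1 ≤ l ∧ l < k ∧ LR ^ 3 < (l : ℝ) / k ∧ (l : ℝ) / k < -LD ^ 3 ∧
          a = 2 * Real.pi *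
            (-l * c + 3 / 2 * (k : ℝ) ^ (2 / 3 : ℝ) * (l : ℝ) ^ (1 / 3 : ℝ))} := by
  refine ⟨RotatingKepler.existsUnique_retrograde hc, RotatingKepler.existsUnique_direct hc, ?_⟩
  intro LR LD hR hD
  have hRm : -1 < LR := by linarith [hR.1]
  have hR1 := (RotatingKepler.eq_iff_of_ne_zero hR.1.ne').1 hR.2
  have hD1 := (RotatingKepler.eq_iff_of_ne_zero hD.2.1.ne).1 hD.2.2
  have hRa : |LR| = LR := abs_of_pos hR.1
  have hDa : 2 * Real.pi * |LD| = -2 * Real.pi * LD := by rw [abs_of_neg hD.2.1]; ring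
  have hret := RotatingKepler.isRetrograde_iff hc hR hD
  have hdir := RotatingKepler.isDirect_iff hc hR hD
  rw [RotatingKepler.actionSpectrum_eq_union hc hR hD,
    RotatingKepler.circular_spectrum hc hRm hR1 hret,
    RotatingKepler.circular_spectrum hc hD.1 hD1 hdir,
    RotatingKepler.noncircular_spectrum hc hR hD, hRa, hDa]
  refine ⟨rfl, ?_, ?_, ?_, ?_, rfl, rfl, rfl⟩
  · obtain ⟨-, q, p, -, h1, -, h2⟩ := RotatingKepler.exists_circular hc hRm hR1
    exact ⟨q, p, _, (hret q p).2 ⟨h1, h2⟩, h1.isSimplePeriod hRm hR.1.ne' (h1.geometry hc h2)⟩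
  · intro q p T h hT
    obtain ⟨h1, h2⟩ := (hret q p).1 h
    rw [h1.action_eq hRm hR.1.ne' (h1.geometry hc h2) hT, hRa]
  · obtain ⟨-, q, p, -, h1, -, h2⟩ := RotatingKepler.exists_circular hc hD.1 hD1
    exact ⟨q, p, _, (hdir q p).2 ⟨h1, h2⟩, h1.isSimplePeriod hD.1 hD.2.1.ne (h1.geometry hc h2)⟩
  · intro q p T h hT
    obtain ⟨h1, h2⟩ := (hdir q p).1 h
    rw [h1.action_eq hD.1 hD.2.1.ne (h1.geometry hc h2) hT, hDa]
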